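/- Let $\alpha_0,\gamma_0,\overline{\mu},\eta_0>0$ and $\overline{\lambda}\in\mathbb{R}$. There is a constant $\mathcal{C}>0$, depending only on $\alpha_0,\gamma_0,\overline{\lambda},\overline{\mu},\eta_0$, with the following property. Let $(\lambda,\mu)$ and $(\lambda^I,\mu^I)$ be two pairs of constant Lamé moduli, both satisfying $\alpha_0\le\mu\le\overline{\mu}$, $2\mu+3\lambda\ge\gamma_0$, $\lambda\le\overline{\lambda}$ (and likewise for $\lambda^I,\mu^I$), and such that $(\lambda-\lambda^I)^2+(\mu-\mu^I)^2\ge\eta_0^2$. Let $\mathbb{C}$ and $\mathbb{C}^I$ be the isotropic elasticity tensors with these moduli, i.e. $C_{ijkl}=\lambda\delta_{ij}\delta_{kl}+\mu(\delta_{ki}\delta_{lj}+\delta_{li}\delta_{kj})$ and similarly for $\mathbb{C}^I$, and let $\chi_+$ be the characteristic function of $\mathbb{R}^3_+=\{x\in\mathbb{R}^3 : x_3>0\}$. Let $\Gamma^+$ be the normalized fundamental matrix of the operator $\mathrm{div}((\mathbb{C}+(\mathbb{C}^I-\mathbb{C})\chi_+)\nabla\,\cdot)$: for a pole $y$, $\Gamma^+(\cdot,y)$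 is a $3\times3$-matrix-valued function, continuous on $\mathbb{R}^3\setminus\{y\}$, such that for every $l\in\mathbb{R}^3$ with $|l|=1$ the field $u=\Gamma^+(\cdot,y)l$ belongs to $L^1_{loc}(\mathbb{R}^3,\mathbb{R}^3)$, has a weak gradient in $L^1_{loc}$, tends to $0$ as $|x|\to\infty$, and satisfies $$\int_{\mathbb{R}^3}(\mathbb{C}+(\mathbb{C}^I-\mathbb{C})\chi_+)\nabla u\cdot\nabla\varphi\,dx=l\cdot\varphi(y)\qquad\text{for every }\varphi\in C_c^\infty(\mathbb{R}^3,\mathbb{R}^3).$$ Let $\Gamma$ be the Kelvin fundamental matrix with moduli $\lambda,\mu$: with $\nu=\frac{\lambda}{2(\lambda+\mu)}$, $$\Gamma(x,y)=\frac{1}{16\pi\mu(1-\nu)}\,\frac{1}{|x-y|}\left(\frac{(x-y)\otimes(x-y)}{|x-y|^2}+(3-4\nu)\,\mathrm{Id}\right).$$ Let $e_1,e_2,e_3$ be the canonical basis of $\mathbb{R}^3$ and $y_0=(0,0,-1)$. Then for every $i\in\{1,2,3\}$ there exists $\lambda_w\in\{\tfrac23,\tfrac34,\tfrac45\}$ such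 that, with $w_0=(0,0,-\lambda_w)$, the fundamental matrix $\Gamma^+(\cdot,w_0)$ exists and $$\left|(\Gamma^+(y_0,w_0)-\Gamma(y_0,w_0))e_i\cdot e_i\right|\ge\mathcal{C}.$$ -/

import Mathlib

open MeasureTheory Filter Topology
open scoped ContDiff

noncomputable section

namespace LameSystem

/-- Euclidean three-space. -/
abbrev R3 : Type := EuclideanSpace ℝ (Fin 3)

/-- The canonical basis vectors. -/
def e (i : Fin 3) : R3 := EuclideanSpace.single i (1 : ℝ)

/-- Components `C_ijkl = lam δ_ij δ_kl + mu (δ_ki δ_lj + δ_li δ_kj)` of the isotropic elasticity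
tensor with Lamé moduli `lam`, `mu`. -/
def elasticityTensor (lam mu : ℝ) (i j k l : Fin 3) : ℝ :=
  lam * ((if i = j then 1 else 0) * (if k = l then 1 else 0)) +
    mu * ((if k = i then 1 else 0) * (if l = j then 1 else 0) +
      (if l = i then 1 else 0) * (if k = j then 1 else 0))

/-- The action `(ℂ A)_ij = ∑_kl C_ijkl A_kl` of the elasticity tensor on matrices. -/
def elasticityAction (lam mu : ℝ) (A : Matrix (Fin 3) (Fin 3) ℝ) : Matrix (Fin 3) (Fin 3) ℝ :=
  fun i j => ∑ k, ∑ l, elasticityTensor lam mu i j k l * A k l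

/-- The product `A · B = ∑_ij A_ij B_ij` of matrices. -/
def matrixDot (A B : Matrix (Fin 3) (Fin 3) ℝ) : ℝ := ∑ i, ∑ j, A i j * B i j

/-- The classical gradient `(∇φ)_ij = ∂_j φ_i` of a differentiable vector field. -/
def grad (φ : R3 → R3) (x : R3) : Matrix (Fin 3) (Fin 3) ℝ :=
  fun i j => fderiv ℝ φ x (e j) i

/-- `V` is a locally integrable weak gradient of the vector field `u`: `V_ij = ∂_j u_i` in the
sense of distributions on the whole space. -/
def HasWeakGradient (u : R3 → R3) (V : R3 → Matrix (Fin 3) (Fin 3) ℝ) : Prop :=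
  (∀ i j, LocallyIntegrable (fun x => V x i j) volume) ∧
    ∀ i j, ∀ ψ : R3 → ℝ, ContDiff ℝ ∞ ψ → HasCompactSupport ψ →
      ∫ x, u x i * fderiv ℝ ψ x (e j) = - ∫ x, V x i j * ψ x

open Classical in
/-- The piecewise constant tensor `ℂ + (ℂ^I - ℂ) χ_D` at the point `x`, acting on matrices: `ℂ` has
moduli `lam`, `mu` and `ℂ^I` has moduli `lamI`, `muI`. -/
def inclusionAction (lam mu lamI muI : ℝ) (D : Set R3) (x : R3)
    (A : Matrix (Fin 3) (Fin 3) ℝ) : Matrix (Fin 3) (Fin 3) ℝ :=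
  if x ∈ D then elasticityAction lamI muI A else elasticityAction lam mu A

/-- `u` is a normalized fundamental solution with pole `y` and concentrated force `l` for the
operator `div ((ℂ + (ℂ^I - ℂ) χ_D) ∇ ·)`: a locally integrable, weakly differentiable field with
`∫ (ℂ + (ℂ^I - ℂ) χ_D) ∇u · ∇φ = l · φ(y)` for every test field `φ`, vanishing at infinity. -/
def IsFundamentalSolution (lam mu lamI muI : ℝ) (D : Set R3) (y l : R3) (u : R3 → R3) : Prop :=
  LocallyIntegrable u volume ∧
    (∃ V : R3 → Matrix (Fin 3) (Fin 3) ℝ, HasWeakGradient u V ∧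
      ∀ φ : R3 → R3, ContDiff ℝ ∞ φ → HasCompactSupport φ →
        ∫ x, matrixDot (inclusionAction lam mu lamI muI D x (V x)) (grad φ x)
          = inner ℝ l (φ y)) ∧
    Tendsto u (cocompact R3) (𝓝 0)

/-- `G` is a normalized fundamental matrix with pole `y`: it is continuous away from the pole, and
`x ↦ G(x) l` is a normalized fundamental solution for every unit force `l`. -/
def IsFundamentalMatrix (lam mu lamI muI : ℝ) (D : Set R3) (y : R3)
    (G : R3 → R3 →L[ℝ] R3) : Prop :=
  ContinuousOn G {y}ᶜ ∧
    ∀ l : R3, ‖l‖ = 1 → IsFundamentalSolution lam mu lamI muI D y l (fun x => G x l)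

open Classical in
/-- The normalized fundamental matrix `Γ^D(x, y)` with pole `y`. -/
def fundamentalMatrix (lam mu lamI muI : ℝ) (D : Set R3) (x y : R3) : R3 →L[ℝ] R3 :=
  if h : ∃ G : R3 → R3 →L[ℝ] R3, IsFundamentalMatrix lam mu lamI muI D y G then h.choose x else 0

/-- The open upper half space `{x_3 > 0}`. -/
def upperHalfSpace : Set R3 := {x | 0 < x 2}

/-- Poisson's ratio. -/
def poissonRatio (lam mu : ℝ) : ℝ := lam / (2 * (lam + mu))

/-- The Kelvin fundamental matrix of the homogeneous Lamé operator,
`1 / (16 π mu (1 - ν)) · 1 / |x - y| · ((x - y) ⊗ (x - y) / |x - y|² + (3 - 4 ν) Id)`. -/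
def kelvinMatrix (lam mu : ℝ) (x y : R3) : R3 →L[ℝ] R3 :=
  (1 / (16 * Real.pi * mu * (1 - poissonRatio lam mu)) * (1 / ‖x - y‖)) •
    ((1 / ‖x - y‖ ^ 2) • (innerSL ℝ (x - y)).smulRight (x - y) +
      (3 - 4 * poissonRatio lam mu) • ContinuousLinearMap.id ℝ R3)

/-- The bounds `mu ≥ α₀`, `2 mu + 3 lam ≥ γ₀`, `mu ≤ muBar`, `lam ≤ lamBar` on the Lamé moduli. -/
def ModuliBounds (α₀ γ₀ muBar lamBar lam mu : ℝ) : Prop :=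
  α₀ ≤ mu ∧ γ₀ ≤ 2 * mu + 3 * lam ∧ mu ≤ muBar ∧ lam ≤ lamBar

end LameSystem

end

open LameSystem

/-! The two-phase fundamental matrix is known in closed form on the lower side, and on the vertical
axis its difference from the Kelvin matrix is a simple function of the height of the pole.

Explicit field. Let `X = t log(|p| + t) - |p|`, where `p` is the position relative to the pole and
`t` its vertical component. Above the pole `X` is harmonic and `|p| = t ∂₃X - X`, so the Kelvin
field, a combination of second derivatives of `|p|`, splits there into three solutions built from
harmonic functions: a gradient, an Almansi field and a horizontal solenoidal field
(`kelvinField_eq_upField`). On the interface an Almansi field has the trace of the gradient of the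
mirrored potential, and proportional tractions. Reflection therefore exchanges the first two types
and preserves the third, and the transmission conditions decouple into three scalar equations for
amplitudes `p`, `q`, `r` (`displacement_match`, `traction_match`), solved by `reflP`, `reflQ`,
`reflR`.

Existence. Replacing `|p|` near the pole by a smooth function gives smooth transmission fields with
a regularised force. They satisfy bounds uniform in the regularisation, and the limit is a
fundamental solution (`IsApproximation.isFundamentalSolution`, `exists_isFundamentalMatrix`).

Identification. `fundamentalMatrix` is an arbitrary choice, so its values have to be derived from
the defining properties alone. Betti reciprocity does this: any fundamental solution with pole `y`
is paired with the regularised explicit field with pole `z`. Vanishing at infinity removes the far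
boundary terms (`IsTransmission.pairing`), and continuity at `z` gives the value there as the
explicit field evaluated at `y` (`IsFundamentalSolution.apply_eq`).

Lower bound. With explicit pole `y₀` and evaluation point `(0, 0, -h)`, the diagonal entries of `Γ⁺
- Γ` are `axisValue / (1 + h)`, and `axisValue` is affine in `h / (1 + h)²` with slope a nonzero
multiple of `p`. If it vanished at both `2/3` and `3/4`, then `p = 0`, hence `μ = μᴵ` and `r = 0`,
then `q = 0`, hence `λ = λᴵ` (`axisValue_ne_zero`). The admissible moduli form a compact set on
which `axisValue` is continuous, which makes the bound uniform (`exists_pos_le_axisValue`). Two of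
the three permitted heights are enough. -/

namespace LameSystem

noncomputable section

/-! ### Calculus of smooth functions, and smooth interpolation across the interface -/

section

/-- The subalgebra of smooth functions among all scalar functions on `ℝ³`. -/
def smoothSubalgebra : Subalgebra ℝ (R3 → ℝ) where
  carrier := {f | ContDiff ℝ ∞ f}
  mul_mem' {a b} (hf : ContDiff ℝ ∞ a) (hg : ContDiff ℝ ∞ b) := hf.mul hg
  add_mem' {a b} (hf : ContDiff ℝ ∞ a) (hg : ContDiff ℝ ∞ b) := hf.add hg
  algebraMap_mem' r := (contDiff_const : ContDiff ℝ ∞ (fun _ : R3 => r))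

/-- The algebra of smooth scalar functions on `ℝ³`. -/
def Smooth3 : Type := smoothSubalgebra

instance : CommRing Smooth3 := inferInstanceAs (CommRing smoothSubalgebra)
instance : Algebra ℝ Smooth3 := inferInstanceAs (Algebra ℝ smoothSubalgebra)

/-- The underlying function. -/
@[coe] def Smooth3.toFun (f : Smooth3) : R3 → ℝ := Subtype.val (p := (· ∈ smoothSubalgebra)) f

instance : CoeFun Smooth3 (fun _ => R3 → ℝ) := ⟨Smooth3.toFun⟩

/-- A smooth function as an element of the algebra. -/
def Smooth3.of (f : R3 → ℝ) (h : ContDiff ℝ ∞ f) : Smooth3 := ⟨f, h⟩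

namespace Smooth3

variable (f g : Smooth3) (x : R3)

theorem contDiff : ContDiff ℝ ∞ f := f.2
theorem differentiable : Differentiable ℝ f := f.contDiff.differentiable (by simp)
theorem continuous : Continuous f := f.contDiff.continuous

@[ext] theorem ext {f g : Smooth3} (h : ∀ x, f x = g x) : f = g := Subtype.ext (funext h)

@[simp] theorem add_apply : (f + g) x = f x + g x := rfl
@[simp] theorem sub_apply : (f - g) x = f x - g x := rfl
@[simp] theorem neg_apply : (-f) x = -f x := rfl
@[simp] theorem mul_apply : (f * g) x = f x * g x := rfl
@[simp] theorem smul_apply (c : ℝ) : (c • f) x = c * f x := rfl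
@[simp] theorem zero_apply : (0 : Smooth3) x = 0 := rfl
@[simp] theorem one_apply : (1 : Smooth3) x = 1 := rfl
@[simp] theorem sum_apply {ι : Type*} (s : Finset ι) (F : ι → Smooth3) :
    (∑ i ∈ s, F i) x = ∑ i ∈ s, F i x := by
  classical
  induction s using Finset.induction_on with
  | empty => rfl
  | insert a s ha ih => rw [Finset.sum_insert ha, Finset.sum_insert ha, add_apply, ih]

end Smooth3

/-- The partial derivative `∂_j` on smooth functions. -/
def D (j : Fin 3) : Derivation ℝ Smooth3 Smooth3 :=
  Derivation.mk'
    { toFun := fun f => .of (fun x => fderiv ℝ f x (e j))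
        ((f.contDiff.fderiv_right (m := ∞) (by simp)).clm_apply contDiff_const)
      map_add' := fun f g => by
        ext x
        change fderiv ℝ ((f : R3 → ℝ) + (g : R3 → ℝ)) x (e j) = _
        rw [fderiv_add (f.differentiable x) (g.differentiable x)]; rfl
      map_smul' := fun c f => by
        ext x
        change fderiv ℝ (c • (f : R3 → ℝ)) x (e j) = _
        rw [fderiv_const_smul (f.differentiable x)]; rfl }
    (fun f g => by
      ext x
      change fderiv ℝ ((f : R3 → ℝ) * (g : R3 → ℝ)) x (e j) = f x * _ + g x * _
      rw [fderiv_mul (f.differentiable x) (g.differentiable x)]; rfl)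

theorem D_apply (j : Fin 3) (f : Smooth3) (x : R3) : D j f x = fderiv ℝ f x (e j) := rfl

/-- With this and the Leibniz rule, differential identities reduce to commutative algebra:
derivatives are put in a fixed order and `ring` or `linear_combination` concludes. -/
theorem D_comm (i j : Fin 3) (f : Smooth3) : D i (D j f) = D j (D i f) := by
  ext x
  have h : ∀ k l : Fin 3, D k (D l f) x = fderiv ℝ (fderiv ℝ (f : R3 → ℝ)) x (e k) (e l) := by
    intro k l
    have hd : DifferentiableAt ℝ (fderiv ℝ (f : R3 → ℝ)) x :=
      ((f.contDiff.fderiv_right (m := ∞) (by simp)).differentiable (by simp)) x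
    rw [D_apply]
    change fderiv ℝ (fun y => fderiv ℝ (f : R3 → ℝ) y (e l)) x (e k) = _
    rw [fderiv_clm_apply hd (differentiableAt_const _)]
    simp
  rw [h, h]
  exact (f.contDiff.contDiffAt.isSymmSndFDerivAt
    (by rw [minSmoothness_of_isRCLikeNormedField]; exact WithTop.coe_le_coe.2 le_top)).eq _ _

theorem D_eq_of_hasFDerivAt {f : Smooth3} {x : R3} {L : R3 →L[ℝ] ℝ} (j : Fin 3)
    (h : HasFDerivAt (f : R3 → ℝ) L x) : D j f x = L (e j) := by
  rw [D_apply, h.fderiv]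

theorem D_congr {f g : R3 → ℝ} {U : Set R3} (hU : IsOpen U) (h : ∀ x ∈ U, f x = g x)
    {x : R3} (hx : x ∈ U) : fderiv ℝ f x = fderiv ℝ g x :=
  Filter.EventuallyEq.fderiv_eq (Filter.eventually_of_mem (hU.mem_nhds hx) h)

theorem D_congr_on {f g : Smooth3} {U : Set R3} (hU : IsOpen U) (h : ∀ x ∈ U, f x = g x)
    (j : Fin 3) : ∀ x ∈ U, D j f x = D j g x := fun x hx => by
  rw [D_apply, D_apply, D_congr hU h hx]

theorem D_zero_on {f : Smooth3} {U : Set R3} (hU : IsOpen U) (h : ∀ x ∈ U, f x = 0)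
    (j : Fin 3) : ∀ x ∈ U, D j f x = 0 := fun x hx => by
  have := D_congr_on (g := 0) hU h j x hx
  simpa using this

/-- The coordinate function `x_i`. -/
def coord (i : Fin 3) : Smooth3 :=
  .of (fun x => x i) (EuclideanSpace.proj i : R3 →L[ℝ] ℝ).contDiff

@[simp] theorem coord_apply (i : Fin 3) (x : R3) : coord i x = x i := rfl

@[simp] theorem D_coord (i j : Fin 3) : D j (coord i) = if i = j then 1 else 0 := by
  ext x
  have : HasFDerivAt (coord i : R3 → ℝ) (EuclideanSpace.proj i : R3 →L[ℝ] ℝ) x :=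
    (EuclideanSpace.proj i : R3 →L[ℝ] ℝ).hasFDerivAt
  rw [D_eq_of_hasFDerivAt j this]
  by_cases h : i = j <;> simp [e, h]

/-- The diagonal affine map `x ↦ (s_i x_i + b_i)_i`. -/
def diagMap (s b : Fin 3 → ℝ) (x : R3) : R3 := WithLp.toLp 2 (fun i => s i * x i + b i)

@[simp] theorem diagMap_apply (s b : Fin 3 → ℝ) (x : R3) (i : Fin 3) :
    diagMap s b x i = s i * x i + b i := rfl

theorem contDiff_diagMap (s b : Fin 3 → ℝ) : ContDiff ℝ ∞ (diagMap s b) := by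
  rw [contDiff_euclidean]
  intro i
  exact ((coord i).contDiff.const_smul (s i)).add contDiff_const

/-- Composition of a smooth function with a diagonal affine map. -/
def Smooth3.compDiag (f : Smooth3) (s b : Fin 3 → ℝ) : Smooth3 :=
  .of (fun x => f (diagMap s b x)) (f.contDiff.comp (contDiff_diagMap s b))

@[simp] theorem Smooth3.compDiag_apply (f : Smooth3) (s b : Fin 3 → ℝ) (x : R3) :
    f.compDiag s b x = f (diagMap s b x) := rfl

/-- One chain rule covers the reflection in the interface, dilations and translations. -/
theorem D_compDiag (f : Smooth3) (s b : Fin 3 → ℝ) (j : Fin 3) :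
    D j (f.compDiag s b) = s j • (D j f).compDiag s b := by
  ext x
  have hA : HasFDerivAt (diagMap s b) (fderiv ℝ (diagMap s b) x) x :=
    ((contDiff_diagMap s b).differentiable (by simp) x).hasFDerivAt
  have hf := (f.differentiable (diagMap s b x)).hasFDerivAt.comp x hA
  rw [D_eq_of_hasFDerivAt (f := f.compDiag s b) j hf]
  have hj : fderiv ℝ (diagMap s b) x (e j) = s j • e j := by
    have h1 := hA.hasLineDerivAt (e j)
    have h2 : HasLineDerivAt ℝ (diagMap s b) (s j • e j) x (e j) := by
      have h3 : ∀ t : ℝ, diagMap s b (x + t • e j) = diagMap s b x + t • s j • e j := by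
        intro t
        ext i
        by_cases h : i = j
        · subst h; simp [e]; ring
        · simp [e, h]
      change HasDerivAt (fun t : ℝ => diagMap s b (x + t • e j)) (s j • e j) 0
      simp_rw [h3]
      simpa using ((hasDerivAt_id (0 : ℝ)).smul_const (s j • e j)).const_add (diagMap s b x)
    exact HasLineDerivAt.unique h1 h2
  simp only [ContinuousLinearMap.comp_apply, hj, map_smul, Smooth3.smul_apply,
    Smooth3.compDiag_apply, D_apply, smul_eq_mul]

theorem D_tsupport_subset (f : Smooth3) (j : Fin 3) :
    tsupport (D j f : R3 → ℝ) ⊆ tsupport (f : R3 → ℝ) := by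
  have h : Function.support (D j f : R3 → ℝ) ⊆ Function.support (fderiv ℝ (f : R3 → ℝ)) := by
    intro x hx h0
    exact hx (by rw [D_apply, Function.notMem_support.1 (fun h => h h0)]; rfl)
  exact (closure_mono h).trans (closure_minimal (support_fderiv_subset ℝ) (isClosed_tsupport _))

theorem hasCompactSupport_D {f : Smooth3} (h : HasCompactSupport (f : R3 → ℝ)) (j : Fin 3) :
    HasCompactSupport (D j f : R3 → ℝ) :=
  h.of_isClosed_subset (isClosed_tsupport _) (D_tsupport_subset f j)

/-- The piecewise function equal to `B` in `{x₃ > 0}` and to `A` in `{x₃ ≤ 0}`. -/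
def glue (A B : R3 → ℝ) (x : R3) : ℝ := if 0 < x 2 then B x else A x

theorem isOpen_upper : IsOpen {x : R3 | 0 < x 2} := isOpen_lt continuous_const (coord 2).continuous

theorem measurable_glue {A B : R3 → ℝ} (hA : Measurable A) (hB : Measurable B) :
    Measurable (glue A B) :=
  Measurable.ite isOpen_upper.measurableSet hB hA

theorem abs_glue_le {A B : R3 → ℝ} (x : R3) : |glue A B x| ≤ |A x| + |B x| := by
  unfold glue; split_ifs
  · linarith [abs_nonneg (A x)]
  · linarith [abs_nonneg (B x)]

theorem exists_bound_deriv_smoothTransition :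
    ∃ C : ℝ, 0 ≤ C ∧ ∀ t : ℝ, |deriv Real.smoothTransition t| ≤ C := by
  have hc : Continuous (deriv Real.smoothTransition) :=
    (Real.smoothTransition.contDiff (n := 1)).continuous_deriv le_rfl
  obtain ⟨C, hC⟩ := (isCompact_Icc (a := (0 : ℝ)) (b := 1)).exists_bound_of_continuousOn
    hc.continuousOn
  refine ⟨max C 0, le_max_right _ _, fun t => ?_⟩
  by_cases ht : t ∈ Set.Icc (0 : ℝ) 1
  · exact (hC t ht).trans (le_max_left _ _)
  · have : deriv Real.smoothTransition t = 0 := by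
      rw [Set.mem_Icc, not_and_or, not_le, not_le] at ht
      rcases ht with ht | ht
      · have h : Real.smoothTransition =ᶠ[𝓝 t] fun _ => 0 := by
          filter_upwards [Iio_mem_nhds ht] with s hs
          exact Real.smoothTransition.zero_of_nonpos (le_of_lt hs)
        rw [h.deriv_eq]; simp
      · have h : Real.smoothTransition =ᶠ[𝓝 t] fun _ => 1 := by
          filter_upwards [Ioi_mem_nhds ht] with s hs
          exact Real.smoothTransition.one_of_one_le (le_of_lt hs)
        rw [h.deriv_eq]; simp
    rw [this]; simp

/-- Smooth approximations of the characteristic function of the upper half space. -/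
def step (n : ℕ) : Smooth3 :=
  .of (fun x => Real.smoothTransition ((n + 1) * x 2))
    ((Real.smoothTransition.contDiff (n := ⊤)).comp
      (contDiff_const.mul (coord 2).contDiff))

theorem step_apply (n : ℕ) (x : R3) : step n x = Real.smoothTransition ((n + 1) * x 2) := rfl

theorem step_of_nonpos (n : ℕ) {x : R3} (hx : x 2 ≤ 0) : step n x = 0 := by
  rw [step_apply]
  exact Real.smoothTransition.zero_of_nonpos (mul_nonpos_of_nonneg_of_nonpos (by positivity) hx)

theorem abs_step_le (n : ℕ) (x : R3) : |step n x| ≤ 1 := by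
  rw [step_apply, abs_of_nonneg (Real.smoothTransition.nonneg _)]
  exact Real.smoothTransition.le_one _

theorem step_eventually_one {x : R3} (hx : 0 < x 2) : ∀ᶠ n : ℕ in atTop, 1 < (n + 1) * x 2 := by
  obtain ⟨N, hN⟩ := exists_nat_gt (1 / x 2)
  filter_upwards [eventually_ge_atTop N] with n hn
  have : (N : ℝ) ≤ n := by exact_mod_cast hn
  have h2 : 1 / x 2 < n + 1 := by linarith
  rwa [div_lt_iff₀ hx] at h2

theorem D_step (n : ℕ) (j : Fin 3) (x : R3) :
    D j (step n) x = if j = 2 then (n + 1) * deriv Real.smoothTransition ((n + 1) * x 2) else 0 := by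
  have h1 : HasFDerivAt (coord 2 : R3 → ℝ) (EuclideanSpace.proj 2 : R3 →L[ℝ] ℝ) x :=
    (EuclideanSpace.proj 2 : R3 →L[ℝ] ℝ).hasFDerivAt
  have h2 : HasFDerivAt (fun y : R3 => ((n : ℝ) + 1) * y 2) _ x := h1.const_mul ((n : ℝ) + 1)
  have h3 : HasDerivAt Real.smoothTransition (deriv Real.smoothTransition ((n + 1) * x 2))
      (((n : ℝ) + 1) * x 2) :=
    ((Real.smoothTransition.contDiff (n := 1)).differentiable (by simp) _).hasDerivAt
  have h4 := HasDerivAt.comp_hasFDerivAt (h₂ := Real.smoothTransition) x h3 h2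
  rw [D_eq_of_hasFDerivAt (f := step n) j h4]
  by_cases h : j = 2
  · subst h; simp [e]; ring
  · simp [e, h, Ne.symm h]

theorem D_step_eq_zero {n : ℕ} {x : R3} (j : Fin 3) (hx : x 2 ≤ 0 ∨ 1 ≤ (n + 1) * x 2) :
    D j (step n) x = 0 := by
  rw [D_step]
  split_ifs
  swap; · rfl
  -- The endpoints are included because the transition attains its minimum or maximum there.
  have key : ∀ t : ℝ, t ≤ 0 ∨ 1 ≤ t → deriv Real.smoothTransition t = 0 := by
    rintro t (ht | ht)
    · exact IsLocalMin.deriv_eq_zero (Filter.Eventually.of_forall fun s => by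
        rw [Real.smoothTransition.zero_of_nonpos ht]; exact Real.smoothTransition.nonneg s)
    · exact IsLocalMax.deriv_eq_zero (Filter.Eventually.of_forall fun s => by
        rw [Real.smoothTransition.one_of_one_le ht]; exact Real.smoothTransition.le_one s)
  rw [key _ (hx.imp (fun h => mul_nonpos_of_nonneg_of_nonpos (by positivity) h) id), mul_zero]

/-- The smooth interpolation between `A` below and `B` above the interface. -/
def blend (A B : Smooth3) (n : ℕ) : Smooth3 := A + step n * (B - A)

theorem blend_apply (A B : Smooth3) (n : ℕ) (x : R3) :
    blend A B n x = A x + step n x * (B x - A x) := rfl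

/-- The last term is the only error. It is supported in the slab `0 < x₃ < 1/(n+1)`, where the
derivative of `step n` is of size `n + 1`. -/
theorem D_blend (A B : Smooth3) (n : ℕ) (j : Fin 3) (x : R3) :
    D j (blend A B n) x = blend (D j A) (D j B) n x + (B x - A x) * D j (step n) x := by
  simp only [blend, map_add, map_sub, Derivation.leibniz, smul_eq_mul, Smooth3.add_apply,
    Smooth3.sub_apply, Smooth3.mul_apply]
  ring

theorem hasCompactSupport_blend {A B : Smooth3} (hA : HasCompactSupport (A : R3 → ℝ))
    (hB : HasCompactSupport (B : R3 → ℝ)) (n : ℕ) : HasCompactSupport (blend A B n : R3 → ℝ) := by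
  have h1 : HasCompactSupport (fun x => B x - A x) := hB.sub hA
  exact hA.add (h1.mul_left (f := (step n : R3 → ℝ)))

theorem abs_blend_le (A B : Smooth3) (n : ℕ) (x : R3) :
    |blend A B n x| ≤ |A x| + |B x - A x| := by
  rw [blend_apply]
  refine (abs_add_le _ _).trans (add_le_add_right ?_ _)
  rw [abs_mul]
  exact mul_le_of_le_one_left (abs_nonneg _) (abs_step_le n x)

/-- At each point the sequence is eventually constant. On the interface itself `step n` vanishes, in
agreement with the convention that `glue` takes the lower value there. -/
theorem tendsto_blend (A B : Smooth3) (x : R3) :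
    Tendsto (fun n => blend A B n x) atTop (𝓝 (glue A B x)) := by
  refine tendsto_const_nhds.congr' ?_
  unfold glue
  split_ifs with h
  · filter_upwards [step_eventually_one h] with n hn
    rw [blend_apply, step_apply, Real.smoothTransition.one_of_one_le hn.le]; ring
  · filter_upwards with n
    rw [blend_apply, step_of_nonpos n (not_lt.1 h)]; ring

theorem tendsto_D_blend (A B : Smooth3) (j : Fin 3) (x : R3) :
    Tendsto (fun n => D j (blend A B n) x) atTop (𝓝 (glue (D j A) (D j B) x)) := by
  have h := tendsto_blend (D j A) (D j B) x
  refine h.congr' ?_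
  by_cases hx : 0 < x 2
  · filter_upwards [step_eventually_one hx] with n hn
    rw [D_blend, D_step_eq_zero j (Or.inr hn.le)]; ring
  · filter_upwards with n
    rw [D_blend, D_step_eq_zero j (Or.inl (not_lt.1 hx))]; ring

theorem integrable_mul_of_compact {w : R3 → ℝ} (hw : LocallyIntegrable w volume) {f : R3 → ℝ}
    (hf : Continuous f) (hc : HasCompactSupport f) : Integrable (fun x => w x * f x) := by
  have := hw.integrable_smul_left_of_hasCompactSupport hf hc
  simpa only [smul_eq_mul, mul_comm] using this

theorem tendsto_integral_blend {w : R3 → ℝ} (hw : LocallyIntegrable w volume) {A B : Smooth3}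
    (hA : HasCompactSupport (A : R3 → ℝ)) (hB : HasCompactSupport (B : R3 → ℝ)) :
    Tendsto (fun n => ∫ x, w x * blend A B n x) atTop (𝓝 (∫ x, w x * glue A B x)) := by
  have h1 : HasCompactSupport (fun x => |B x - A x|) := (hB.sub hA).abs
  refine tendsto_integral_of_dominated_convergence
    (fun x => |w x| * (|A x| + |B x - A x|)) (fun n => ?_) ?_ (fun n => ?_) ?_
  · exact (integrable_mul_of_compact hw (blend A B n).continuous
      (hasCompactSupport_blend hA hB n)).aestronglyMeasurable
  · exact integrable_mul_of_compact (w := fun x => |w x|) (fun x => (hw x).norm)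
      (A.continuous.abs.add (B.continuous.sub A.continuous).abs) (hA.abs.add h1)
  · refine Filter.Eventually.of_forall fun x => ?_
    rw [Real.norm_eq_abs, abs_mul]
    exact mul_le_mul_of_nonneg_left (abs_blend_le A B n x) (abs_nonneg _)
  · exact Filter.Eventually.of_forall fun x => (tendsto_blend A B x).const_mul _

end

/-! ### Weak derivatives tested against piecewise smooth functions -/

section

theorem exists_abs_le_mul_of_eq_zero {f : Smooth3} (hc : HasCompactSupport (f : R3 → ℝ))
    (h0 : ∀ x : R3, x 2 = 0 → f x = 0) : ∃ M : ℝ, 0 ≤ M ∧ ∀ x, |f x| ≤ M * |x 2| := by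
  obtain ⟨C, hC⟩ := (f.contDiff.of_le (n := ∞) (m := 1) (by simp)).lipschitzWith_of_hasCompactSupport hc
    (by simp)
  refine ⟨C, C.2, fun x => ?_⟩
  -- Compare `x` with its vertical projection onto the interface.
  have h := hC.dist_le_mul x (x - x 2 • e 2)
  rw [h0 (x - x 2 • e 2) (by simp [e]), Real.dist_eq, sub_zero, dist_eq_norm] at h
  simpa [norm_smul, e] using h

theorem abs_D_step_le {C : ℝ} (hC : ∀ t : ℝ, |deriv Real.smoothTransition t| ≤ C) (n : ℕ)
    (j : Fin 3) (x : R3) : |D j (step n) x| ≤ (n + 1) * C := by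
  have hC0 : 0 ≤ C := (abs_nonneg _).trans (hC 0)
  rw [D_step]
  split_ifs
  · rw [abs_mul, abs_of_nonneg (by positivity : (0 : ℝ) ≤ n + 1)]
    exact mul_le_mul_of_nonneg_left (hC _) (by positivity)
  · rw [abs_zero]; positivity

/-- For `j = 2` the error of `D_blend` stays bounded: `B - A` vanishes on the interface, so `|B - A|
≤ M x₃`, while `|∂₃ step n| ≤ (n + 1) C` is supported where `(n + 1) x₃ < 1`. For horizontal `j`
there is no error. Dominated convergence then applies. -/
theorem tendsto_integral_D_blend {w : R3 → ℝ} (hw : LocallyIntegrable w volume) {A B : Smooth3}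
    (hA : HasCompactSupport (A : R3 → ℝ)) (hB : HasCompactSupport (B : R3 → ℝ)) (j : Fin 3)
    (hAB : j = 2 → ∀ x : R3, x 2 = 0 → A x = B x) :
    Tendsto (fun n => ∫ x, w x * D j (blend A B n) x) atTop
      (𝓝 (∫ x, w x * glue (D j A) (D j B) x)) := by
  obtain ⟨C, hC0, hC⟩ := exists_bound_deriv_smoothTransition
  have hBA : HasCompactSupport ((B - A : Smooth3) : R3 → ℝ) := hB.sub hA
  obtain ⟨M, hM0, hM⟩ : ∃ M : ℝ, 0 ≤ M ∧
      ∀ n x, |(B x - A x) * D j (step n) x| ≤ M := by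
    by_cases hj : j = 2
    · obtain ⟨M, hM0, hM⟩ := exists_abs_le_mul_of_eq_zero hBA
        (fun x hx => by simp [hAB hj x hx])
      refine ⟨M * C, by positivity, fun n x => ?_⟩
      by_cases hx : x 2 ≤ 0 ∨ 1 ≤ (n + 1) * x 2
      · rw [D_step_eq_zero j hx]; simp; positivity
      · push Not at hx
        rw [abs_mul]
        have h1 := hM x
        rw [Smooth3.sub_apply, abs_of_pos hx.1] at h1
        calc |B x - A x| * |D j (step n) x| ≤ (M * x 2) * ((n + 1) * C) :=
              mul_le_mul h1 (abs_D_step_le hC n j x) (abs_nonneg _)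
                (mul_nonneg hM0 hx.1.le)
          _ = M * C * ((n + 1) * x 2) := by ring
          _ ≤ M * C * 1 := mul_le_mul_of_nonneg_left hx.2.le (by positivity)
          _ = M * C := mul_one _
    · exact ⟨0, le_rfl, fun n x => by rw [D_step]; simp [hj]⟩
  -- The bound on the error is a constant, so it is restricted to a compact set on which `w` is
  -- integrable.
  set K := tsupport ((B - A : Smooth3) : R3 → ℝ) with hK
  have hKi : Integrable (fun x => K.indicator (fun x => |w x| * M) x) := by
    rw [integrable_indicator_iff (isClosed_tsupport _).measurableSet]
    exact ((hw.integrableOn_isCompact hBA).norm).mul_const M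
  have h1 : HasCompactSupport (fun x => |D j B x - D j A x|) :=
    ((hasCompactSupport_D hB j).sub (hasCompactSupport_D hA j)).abs
  refine tendsto_integral_of_dominated_convergence
    (fun x => |w x| * (|D j A x| + |D j B x - D j A x|) + K.indicator (fun x => |w x| * M) x)
    (fun n => ?_) ?_ (fun n => ?_) ?_
  · exact (integrable_mul_of_compact hw (D j (blend A B n)).continuous
      (hasCompactSupport_D (hasCompactSupport_blend hA hB n) j)).aestronglyMeasurable
  · refine (integrable_mul_of_compact (w := fun x => |w x|) (fun x => (hw x).norm)
      ((D j A).continuous.abs.add ((D j B).continuous.sub (D j A).continuous).abs)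
      ((hasCompactSupport_D hA j).abs.add h1)).add hKi
  · refine Filter.Eventually.of_forall fun x => ?_
    rw [Real.norm_eq_abs, D_blend, mul_add]
    refine (abs_add_le _ _).trans (add_le_add ?_ ?_)
    · rw [abs_mul]
      exact mul_le_mul_of_nonneg_left (abs_blend_le _ _ n x) (abs_nonneg _)
    · by_cases hx : x ∈ K
      · rw [Set.indicator_of_mem hx, abs_mul]
        exact mul_le_mul_of_nonneg_left (hM n x) (abs_nonneg _)
      · have : (B - A : Smooth3) x = 0 := image_eq_zero_of_notMem_tsupport hx
        rw [Smooth3.sub_apply] at this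
        rw [this, Set.indicator_of_notMem hx]; simp
  · exact Filter.Eventually.of_forall fun x => (tendsto_D_blend A B j x).const_mul _

/-- `v` is the distributional derivative of `u` in the direction `e_j`. -/
def IsWeakDeriv (j : Fin 3) (u v : R3 → ℝ) : Prop :=
  ∀ ψ : Smooth3, HasCompactSupport (ψ : R3 → ℝ) → ∫ x, u x * D j ψ x = -∫ x, v x * ψ x

theorem IsWeakDeriv.integral_glue {j : Fin 3} {u v : R3 → ℝ} (h : IsWeakDeriv j u v)
    (hu : LocallyIntegrable u volume) (hv : LocallyIntegrable v volume) {A B : Smooth3}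
    (hA : HasCompactSupport (A : R3 → ℝ)) (hB : HasCompactSupport (B : R3 → ℝ))
    (hAB : j = 2 → ∀ x : R3, x 2 = 0 → A x = B x) :
    ∫ x, u x * glue (D j A) (D j B) x = -∫ x, v x * glue A B x := by
  refine tendsto_nhds_unique (tendsto_integral_D_blend hu hA hB j hAB) ?_
  refine (tendsto_integral_blend hv hA hB).neg.congr fun n => ?_
  exact (h _ (hasCompactSupport_blend hA hB n)).symm

theorem integral_D_eq_zero {f : Smooth3} (hf : HasCompactSupport (f : R3 → ℝ)) (j : Fin 3) :
    ∫ x, D j f x = 0 := by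
  have h := integral_mul_fderiv_eq_neg_fderiv_mul_of_integrable (μ := (volume : Measure R3))
    (f := fun _ => (1 : ℝ)) (g := (f : R3 → ℝ)) (v := e j) (by simp)
    (by simp only [one_mul]; exact
      (D j f).continuous.integrable_of_hasCompactSupport (hasCompactSupport_D hf j))
    (by simpa using f.continuous.integrable_of_hasCompactSupport hf)
    (fun x _ => differentiableAt_const _) (fun x _ => f.differentiable x)
  simp only [one_mul, fderiv_fun_const, Pi.zero_apply, _root_.zero_apply, zero_mul,
    integral_zero, neg_zero] at h
  exact h

theorem integral_glue_D_eq_zero {j : Fin 3} {A B : Smooth3}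
    (hA : HasCompactSupport (A : R3 → ℝ)) (hB : HasCompactSupport (B : R3 → ℝ))
    (hAB : j = 2 → ∀ x : R3, x 2 = 0 → A x = B x) :
    ∫ x, glue (D j A) (D j B) x = 0 := by
  -- The constant `1` has weak derivative `0`; test it against the glued pair.
  have h : IsWeakDeriv j (fun _ => 1) (fun _ => 0) := fun ψ hψ => by
    simpa using integral_D_eq_zero hψ j
  simpa using h.integral_glue (locallyIntegrable_const _) (locallyIntegrable_const _) hA hB hAB

theorem integrable_glue_mul {A B : Smooth3} {ψ : R3 → ℝ} (hψ : Continuous ψ)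
    (hc : HasCompactSupport ψ) : Integrable (fun x => glue A B x * ψ x) := by
  have hA := A.continuous
  have hB := B.continuous
  refine Integrable.mono' ((hA.abs.add hB.abs).mul hψ.abs |>.integrable_of_hasCompactSupport
    (hc.abs.mul_left)) ?_ (Filter.Eventually.of_forall fun x => ?_)
  · exact ((measurable_glue hA.measurable hB.measurable).mul hψ.measurable).aestronglyMeasurable
  · rw [Real.norm_eq_abs, abs_mul]
    exact mul_le_mul_of_nonneg_right (abs_glue_le x) (abs_nonneg _)

/-- Integration by parts for a piecewise smooth function which is continuous across the interface
when `j` is the normal direction. -/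
theorem isWeakDeriv_glue (j : Fin 3) (A B : Smooth3)
    (hAB : j = 2 → ∀ x : R3, x 2 = 0 → A x = B x) :
    IsWeakDeriv j (glue A B) (glue (D j A) (D j B)) := by
  intro ψ hψ
  have h := integral_glue_D_eq_zero (j := j) (A := A * ψ) (B := B * ψ)
    (hψ.mul_left (f := (A : R3 → ℝ))) (hψ.mul_left (f := (B : R3 → ℝ)))
    (fun hj x hx => by simp [hAB hj x hx])
  rw [← add_eq_zero_iff_eq_neg, ← integral_add (integrable_glue_mul (D j ψ).continuous
    (hasCompactSupport_D hψ j)) (integrable_glue_mul ψ.continuous hψ), ← h]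
  congr 1
  ext x
  unfold glue
  split_ifs <;> simp <;> ring

theorem volume_slab_le (ρ a : ℝ) (hρ : 0 ≤ ρ) (ha : 0 ≤ a) :
    volume.real {x : R3 | ‖x‖ ≤ ρ ∧ 0 < x 2 ∧ x 2 < a} ≤ 4 * ρ ^ 2 * a := by
  have hp := PiLp.volume_preserving_ofLp (Fin 3)
  set l : Fin 3 → ℝ := ![-ρ, -ρ, 0]
  set r : Fin 3 → ℝ := ![ρ, ρ, a]
  have hv : volume ((WithLp.ofLp : R3 → Fin 3 → ℝ) ⁻¹' Set.Icc l r) =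
      ENNReal.ofReal (4 * ρ ^ 2 * a) := by
    rw [hp.measure_preimage measurableSet_Icc.nullMeasurableSet, Real.volume_Icc_pi,
      Fin.prod_univ_three]
    simp only [l, r, Matrix.cons_val]
    rw [← ENNReal.ofReal_mul (by linarith), ← ENNReal.ofReal_mul (by nlinarith)]
    congr 1; ring
  refine (measureReal_mono (μ := volume) (s₂ := (WithLp.ofLp : R3 → Fin 3 → ℝ) ⁻¹' Set.Icc l r)
    ?_ (by rw [hv]; exact ENNReal.ofReal_ne_top)).trans ?_
  · rintro x ⟨h1, h2, h3⟩
    have hx : ∀ i, |x i| ≤ ρ := fun i => (by simpa using PiLp.norm_apply_le x i : |x i| ≤ ‖x‖).trans h1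
    refine ⟨fun i => ?_, fun i => ?_⟩
    · fin_cases i
      · exact (abs_le.1 (hx 0)).1
      · exact (abs_le.1 (hx 1)).1
      · exact h2.le
    · fin_cases i
      · exact (abs_le.1 (hx 0)).2
      · exact (abs_le.1 (hx 1)).2
      · exact h3.le
  · rw [measureReal_def, hv, ENNReal.toReal_ofReal (by positivity)]

/-- Integration by parts against a field which jumps across the interface: the boundary term is
controlled by the size of the jump. -/
theorem exists_jump_bound : ∃ C : ℝ, 0 ≤ C ∧ ∀ u v : R3 → ℝ, LocallyIntegrable u volume →
    LocallyIntegrable v volume → IsWeakDeriv 2 u v → ∀ A B : Smooth3,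
    HasCompactSupport (A : R3 → ℝ) → HasCompactSupport (B : R3 → ℝ) → ∀ m ρ a : ℝ, 0 ≤ m → 0 ≤ ρ →
    0 < a → (∀ x : R3, 0 < x 2 → x 2 < a → |u x * (B x - A x)| ≤ m) →
    (∀ x : R3, ρ < ‖x‖ → B x - A x = 0) →
    |(∫ x, u x * glue (D 2 A) (D 2 B) x) + ∫ x, v x * glue A B x| ≤ C * m * ρ ^ 2 := by
  obtain ⟨C, hC0, hC⟩ := exists_bound_deriv_smoothTransition
  refine ⟨4 * C, by positivity, fun u v hu hv h A B hA hB m ρ a hm hρ ha hu' hsupp => ?_⟩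
  have hDA := hasCompactSupport_D hA 2
  have hDB := hasCompactSupport_D hB 2
  have hlim := ((tendsto_integral_blend hu hDA hDB).add (tendsto_integral_blend hv hA hB)).abs
  -- Testing with the blend leaves exactly one term, the jump times the derivative of the step.
  have hInt : ∀ n, (∫ x, u x * blend (D 2 A) (D 2 B) n x) + ∫ x, v x * blend A B n x =
      -∫ x, u x * (B x - A x) * D 2 (step n) x := by
    intro n
    have h1 := h _ (hasCompactSupport_blend hA hB n)
    have h2 : ∀ x, u x * D 2 (blend A B n) x =
        u x * blend (D 2 A) (D 2 B) n x + u x * (B x - A x) * D 2 (step n) x := fun x => by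
      rw [D_blend]; ring
    have hi : Integrable (fun x => u x * (B x - A x) * D 2 (step n) x) := by
      have := integrable_mul_of_compact hu
        (f := (((B - A) * D 2 (step n) : Smooth3) : R3 → ℝ)) (Smooth3.continuous _)
        ((hB.sub hA).mul_right)
      refine this.congr (Filter.Eventually.of_forall fun x => ?_)
      simp only [Smooth3.mul_apply, Smooth3.sub_apply]; ring
    simp_rw [h2] at h1
    rw [integral_add (integrable_mul_of_compact hu (blend (D 2 A) (D 2 B) n).continuous
      (hasCompactSupport_blend hDA hDB n)) hi] at h1
    linarith
  refine le_of_tendsto hlim ?_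
  -- For such `n` the slab lies in `0 < x₃ < a`, where the bound on the jump is available.
  obtain ⟨N, hN⟩ := exists_nat_gt (1 / a)
  filter_upwards [eventually_ge_atTop N] with n hn
  have hNn : (N : ℝ) ≤ n := by exact_mod_cast hn
  have hn1 : (0 : ℝ) < n + 1 := by positivity
  have hna : 1 / ((n : ℝ) + 1) < a := by
    rw [div_lt_comm₀ hn1 ha]; linarith
  rw [hInt, abs_neg]
  set s : Set R3 := {x : R3 | ‖x‖ ≤ ρ ∧ 0 < x 2 ∧ x 2 < 1 / ((n : ℝ) + 1)} with hs
  have hsm : MeasurableSet s :=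
    (isClosed_le continuous_norm continuous_const).measurableSet.inter
      (isOpen_upper.measurableSet.inter
        (isOpen_lt (coord 2).continuous continuous_const).measurableSet)
  have hzero : ∀ x ∉ s, u x * (B x - A x) * D 2 (step n) x = 0 := by
    intro x hx
    by_cases h1 : ρ < ‖x‖
    · rw [hsupp x h1]; ring
    · rw [D_step_eq_zero]
      · ring
      · by_contra hcon
        push Not at hcon
        exact hx ⟨not_lt.1 h1, hcon.1, by rw [lt_div_iff₀ hn1]; linarith [hcon.2]⟩
  rw [← setIntegral_eq_integral_of_forall_compl_eq_zero hzero, ← Real.norm_eq_abs]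
  have hfin : volume s < ⊤ := (measure_mono (fun x hx => by
    simpa using hx.1)).trans_lt (measure_closedBall_lt_top (x := (0 : R3)) (r := ρ))
  -- The volume of the slab is at most `4ρ²/(n+1)`, which cancels the factor `n + 1` from the
  -- derivative of the step.
  refine (norm_setIntegral_le_of_norm_le_const (C := m * ((n + 1) * C)) hfin
    (fun x hx => ?_)).trans ?_
  · rw [Real.norm_eq_abs, abs_mul]
    exact mul_le_mul (hu' x hx.2.1 (hx.2.2.trans hna)) (abs_D_step_le hC n 2 x) (abs_nonneg _) hm
  · have h1 := volume_slab_le ρ (1 / ((n : ℝ) + 1)) hρ (by positivity)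
    calc m * ((n + 1) * C) * volume.real s
        ≤ m * ((n + 1) * C) * (4 * ρ ^ 2 * (1 / ((n : ℝ) + 1))) :=
          mul_le_mul_of_nonneg_left h1 (by positivity)
      _ = 4 * C * m * ρ ^ 2 := by field_simp

end

/-! ### The Lamé system: elementary solutions and their interface data -/

section

/-- The divergence of a smooth vector field. -/
def divF (U : Fin 3 → Smooth3) : Smooth3 := ∑ i, D i (U i)

/-- The stress tensor of a smooth displacement field. -/
def stress (lam mu : ℝ) (U : Fin 3 → Smooth3) (i j : Fin 3) : Smooth3 :=
  lam • (if i = j then divF U else 0) + mu • (D j (U i) + D i (U j))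

/-- The Lamé operator. -/
def lame (lam mu : ℝ) (U : Fin 3 → Smooth3) (i : Fin 3) : Smooth3 :=
  ∑ j, D j (stress lam mu U i j)

/-- The Laplacian. -/
def lap (f : Smooth3) : Smooth3 := ∑ i, D i (D i f)

theorem elasticityAction_eq (lam mu : ℝ) (A : Matrix (Fin 3) (Fin 3) ℝ) (i j : Fin 3) :
    elasticityAction lam mu A i j =
      lam * (if i = j then ∑ k, A k k else 0) + mu * (A i j + A j i) := by
  fin_cases i <;> fin_cases j <;>
    simp [elasticityAction, elasticityTensor, Fin.sum_univ_three] <;> ring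

theorem stress_apply (lam mu : ℝ) (U : Fin 3 → Smooth3) (i j : Fin 3) (x : R3) :
    stress lam mu U i j x = elasticityAction lam mu (fun k l => D l (U k) x) i j := by
  refine Eq.trans ?_ (elasticityAction_eq lam mu _ i j).symm
  by_cases h : i = j <;> simp [stress, divF, h] <;> ring

theorem stress_add (lam mu : ℝ) (U V : Fin 3 → Smooth3) (i j : Fin 3) :
    stress lam mu (U + V) i j = stress lam mu U i j + stress lam mu V i j := by
  ext x
  by_cases h : i = j <;> simp [stress, divF, h, Fin.sum_univ_three] <;> ring

theorem stress_smul (lam mu a : ℝ) (U : Fin 3 → Smooth3) (i j : Fin 3) :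
    stress lam mu (a • U) i j = a • stress lam mu U i j := by
  ext x
  by_cases h : i = j <;> simp [stress, divF, h, Fin.sum_univ_three] <;> ring

theorem lame_add (lam mu : ℝ) (U V : Fin 3 → Smooth3) (i : Fin 3) :
    lame lam mu (U + V) i = lame lam mu U i + lame lam mu V i := by
  simp only [lame, stress_add, map_add, Finset.sum_add_distrib]

theorem lame_smul (lam mu a : ℝ) (U : Fin 3 → Smooth3) (i : Fin 3) :
    lame lam mu (a • U) i = a • lame lam mu U i := by
  simp only [lame, stress_smul, Derivation.map_smul, Finset.smul_sum]

/-- The sign of the reflection `x₃ ↦ -x₃` on the `i`-th coordinate. -/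
def sgn (i : Fin 3) : ℝ := if i = 2 then -1 else 1

@[simp] theorem sgn_zero : sgn 0 = 1 := rfl
@[simp] theorem sgn_one : sgn 1 = 1 := rfl
@[simp] theorem sgn_two : sgn 2 = -1 := rfl
theorem sgn_mul_self (i : Fin 3) : sgn i * sgn i = 1 := by fin_cases i <;> simp

/-- The gradient field of a scalar function. -/
def gradF (f : Smooth3) (i : Fin 3) : Smooth3 := D i f

/-- The Almansi-type field `J ∇f + 2 k x₃ ∇∂₃f`, with `J` the reflection. -/
def almansi (k : ℝ) (f : Smooth3) (i : Fin 3) : Smooth3 :=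
  sgn i • D i f + (2 * k) • (coord 2 * D i (D 2 f))

/-- The horizontal solenoidal field `∂₃₃X e_j + ∇'∂_jX`. -/
def twist (j : Fin 3) (X : Smooth3) (i : Fin 3) : Smooth3 :=
  if i = 2 ∨ j = 2 then 0 else (if i = j then D 2 (D 2 X) else 0) + D i (D j X)

section PDE

variable {f : Smooth3} {U : Set R3} (hU : IsOpen U) (hf : ∀ x ∈ U, lap f x = 0)
include hU hf

theorem lap_D_eq_zero (i : Fin 3) : ∀ x ∈ U, lap (D i f) x = 0 := by
  intro x hx
  have h := D_zero_on hU hf i x hx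
  rw [← h]
  simp only [lap, map_sum, Smooth3.sum_apply, D_comm _ i]

/-- For a gradient the Lamé operator is `(λ + 2μ) ∇Δf`. -/
theorem lame_gradF (lam mu : ℝ) (i : Fin 3) : ∀ x ∈ U, lame lam mu (gradF f) i x = 0 := by
  intro x hx
  have h := lap_D_eq_zero hU hf i x hx
  simp only [lap, Fin.sum_univ_three, Smooth3.add_apply] at h
  fin_cases i <;>
    simp [lame, stress, divF, gradF, Fin.sum_univ_three, D_comm 1 0, D_comm 2 0, D_comm 2 1] at h ⊢ <;>
    linear_combination (lam + 2 * mu) * h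

/-- For harmonic `f` the field has divergence `2(k - 1) ∂₃₃f` and Laplacian `4k ∇∂₃₃f`, so `μ Δ + (λ
+ μ) ∇ div` gives `2 (k (λ + 3μ) - (λ + μ)) ∇∂₃₃f`. The hypothesis on `k` is exactly the vanishing
of this factor. -/
theorem lame_almansi {lam mu k : ℝ} (hk : k * (lam + 3 * mu) = lam + mu) (i : Fin 3) :
    ∀ x ∈ U, lame lam mu (almansi k f) i x = 0 := by
  intro x hx
  have h := lap_D_eq_zero hU hf i x hx
  have h2 := lap_D_eq_zero hU hf 2 x hx
  have h3 := lap_D_eq_zero hU (lap_D_eq_zero hU hf 2) i x hx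
  simp only [lap, Fin.sum_univ_three, Smooth3.add_apply] at h h2 h3
  fin_cases i <;>
    simp [lame, stress, divF, almansi, Fin.sum_univ_three, D_comm 1 0, D_comm 2 0,
      D_comm 2 1] at h h2 h3 ⊢
  · linear_combination (mu + (lam + mu)) * h + 2 * k * x 2 * (lam + 2 * mu) * h3 +
      2 * D 0 (D 2 (D 2 f)) x * hk
  · linear_combination (mu + (lam + mu)) * h + 2 * k * x 2 * (lam + 2 * mu) * h3 +
      2 * D 1 (D 2 (D 2 f)) x * hk
  · linear_combination (-mu + (lam + mu) + 2 * k * (lam + mu)) * h +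
      2 * k * x 2 * (lam + 2 * mu) * h3 + 2 * D 2 (D 2 (D 2 f)) x * hk

/-- The components are harmonic, and for horizontal `j` the divergence is `∂_j ΔX = 0`; for `j = 2`
the field is zero. -/
theorem lame_twist (lam mu : ℝ) (j i : Fin 3) : ∀ x ∈ U, lame lam mu (twist j f) i x = 0 := by
  intro x hx
  have h2 := lap_D_eq_zero hU (lap_D_eq_zero hU hf 2) 2 x hx
  have h7 := lap_D_eq_zero hU (lap_D_eq_zero hU hf j) i x hx
  simp only [lap, Fin.sum_univ_three, Smooth3.add_apply] at h2 h7
  fin_cases i <;> fin_cases j <;>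
    simp [lame, stress, divF, twist, Fin.sum_univ_three, D_comm 1 0, D_comm 2 0,
      D_comm 2 1] at h2 h7 ⊢
  · linear_combination mu * h2 + (lam + 2 * mu) * h7
  · linear_combination (lam + 2 * mu) * h7
  · linear_combination (lam + 2 * mu) * h7
  · linear_combination mu * h2 + (lam + 2 * mu) * h7
  · linear_combination (lam + mu) * h7
  · linear_combination (lam + mu) * h7

end PDE

/-- The reflection of a function in the interface. -/
def Smooth3.mirror (f : Smooth3) : Smooth3 := f.compDiag sgn 0

theorem D_mirror (f : Smooth3) (j : Fin 3) : D j f.mirror = sgn j • (D j f).mirror :=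
  D_compDiag f sgn 0 j

theorem diagMap_sgn_of_eq_zero {x : R3} (hx : x 2 = 0) : diagMap sgn 0 x = x := by
  ext i
  fin_cases i <;> simp [hx]

theorem mirror_of_eq_zero (f : Smooth3) {x : R3} (hx : x 2 = 0) : f.mirror x = f x := by
  change f (diagMap sgn 0 x) = f x
  rw [diagMap_sgn_of_eq_zero hx]

theorem mirror_add (f g : Smooth3) : (f + g).mirror = f.mirror + g.mirror := rfl

theorem lap_mirror (f : Smooth3) : lap f.mirror = (lap f).mirror := by
  simp only [lap, Fin.sum_univ_three, D_mirror, Derivation.map_smul, smul_smul, sgn_mul_self,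
    one_smul, mirror_add]

section Interface

variable {f : Smooth3} {x : R3}

/-- The divergence of the field is `Δf = 0`, so only the symmetric gradient contributes. -/
theorem stress_gradF (lam mu : ℝ) (hf : lap f x = 0) (i : Fin 3) :
    stress lam mu (gradF f) i 2 x = 2 * mu * D i (D 2 f) x := by
  simp only [lap, Fin.sum_univ_three, Smooth3.add_apply] at hf
  fin_cases i <;>
    simp [stress, divF, gradF, Fin.sum_univ_three, D_comm 2 0, D_comm 2 1] at hf ⊢
  · ring
  · ring
  · linear_combination lam * hf

/-- The same value of `k` serves again: the normal component has factor `2 (k (λ + 2μ) - (λ + μ)) =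
-2kμ`, so the traction is a single multiple of `J ∇∂₃f`. This is what lets each Almansi field be
matched with a gradient field by one scalar amplitude. -/
theorem stress_almansi (hx : x 2 = 0) {lam mu k : ℝ} (hk : k * (lam + 3 * mu) = lam + mu) (hf : lap f x = 0)
    (i : Fin 3) : stress lam mu (almansi k f) i 2 x = 2 * k * mu * (sgn i * D i (D 2 f) x) := by
  simp only [lap, Fin.sum_univ_three, Smooth3.add_apply] at hf
  fin_cases i <;>
    simp [stress, divF, almansi, Fin.sum_univ_three, D_comm 2 0, D_comm 2 1, hx]
      at hf ⊢
  · ring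
  · ring
  · linear_combination lam * hf + 2 * D 2 (D 2 f) x * hk

end Interface

/-- The field is divergence free with zero vertical component, which leaves only the normal
derivative. -/
theorem stress_twist {X : Smooth3} {x : R3} (lam mu : ℝ) (j : Fin 3)
    (hf : D j (lap X) x = 0) (i : Fin 3) :
    stress lam mu (twist j X) i 2 x = mu * D 2 (twist j X i) x := by
  simp only [lap, Fin.sum_univ_three, map_add, Smooth3.add_apply] at hf
  fin_cases i <;> fin_cases j <;>
    simp [stress, divF, twist, Fin.sum_univ_three, D_comm 1 0, D_comm 2 0, D_comm 2 1] at hf ⊢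
  all_goals first | linear_combination lam * hf | ring

/-! ### Kelvin, reflected and transmitted fields, and their matching on the interface -/

section Fields

/-- The auxiliary potential of the incoming field in direction `j`, above the pole. -/
def potUp (X : Smooth3) (j : Fin 3) : Smooth3 := sgn j • D j X

/-- The potential of the `Σ`-part of the incoming field. -/
def potSum (k d : ℝ) (X : Smooth3) (j : Fin 3) : Smooth3 :=
  k⁻¹ • potUp X j + (2 * d * sgn j) • D 2 (potUp X j)

/-- A field of transmitted type with amplitudes `p`, `q`, `r`. -/
def upField (c k kI d p q r : ℝ) (X : Smooth3) (j : Fin 3) : Fin 3 → Smooth3 :=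
  (-(c / 2) * p) • gradF (potSum k d X j) + (-(c / 2) * sgn j * q / k) • almansi kI (potUp X j) +
    (c * (1 + k⁻¹) * r) • twist j X

/-- A field of reflected type with amplitudes `p`, `q`, `r`. -/
def lowField (c k d p q r : ℝ) (X : Smooth3) (j : Fin 3) : Fin 3 → Smooth3 :=
  (-(c / 2) * p) • almansi k (potSum k d X j).mirror +
    (-(c / 2) * sgn j * q / k) • gradF (potUp X j).mirror +
    (c * (1 + k⁻¹) * r) • twist j X.mirror

/-- The Kelvin field with Galerkin potential `H` in direction `j`. -/
def kelvinField (c k : ℝ) (H : Smooth3) (j i : Fin 3) : Smooth3 :=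
  c • (((1 + k⁻¹) / 2) • (if i = j then lap H else 0) - D i (D j H))

/-- This is the Galerkin representation. The coefficient of `∇∂_jΔH` is proportional to `(λ + μ) k⁻¹
- (λ + 3μ)`, which vanishes for this `k`; only the bilaplacian of `H` survives. -/
theorem lame_kelvinField {c k lam mu : ℝ} (hk0 : k ≠ 0) (hk : k * (lam + 3 * mu) = lam + mu)
    (H : Smooth3) (j i : Fin 3) :
    lame lam mu (kelvinField c k H j) i =
      (c * mu * (1 + k⁻¹) / 2) • (if i = j then lap (lap H) else 0) := by
  have hk' : lam + 3 * mu = k⁻¹ * (lam + mu) := by field_simp; linear_combination hk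
  ext x
  have h : (lam + 3 * mu - k⁻¹ * (lam + mu)) * (c / 2 * D i (D j (lap H)) x) = 0 := by
    rw [hk']; ring
  fin_cases i <;> fin_cases j <;>
    simp only [lame, stress, divF, kelvinField, lap, Fin.sum_univ_three, D_comm 1 0, D_comm 2 0,
      D_comm 2 1, map_add, map_sub, map_zero, Derivation.map_smul, Smooth3.add_apply,
      Smooth3.sub_apply, Smooth3.smul_apply, Smooth3.zero_apply, Fin.isValue, Fin.zero_eta,
      Fin.mk_one, Fin.reduceFinMk, Fin.reduceEq, if_true, if_false] at h ⊢ <;>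
    linear_combination -h

/-- The incoming field is itself of transmitted type, with all amplitudes equal to `1` and the ratio
`k` of the lower medium. Substituting `H = (x₃ + d) ∂₃X - X` and `ΔX = 0` reduces the claim to
algebra. -/
theorem kelvinField_eq_upField {c k d : ℝ} (hk0 : k ≠ 0) {X H : Smooth3} {U : Set R3}
    (hU : IsOpen U) (hX : ∀ x ∈ U, lap X x = 0)
    (hH : ∀ x ∈ U, H x = (x 2 + d) * D 2 X x - X x) (j i : Fin 3) :
    ∀ x ∈ U, kelvinField c k H j i x = upField c k k d 1 1 1 X j i x := by
  have hH' : ∀ x ∈ U, H x = ((coord 2 + d • 1) * D 2 X - X) x := fun x hx => by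
    simpa using hH x hx
  intro x hx
  have h1 := hX x hx
  have h2 := D_zero_on hU hX 2 x hx
  have hD : ∀ l m : Fin 3, D l (D m H) x = D l (D m ((coord 2 + d • 1) * D 2 X - X)) x :=
    fun l m => D_congr_on hU (D_congr_on hU hH' m) l x hx
  have h3 : (k * k⁻¹ - 1) * (c * x 2 * D i (D j (D 2 X)) x) = 0 := by
    rw [mul_inv_cancel₀ hk0]; ring
  have h4 : (if i = j then 1 else 0) * (c * (1 + k⁻¹) / 2 * ((x 2 + d) * D 2 (lap X) x
      - lap X x)) = 0 := by rw [h1, h2]; ring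
  simp only [kelvinField, lap, Fin.sum_univ_three]
  fin_cases i <;> fin_cases j <;>
    simp [lap, upField, gradF, almansi, twist, potSum, potUp, hD, Fin.sum_univ_three,
      D_comm 1 0, D_comm 2 0, D_comm 2 1, -mul_eq_zero] at h3 h4 ⊢ <;>
    linear_combination h3 + h4

/-- On the interface `almansi k f.mirror` is `∇f`, and `gradF f.mirror` is `J∇f`, the trace of any
Almansi field of `f`. Each reflected term thus has the trace of the incoming term with the same
amplitude, whatever `p`, `q`, `r` are. -/
theorem displacement_match {c k kI d p q r : ℝ} {X : Smooth3} (j i : Fin 3) {x : R3}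
    (hx : x 2 = 0) :
    upField c k k d 1 1 1 X j i x + lowField c k d p q r X j i x =
      upField c k kI d (1 + p) (1 + q) (1 + r) X j i x := by
  have ht : twist j X.mirror i x = twist j X i x := by
    fin_cases i <;> fin_cases j <;>
      simp [twist, D_mirror, mirror_of_eq_zero _ hx]
  have hs := sgn_mul_self i
  simp [upField, lowField, almansi, gradF, D_mirror, mirror_of_eq_zero _ hx, hx, ht]
  linear_combination (-(c / 2) * p * D i (potSum k d X j) x) * hs

theorem lap_potUp {X : Smooth3} {U : Set R3} (hU : IsOpen U) (hX : ∀ x ∈ U, lap X x = 0)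
    (j : Fin 3) : ∀ y ∈ U, lap (potUp X j) y = 0 := fun y hy => by
  have := lap_D_eq_zero hU hX j y hy
  simp only [lap, Fin.sum_univ_three, Smooth3.add_apply] at this
  simp only [lap, potUp, Derivation.map_smul, Fin.sum_univ_three, Smooth3.add_apply,
    Smooth3.smul_apply]
  linear_combination sgn j * this

theorem lap_potSum (k d : ℝ) {X : Smooth3} {U : Set R3} (hU : IsOpen U)
    (hX : ∀ x ∈ U, lap X x = 0) (j : Fin 3) : ∀ y ∈ U, lap (potSum k d X j) y = 0 := fun y hy => by
  have hw := lap_potUp hU hX j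
  have h1 := hw y hy
  have h2 := lap_D_eq_zero hU hw 2 y hy
  simp only [lap, Fin.sum_univ_three, Smooth3.add_apply] at h1 h2
  simp only [lap, potSum, Derivation.map_smul, map_add, Fin.sum_univ_three, Smooth3.add_apply,
    Smooth3.smul_apply]
  linear_combination k⁻¹ * h1 + 2 * d * sgn j * h2

theorem lap_mirror_eq_zero {f : Smooth3} {U : Set R3} (hf : ∀ x ∈ U, lap f x = 0) :
    ∀ x ∈ diagMap sgn 0 ⁻¹' U, lap f.mirror x = 0 := fun x hx => by
  rw [lap_mirror]; exact hf _ hx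

theorem lame_upField {lam mu kI : ℝ} (hk : kI * (lam + 3 * mu) = lam + mu) (c k d p q r : ℝ)
    {X : Smooth3} {U : Set R3} (hU : IsOpen U) (hX : ∀ x ∈ U, lap X x = 0) (j i : Fin 3) :
    ∀ x ∈ U, lame lam mu (upField c k kI d p q r X j) i x = 0 := fun x hx => by
  simp only [upField, lame_add, lame_smul, Smooth3.add_apply, Smooth3.smul_apply, mul_zero,
    add_zero, lame_gradF hU (lap_potSum k d hU hX j) lam mu i x hx,
    lame_almansi hU (lap_potUp hU hX j) hk i x hx, lame_twist hU hX lam mu j i x hx]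

theorem lame_lowField {lam mu k : ℝ} (hk : k * (lam + 3 * mu) = lam + mu) (c d p q r : ℝ)
    {X : Smooth3} {U : Set R3} (hU : IsOpen U) (hX : ∀ x ∈ U, lap X x = 0) (j i : Fin 3) :
    ∀ x ∈ diagMap sgn 0 ⁻¹' U, lame lam mu (lowField c k d p q r X j) i x = 0 := fun x hx => by
  have hU' : IsOpen (diagMap sgn 0 ⁻¹' U) := hU.preimage (contDiff_diagMap _ _).continuous
  simp only [lowField, lame_add, lame_smul, Smooth3.add_apply, Smooth3.smul_apply, mul_zero,
    add_zero,
    lame_gradF hU' (lap_mirror_eq_zero (lap_potUp hU hX j)) lam mu i x hx,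
    lame_almansi hU' (lap_mirror_eq_zero (lap_potSum k d hU hX j)) hk i x hx,
    lame_twist hU' (lap_mirror_eq_zero hX) lam mu j i x hx]

/-- The normal derivative changes sign under reflection, whence the minus signs on the left of `hp`,
`hq`, `hr`. Each of these equations balances the tractions of one of the three types of field. -/
theorem traction_match {c k kI d p q r lam mu lamI muI : ℝ}
    (hk : k * (lam + 3 * mu) = lam + mu) (hkI : kI * (lamI + 3 * muI) = lamI + muI)
    (hp : mu - p * k * mu = (1 + p) * muI) (hq : k * mu - q * mu = (1 + q) * kI * muI)
    (hr : mu * (1 - r) = (1 + r) * muI)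
    {X : Smooth3} {U : Set R3} (hU : IsOpen U) (hX : ∀ x ∈ U, lap X x = 0) (j i : Fin 3) {x : R3}
    (hx : x 2 = 0) (hxU : x ∈ U) :
    stress lam mu (upField c k k d 1 1 1 X j) i 2 x +
      stress lam mu (lowField c k d p q r X j) i 2 x =
      stress lamI muI (upField c k kI d (1 + p) (1 + q) (1 + r) X j) i 2 x := by
  have hw := lap_potUp hU hX j
  have hv := lap_potSum k d hU hX j x hxU
  have hvm : lap (potSum k d X j).mirror x = 0 := by
    rw [lap_mirror, mirror_of_eq_zero _ hx, hv]
  have hwm : lap (potUp X j).mirror x = 0 := by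
    rw [lap_mirror, mirror_of_eq_zero _ hx, hw x hxU]
  have hj := D_zero_on hU hX j x hxU
  have hjm : D j (lap X.mirror) x = 0 := by
    rw [lap_mirror, D_mirror, Smooth3.smul_apply, mirror_of_eq_zero _ hx, hj, mul_zero]
  have ht : D 2 (twist j X.mirror i) x = -D 2 (twist j X i) x := by
    fin_cases i <;> fin_cases j <;>
      simp [twist, D_mirror, mirror_of_eq_zero _ hx] <;> ring
  have hs := sgn_mul_self i
  simp only [upField, lowField, stress_add, stress_smul, Smooth3.add_apply, Smooth3.smul_apply,
    stress_gradF _ _ hv, stress_gradF _ _ hwm, stress_twist _ _ j hj, stress_twist _ _ j hjm,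
    stress_almansi hx hk hvm, stress_almansi hx hk (hw x hxU), stress_almansi hx hkI (hw x hxU),
    ht, D_mirror, Derivation.map_smul, mirror_of_eq_zero _ hx, sgn_two, smul_smul]
  linear_combination (-c * D i (D 2 (potSum k d X j)) x) * hp +
    (-c * sgn j / k * sgn i * D i (D 2 (potUp X j)) x) * hq +
    (c * (1 + k⁻¹) * D 2 (twist j X i) x) * hr +
    (c * p * k * mu * D i (D 2 (potSum k d X j)) x) * hs

end Fields

end

/-! ### The Boussinesq potential: harmonicity, homogeneity, decay, values on the axis -/

section

theorem norm_sq_eq (p : R3) : ‖p‖ ^ 2 = p 0 ^ 2 + p 1 ^ 2 + p 2 ^ 2 := by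
  rw [EuclideanSpace.norm_sq_eq, Fin.sum_univ_three]; simp

theorem abs_coord_le (p : R3) (i : Fin 3) : |p i| ≤ ‖p‖ := by simpa using PiLp.norm_apply_le p i

theorem hasFDerivAt_norm {p : R3} (hp : p ≠ 0) :
    HasFDerivAt (fun q : R3 => ‖q‖) (‖p‖⁻¹ • innerSL ℝ p) p := by
  have h := ((hasStrictFDerivAt_norm_sq p).hasFDerivAt).sqrt (by positivity)
  simp only [Real.sqrt_sq (norm_nonneg _)] at h
  refine h.congr_fderiv ?_
  ext v
  simp [two_smul]
  ring

theorem innerSL_e (p : R3) (j : Fin 3) : innerSL ℝ p (e j) = p j := by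
  simp [e, EuclideanSpace.inner_single_right]

/-- The harmonic potential `t log (|p| + t) - |p|`. -/
def boussinesq (p : R3) : ℝ := p 2 * Real.log (‖p‖ + p 2) - ‖p‖

theorem ne_zero_of_pos {p : R3} (h : 0 < ‖p‖ + p 2) : p ≠ 0 := by
  rintro rfl; simp at h

theorem hasFDerivAt_height {p : R3} (h : 0 < ‖p‖ + p 2) :
    HasFDerivAt (fun q : R3 => ‖q‖ + q 2)
      (‖p‖⁻¹ • innerSL ℝ p + (EuclideanSpace.proj 2 : R3 →L[ℝ] ℝ)) p :=
  (hasFDerivAt_norm (ne_zero_of_pos h)).add (EuclideanSpace.proj 2 : R3 →L[ℝ] ℝ).hasFDerivAt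

theorem contDiffAt_boussinesq {p : R3} (h : 0 < ‖p‖ + p 2) : ContDiffAt ℝ ∞ boussinesq p := by
  have h1 : ContDiffAt ℝ ∞ (fun q : R3 => ‖q‖) p := contDiffAt_norm ℝ (ne_zero_of_pos h)
  have h2 : ContDiffAt ℝ ∞ (fun q : R3 => q 2) p := (coord 2).contDiff.contDiffAt
  exact (h2.mul ((h1.add h2).log h.ne')).sub h1

/-- The open region where the cut-off potential agrees with the potential itself. -/
def goodSet (a : ℝ) : Set R3 := {p | a < ‖p‖ + p 2}

theorem isOpen_goodSet (a : ℝ) : IsOpen (goodSet a) :=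
  isOpen_lt continuous_const (continuous_norm.add (coord 2).continuous)

/-- A smooth extension of the potential `t log (|p| + t) - |p|` from `goodSet a` to `ℝ³`. -/
def potX {a : ℝ} (ha : 0 < a) : Smooth3 :=
  .of (fun p => Real.smoothTransition (2 * (‖p‖ + p 2) / a - 1) * boussinesq p) <| by
    rw [contDiff_iff_contDiffAt]
    intro p
    by_cases h : 0 < ‖p‖ + p 2
    · have h1 : ContDiffAt ℝ ∞ (fun q : R3 => ‖q‖) p := contDiffAt_norm ℝ (ne_zero_of_pos h)
      have h2 : ContDiffAt ℝ ∞ (fun q : R3 => q 2) p := (coord 2).contDiff.contDiffAt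
      exact ((Real.smoothTransition.contDiff (n := ⊤)).contDiffAt.comp p
        (((contDiffAt_const.mul (h1.add h2)).div_const a).sub contDiffAt_const)).mul
        (contDiffAt_boussinesq h)
    · have hopen : IsOpen {q : R3 | ‖q‖ + q 2 < a / 2} :=
        isOpen_lt (continuous_norm.add (coord 2).continuous) continuous_const
      refine (contDiffAt_const (c := (0 : ℝ))).congr_of_eventuallyEq ?_
      filter_upwards [hopen.mem_nhds (show ‖p‖ + p 2 < a / 2 by linarith)] with q hq
      have hq' : ‖q‖ + q 2 < a / 2 := hq
      rw [Real.smoothTransition.zero_of_nonpos, zero_mul]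
      rw [sub_nonpos, div_le_one ha]
      linarith

variable {a : ℝ} (ha : 0 < a)
include ha

theorem potX_eq {p : R3} (hp : p ∈ goodSet a) : potX ha p = boussinesq p := by
  change Real.smoothTransition _ * _ = _
  rw [Real.smoothTransition.one_of_one_le, one_mul]
  rw [le_sub_iff_add_le, le_div_iff₀ ha]
  linarith [show a < ‖p‖ + p 2 from hp]

theorem D_potX {p : R3} (hp : p ∈ goodSet a) (j : Fin 3) : D j (potX ha) p =
    if j = 2 then Real.log (‖p‖ + p 2) else -(p j / (‖p‖ + p 2)) := by
  have h : 0 < ‖p‖ + p 2 := ha.trans hp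
  have hR : ‖p‖ ≠ 0 := norm_ne_zero_iff.2 (ne_zero_of_pos h)
  have hp2 : HasFDerivAt (fun q : R3 => q 2) (EuclideanSpace.proj 2 : R3 →L[ℝ] ℝ) p :=
    (EuclideanSpace.proj 2 : R3 →L[ℝ] ℝ).hasFDerivAt
  have h1 : HasFDerivAt boussinesq _ p :=
    (hp2.mul ((hasFDerivAt_height h).log h.ne')).sub (hasFDerivAt_norm (ne_zero_of_pos h))
  rw [D_apply, D_congr (isOpen_goodSet a) (fun x hx => potX_eq ha hx) hp, h1.fderiv]
  simp only [_root_.sub_apply, _root_.add_apply,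
    _root_.smul_apply, innerSL_e, smul_eq_mul, PiLp.proj_apply]
  by_cases hj : j = 2
  · subst hj
    simp [e]
    field_simp
    ring
  · simp [e, hj, Ne.symm hj]
    field_simp
    ring

/-- Since `∂₃X = log (|p| + p₃)`, this rereads the definition of `boussinesq`. It expresses the
Galerkin potential of the Kelvin field through a harmonic function. -/
theorem norm_eq_potX {p : R3} (hp : p ∈ goodSet a) :
    ‖p‖ = p 2 * D 2 (potX ha) p - potX ha p := by
  rw [D_potX ha hp, potX_eq ha hp, boussinesq]; simp

theorem D_two_two_potX {p : R3} (hp : p ∈ goodSet a) (j : Fin 3) :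
    D j (D 2 (potX ha)) p = if j = 2 then 1 / ‖p‖ else p j / (‖p‖ * (‖p‖ + p 2)) := by
  have h : 0 < ‖p‖ + p 2 := ha.trans hp
  have hR : ‖p‖ ≠ 0 := norm_ne_zero_iff.2 (ne_zero_of_pos h)
  have h1 := (hasFDerivAt_height h).log h.ne'
  rw [D_apply, D_congr (isOpen_goodSet a) (fun x hx => by rw [D_potX ha hx, if_pos rfl]) hp,
    h1.fderiv]
  simp only [_root_.add_apply,
    _root_.smul_apply, innerSL_e, smul_eq_mul, PiLp.proj_apply]
  by_cases hj : j = 2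
  · subst hj
    simp [e]
    field_simp
    ring
  · simp [e, hj, Ne.symm hj]
    field_simp

theorem D_D_potX {p : R3} (hp : p ∈ goodSet a) {j : Fin 3} (hj : j ≠ 2) :
    D j (D j (potX ha)) p = -(1 / (‖p‖ + p 2)) + p j ^ 2 / (‖p‖ * (‖p‖ + p 2) ^ 2) := by
  have h : 0 < ‖p‖ + p 2 := ha.trans hp
  have hR : ‖p‖ ≠ 0 := norm_ne_zero_iff.2 (ne_zero_of_pos h)
  have hpj : HasFDerivAt (fun q : R3 => q j) (EuclideanSpace.proj j : R3 →L[ℝ] ℝ) p :=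
    (EuclideanSpace.proj j : R3 →L[ℝ] ℝ).hasFDerivAt
  have h1 := (hpj.mul ((hasDerivAt_inv h.ne').comp_hasFDerivAt p (hasFDerivAt_height h))).neg
  rw [D_apply, D_congr (g := fun q : R3 => -(q j * (‖q‖ + q 2)⁻¹)) (isOpen_goodSet a)
    (fun x hx => by rw [D_potX ha hx, if_neg hj, div_eq_mul_inv]) hp]
  refine (congrArg (fun L : R3 →L[ℝ] ℝ => L (e j)) h1.fderiv).trans ?_
  have h2 : inner ℝ p (EuclideanSpace.single j (1 : ℝ)) = p j := innerSL_e p j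
  simp [e, hj, h2]
  field_simp

theorem lap_potX : ∀ p ∈ goodSet a, lap (potX ha) p = 0 := by
  intro p hp
  have h : 0 < ‖p‖ + p 2 := ha.trans hp
  have hR : ‖p‖ ≠ 0 := norm_ne_zero_iff.2 (ne_zero_of_pos h)
  simp only [lap, Fin.sum_univ_three, Smooth3.add_apply]
  rw [D_D_potX ha hp (by decide), D_D_potX ha hp (by decide), D_two_two_potX ha hp, if_pos rfl]
  have h2 := norm_sq_eq p
  field_simp
  linear_combination -h2

omit ha

/-- Iterated partial derivatives. -/
def Dl (l : List (Fin 3)) (f : Smooth3) : Smooth3 := l.foldr (fun i g => D i g) f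

theorem Dl_cons (i : Fin 3) (l : List (Fin 3)) (f : Smooth3) : Dl (i :: l) f = D i (Dl l f) := rfl

theorem Dl_add (l : List (Fin 3)) (f g : Smooth3) : Dl l (f + g) = Dl l f + Dl l g := by
  induction l with
  | nil => rfl
  | cons i l ih => rw [Dl_cons, ih, map_add]; rfl

theorem Dl_smul (l : List (Fin 3)) (c : ℝ) (f : Smooth3) : Dl l (c • f) = c • Dl l f := by
  induction l with
  | nil => rfl
  | cons i l ih => rw [Dl_cons, ih, Derivation.map_smul]; rfl

theorem Dl_congr_on {f g : Smooth3} {U : Set R3} (hU : IsOpen U) (h : ∀ x ∈ U, f x = g x)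
    (l : List (Fin 3)) : ∀ x ∈ U, Dl l f x = Dl l g x := by
  induction l with
  | nil => exact h
  | cons i l ih => exact D_congr_on hU ih i

theorem Dl_coord {l : List (Fin 3)} (hl : 2 ≤ l.length) (i : Fin 3) : Dl l (coord i) = 0 := by
  induction l with
  | nil => simp at hl
  | cons j l ih =>
    rw [Dl_cons]
    by_cases h : 2 ≤ l.length
    · rw [ih h, map_zero]
    · obtain ⟨m, rfl⟩ : ∃ m, l = [m] := List.length_eq_one_iff.1 (by simp at hl; omega)
      change D j (D m (coord i)) = 0
      rw [D_coord]; split_ifs <;> simp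

/-- Scaling of a function. -/
def Smooth3.dilate (f : Smooth3) (s : ℝ) : Smooth3 := f.compDiag (fun _ => s) 0

theorem Smooth3.dilate_apply (f : Smooth3) (s : ℝ) (x : R3) : f.dilate s x = f (s • x) := by
  change f _ = f _
  congr 1
  ext i; simp

theorem Dl_dilate (f : Smooth3) (s : ℝ) (l : List (Fin 3)) :
    Dl l (f.dilate s) = s ^ l.length • (Dl l f).dilate s := by
  induction l with
  | nil => simp [Dl]
  | cons i l ih =>
    rw [Dl_cons, ih, Derivation.map_smul, Smooth3.dilate, D_compDiag, smul_smul]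
    rfl

theorem smul_mem_goodSet (ha : 0 < a) {p : R3} (hp : p ∈ goodSet a) {s : ℝ} (hs : 1 ≤ s) :
    s • p ∈ goodSet a := by
  have hp' : a < ‖p‖ + p 2 := hp
  change a < ‖s • p‖ + (s • p) 2
  rw [norm_smul, Real.norm_of_nonneg (by linarith), PiLp.smul_apply, smul_eq_mul, ← mul_add]
  nlinarith

/-- One has `X (s q) = s X q + (s log s) q₃`: homogeneity of degree one up to a linear term, which
two derivatives remove. The scale is restricted to `s ≥ 1` because only then is `goodSet a`
preserved. -/
theorem Dl_potX_smul (ha : 0 < a) {l : List (Fin 3)} (hl : 2 ≤ l.length) {p : R3}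
    (hp : p ∈ goodSet a) {s : ℝ} (hs : 1 ≤ s) :
    s ^ (l.length - 1) * Dl l (potX ha) (s • p) = Dl l (potX ha) p := by
  have h1 : ∀ q ∈ goodSet a, (potX ha).dilate s q =
      (s • potX ha + (s * Real.log s) • coord 2) q := fun q hq => by
    have hq' : 0 < ‖q‖ + q 2 := ha.trans hq
    rw [Smooth3.dilate_apply, potX_eq ha (smul_mem_goodSet ha hq hs)]
    simp only [Smooth3.add_apply, Smooth3.smul_apply, potX_eq ha hq, boussinesq, norm_smul,
      Real.norm_of_nonneg (zero_le_one.trans hs), PiLp.smul_apply, smul_eq_mul, coord_apply,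
      ← mul_add]
    rw [Real.log_mul (by linarith) hq'.ne']
    ring
  have h2 := Dl_congr_on (isOpen_goodSet a) h1 l p hp
  rw [Dl_dilate, Dl_add, Dl_smul, Dl_smul, Dl_coord hl] at h2
  simp only [Smooth3.smul_apply, Smooth3.add_apply, Smooth3.zero_apply, mul_zero, add_zero,
    Smooth3.dilate_apply] at h2
  obtain ⟨m, hm⟩ : ∃ m, l.length = m + 1 := ⟨l.length - 1, by omega⟩
  rw [hm, pow_succ] at h2
  rw [hm, Nat.add_sub_cancel]
  have hs0 : s ≠ 0 := by linarith
  exact mul_left_cancel₀ hs0 (by linear_combination h2)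

/-- A continuous function that is homogeneous outside a ball of a cone decays accordingly. -/
theorem exists_decay {F : R3 → ℝ} (hF : Continuous F) {n : ℕ} {r : ℝ} (hr : 0 < r) {S : Set R3}
    (hS : ∀ p ∈ S, ∀ s : ℝ, 0 < s → s • p ∈ S)
    (hom : ∀ p ∈ S, ‖p‖ = r → ∀ s : ℝ, 1 ≤ s → s ^ n * F (s • p) = F p) :
    ∃ C : ℝ, 0 ≤ C ∧ ∀ p ∈ S, r ≤ ‖p‖ → |F p| ≤ C / ‖p‖ ^ n := by
  obtain ⟨C, hC⟩ := (isCompact_sphere (0 : R3) r).exists_bound_of_continuousOn hF.continuousOn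
  refine ⟨|C| * r ^ n, by positivity, fun p hp hrp => ?_⟩
  have hp0 : 0 < ‖p‖ := hr.trans_le hrp
  have hq := hS p hp (r / ‖p‖) (by positivity)
  have hqn : ‖(r / ‖p‖) • p‖ = r := by
    rw [norm_smul, Real.norm_of_nonneg (by positivity)]; field_simp
  have h := hom _ hq hqn (‖p‖ / r) ((one_le_div hr).2 hrp)
  rw [smul_smul, show ‖p‖ / r * (r / ‖p‖) = 1 by field_simp, one_smul] at h
  have h2 := hC ((r / ‖p‖) • p) (by simpa using hqn)
  rw [← h, Real.norm_eq_abs, abs_mul, abs_of_nonneg (by positivity)] at h2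
  rw [le_div_iff₀ (by positivity)]
  calc |F p| * ‖p‖ ^ n = (‖p‖ / r) ^ n * |F p| * r ^ n := by
        rw [div_pow]; field_simp
    _ ≤ |C| * r ^ n := mul_le_mul_of_nonneg_right (h2.trans (le_abs_self C)) (by positivity)

/-- On the upper half of the sphere of radius `2a` one has `‖p‖ + p₃ ≥ 2a > a`, so homogeneity is
available there and propagates the bound outwards. -/
theorem exists_decay_potX (ha : 0 < a) {l : List (Fin 3)} (hl : 2 ≤ l.length) :
    ∃ C : ℝ, 0 ≤ C ∧ ∀ p : R3, 2 * a ≤ p 2 → |Dl l (potX ha) p| ≤ C / ‖p‖ ^ (l.length - 1) := by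
  obtain ⟨C, hC0, hC⟩ := exists_decay (F := Dl l (potX ha)) (Smooth3.continuous _)
    (n := l.length - 1) (r := 2 * a) (by positivity) (S := {p | 0 ≤ p 2})
    (fun p hp s hs => by
      change 0 ≤ s * p 2
      exact mul_nonneg hs.le hp)
    (fun p hp hpn s hs => Dl_potX_smul ha hl (by
      have hp' : 0 ≤ p 2 := hp
      change a < ‖p‖ + p 2
      linarith) hs)
  refine ⟨C, hC0, fun p hp => hC p (show 0 ≤ p 2 by linarith) ?_⟩
  exact hp.trans ((le_abs_self _).trans (abs_coord_le p 2))

/-- The point at height `s` on the vertical axis. -/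
def axis (s : ℝ) : R3 := s • e 2

@[simp] theorem axis_apply (s : ℝ) (i : Fin 3) : axis s i = if i = 2 then s else 0 := by
  by_cases h : i = 2 <;> simp [axis, e, h]

theorem norm_axis {s : ℝ} (hs : 0 < s) : ‖axis s‖ = s := by
  simp [axis, norm_smul, e, abs_of_pos hs]

theorem axis_mem_goodSet {s : ℝ} (hs : 0 < s) (h : a < 2 * s) : axis s ∈ goodSet a := by
  change a < ‖axis s‖ + axis s 2
  rw [norm_axis hs]; simp; linarith

theorem hasDerivAt_axis (f : Smooth3) (s : ℝ) : HasDerivAt (fun t => f (axis t)) (D 2 f (axis s)) s := by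
  have h1 : HasDerivAt axis (e 2) s := by
    have h := (hasDerivAt_id s).smul_const (e 2)
    rw [one_smul] at h
    exact h
  exact (f.differentiable (axis s)).hasFDerivAt.comp_hasDerivAt s h1

theorem D_two_axis {f : Smooth3} {b C : ℝ} {n : ℕ} (hb : 0 < b)
    (h : ∀ s, b < s → f (axis s) = C / s ^ (n + 1)) :
    ∀ s, b < s → D 2 f (axis s) = -(n + 1) * C / s ^ (n + 2) := by
  intro s hs
  have hs0 : s ≠ 0 := by linarith
  have h1 : HasDerivAt (fun t : ℝ => C / t ^ (n + 1)) (-(n + 1) * C / s ^ (n + 2)) s := by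
    have h2 := ((hasDerivAt_pow (n + 1) s).inv (pow_ne_zero _ hs0)).const_mul C
    simp only [div_eq_mul_inv]
    refine h2.congr_deriv ?_
    push_cast
    field_simp
    ring
  refine (hasDerivAt_axis f s).unique (h1.congr_of_eventuallyEq ?_)
  filter_upwards [Ioi_mem_nhds hs] with t ht using h t ht

theorem D_D_potX_axis (ha : 0 < a) (i : Fin 3) {s : ℝ} (hs : a < s) :
    D i (D i (potX ha)) (axis s) = (if i = 2 then 1 else -(1 / 2)) / s ^ 1 := by
  have hs0 : 0 < s := ha.trans hs
  have hm : axis s ∈ goodSet a := axis_mem_goodSet hs0 (by linarith)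
  by_cases h : i = 2
  · subst h
    rw [D_two_two_potX ha hm, norm_axis hs0]; simp
  · rw [D_D_potX ha hm h, norm_axis hs0]; simp [h]; field_simp; norm_num

end

/-! ### The smoothed distance and its bilaplacian -/

section

section Radial

theorem contDiff_deriv {g : ℝ → ℝ} (hg : ContDiff ℝ ∞ g) : ContDiff ℝ ∞ (deriv g) :=
  (contDiff_infty_iff_deriv.1 hg).2

/-- The radial function `g (|p|²)`. -/
def radial (g : ℝ → ℝ) (hg : ContDiff ℝ ∞ g) : Smooth3 :=
  .of (fun p => g (‖p‖ ^ 2)) (hg.comp (contDiff_norm_sq ℝ))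

theorem radial_apply (g : ℝ → ℝ) (hg : ContDiff ℝ ∞ g) (p : R3) : radial g hg p = g (‖p‖ ^ 2) := rfl

theorem D_radial {g : ℝ → ℝ} (hg : ContDiff ℝ ∞ g) (j : Fin 3) :
    D j (radial g hg) = (2 : ℝ) • (coord j * radial (deriv g) (contDiff_deriv hg)) := by
  ext p
  have h1 : HasFDerivAt (fun x : R3 => ‖x‖ ^ 2) ((2 : ℝ) • innerSL ℝ p) p :=
    (hasStrictFDerivAt_norm_sq p).hasFDerivAt.congr_fderiv (by ext v; simp [two_smul])
  have h2 : HasDerivAt g (deriv g (‖p‖ ^ 2)) (‖p‖ ^ 2) :=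
    (hg.differentiable (by simp) _).hasDerivAt
  rw [D_eq_of_hasFDerivAt (f := radial g hg) j (h2.comp_hasFDerivAt p h1)]
  have h3 : innerSL ℝ p (e j) = p j := innerSL_e p j
  simp only [_root_.smul_apply, h3, smul_eq_mul, Smooth3.smul_apply,
    Smooth3.mul_apply, coord_apply, radial_apply]
  ring

/-- The Laplacian of `g (|p|²)` as a function of `|p|²`. -/
def radLap (g : ℝ → ℝ) (s : ℝ) : ℝ := 6 * deriv g s + 4 * s * deriv (deriv g) s

theorem contDiff_radLap {g : ℝ → ℝ} (hg : ContDiff ℝ ∞ g) : ContDiff ℝ ∞ (radLap g) :=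
  (contDiff_const.mul (contDiff_deriv hg)).add
    ((contDiff_const.mul contDiff_id).mul (contDiff_deriv (contDiff_deriv hg)))

theorem lap_radial {g : ℝ → ℝ} (hg : ContDiff ℝ ∞ g) :
    lap (radial g hg) = radial (radLap g) (contDiff_radLap hg) := by
  ext p
  simp [lap, D_radial, Fin.sum_univ_three, radial_apply, radLap, norm_sq_eq]
  ring

theorem deriv_of_eq_rpow {g : ℝ → ℝ} {b C r : ℝ} (hb : 0 ≤ b) (h : ∀ s, b < s → g s = C * s ^ r) :
    ∀ s, b < s → deriv g s = C * r * s ^ (r - 1) := by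
  intro s hs
  have h1 : g =ᶠ[𝓝 s] fun t => C * t ^ r := by
    filter_upwards [Ioi_mem_nhds hs] with t ht using h t ht
  rw [h1.deriv_eq, ((Real.hasDerivAt_rpow_const (Or.inl (by linarith : s ≠ 0))).const_mul C).deriv]
  ring

/-- A smooth function which agrees with the square root on `[1/4, ∞)`. -/
def cutSqrt (s : ℝ) : ℝ := √s * Real.smoothTransition (8 * s - 1)

theorem contDiff_cutSqrt : ContDiff ℝ ∞ cutSqrt := by
  rw [contDiff_iff_contDiffAt]
  intro s
  by_cases h : 0 < s
  · exact (contDiffAt_id.sqrt h.ne').mul ((Real.smoothTransition.contDiff (n := ⊤)).contDiffAt.comp s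
      ((contDiffAt_const.mul contDiffAt_id).sub contDiffAt_const))
  · refine (contDiffAt_const (c := (0 : ℝ))).congr_of_eventuallyEq ?_
    filter_upwards [Iio_mem_nhds (show s < 1 / 8 by linarith)] with t ht
    have ht' : t < 1 / 8 := ht
    rw [cutSqrt, Real.smoothTransition.zero_of_nonpos (by linarith), mul_zero]

theorem cutSqrt_of_ge {s : ℝ} (hs : 1 / 4 ≤ s) : cutSqrt s = √s := by
  rw [cutSqrt, Real.smoothTransition.one_of_one_le (by linarith), mul_one]

/-- In the variable `s = |p|²` this is `Δ|p| = 2/|p|`, which is harmonic in turn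
(`radLap_radLap_cutSqrt`). -/
theorem radLap_cutSqrt {s : ℝ} (hs : 1 / 4 < s) : radLap cutSqrt s = 2 * s ^ (-(1 / 2) : ℝ) := by
  have h0 : ∀ s : ℝ, 1 / 4 < s → cutSqrt s = 1 * s ^ (1 / 2 : ℝ) := fun s hs => by
    rw [cutSqrt_of_ge hs.le, Real.sqrt_eq_rpow, one_mul]
  have h1 := deriv_of_eq_rpow (by norm_num) h0
  have h2 := deriv_of_eq_rpow (by norm_num) h1
  have hs0 : 0 < s := by linarith
  rw [radLap, h1 s hs, h2 s hs]
  have h3 : s ^ (1 / 2 - 1 : ℝ) = s * s ^ (1 / 2 - 1 - 1 : ℝ) := by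
    rw [Real.rpow_sub_one hs0.ne' (1 / 2 - 1)]; field_simp
  rw [show (-(1 / 2) : ℝ) = 1 / 2 - 1 by norm_num, h3]
  ring

theorem deriv_radLap_cutSqrt {s : ℝ} (hs : 1 / 4 < s) :
    deriv (radLap cutSqrt) s = -1 * s ^ (-(3 / 2) : ℝ) := by
  rw [deriv_of_eq_rpow (by norm_num) (fun s hs => radLap_cutSqrt hs) s hs]
  norm_num

theorem radLap_radLap_cutSqrt {s : ℝ} (hs : 1 / 4 < s) : radLap (radLap cutSqrt) s = 0 := by
  have hs0 : 0 < s := by linarith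
  rw [radLap, deriv_radLap_cutSqrt hs,
    deriv_of_eq_rpow (by norm_num) (fun s hs => deriv_radLap_cutSqrt hs) s hs,
    Real.rpow_sub_one hs0.ne']
  field_simp
  ring

end Radial

/-- A smooth function which agrees with the norm outside the ball of radius `1/2`. -/
def smoothNorm : Smooth3 := radial cutSqrt contDiff_cutSqrt

theorem smoothNorm_of_ge {p : R3} (hp : 1 / 2 ≤ ‖p‖) : smoothNorm p = ‖p‖ := by
  rw [smoothNorm, radial_apply, cutSqrt_of_ge (by nlinarith), Real.sqrt_sq (norm_nonneg _)]

/-- The bilaplacian of the smoothed norm. -/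
def bilapNorm : Smooth3 := lap (lap smoothNorm)

theorem bilapNorm_apply (p : R3) : bilapNorm p = radLap (radLap cutSqrt) (‖p‖ ^ 2) := by
  rw [bilapNorm, smoothNorm, lap_radial, lap_radial, radial_apply]

theorem bilapNorm_eq_zero {p : R3} (hp : 1 / 2 < ‖p‖) : bilapNorm p = 0 := by
  rw [bilapNorm_apply, radLap_radLap_cutSqrt (by nlinarith)]

/-- In polar coordinates the integrand `y² radLap v (y²)` is the exact derivative of `2 y³ v' (y²)`,
which is `0` at the origin and `-2` for large `y`. The remaining factor is the area `4π` of the unit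
sphere. -/
theorem integral_bilapNorm : ∫ p, bilapNorm p = -(8 * Real.pi) := by
  set v := radLap cutSqrt with hv
  have hvs : ContDiff ℝ ∞ v := contDiff_radLap contDiff_cutSqrt
  have hT : Continuous (radLap v) := (contDiff_radLap hvs).continuous
  have h1 : ∫ p, bilapNorm p = ∫ p : R3, (fun y => radLap v (y ^ 2)) ‖p‖ :=
    integral_congr_ae (Filter.Eventually.of_forall bilapNorm_apply)
  rw [h1]
  refine (integral_fun_norm_addHaar (volume : Measure R3) (fun y => radLap v (y ^ 2))).trans ?_
  have hder : ∀ y ∈ Set.Ici (0 : ℝ), HasDerivAt (fun y => 2 * y ^ 3 * deriv v (y ^ 2))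
      (y ^ 2 * radLap v (y ^ 2)) y := by
    intro y _
    have h2 : HasDerivAt (deriv v) (deriv (deriv v) (y ^ 2)) (y ^ 2) :=
      ((contDiff_deriv hvs).differentiable (by simp) _).hasDerivAt
    have h3 := ((hasDerivAt_pow 3 y).const_mul 2).mul
      (HasDerivAt.comp (h := fun y : ℝ => y ^ 2) y h2 (hasDerivAt_pow 2 y))
    refine h3.congr_deriv ?_
    simp [radLap]
    ring
  have hint : IntegrableOn (fun y => y ^ 2 * radLap v (y ^ 2)) (Set.Ioi (0 : ℝ)) := by
    refine (Continuous.integrable_of_hasCompactSupport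
      ((continuous_pow 2).mul (hT.comp (continuous_pow 2))) ?_).integrableOn
    refine HasCompactSupport.intro (isCompact_Icc (a := (-1 : ℝ)) (b := 1)) fun y hy => ?_
    have : 1 / 4 < y ^ 2 := by
      by_contra hcon
      push Not at hcon
      exact hy ⟨by nlinarith, by nlinarith⟩
    change y ^ 2 * radLap v (y ^ 2) = 0
    rw [radLap_radLap_cutSqrt this, mul_zero]
  have hlim : Tendsto (fun y : ℝ => 2 * y ^ 3 * deriv v (y ^ 2)) atTop (𝓝 (-2)) := by
    refine tendsto_const_nhds.congr' ?_
    filter_upwards [eventually_gt_atTop 1] with y hy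
    have hy0 : 0 < y := by linarith
    rw [deriv_radLap_cutSqrt (by nlinarith), ← Real.rpow_natCast y 2, ← Real.rpow_mul hy0.le]
    norm_num
    field_simp
  have hI := integral_Ioi_of_hasDerivAt_of_tendsto' hder hint hlim
  have hvol : (volume : Measure R3).real (Metric.ball 0 1) = Real.pi * 4 / 3 := by
    rw [measureReal_def, EuclideanSpace.volume_ball_fin_three]
    simp
    positivity
  simp only [finrank_euclideanSpace, Fintype.card_fin, smul_eq_mul, hvol, nsmul_eq_mul]
  norm_num at hI ⊢
  rw [hI]
  ring

theorem Dl_smoothNorm_smul {l : List (Fin 3)} (hl : 1 ≤ l.length) {p : R3}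
    (hp : 1 / 2 < ‖p‖) {s : ℝ} (hs : 1 ≤ s) :
    s ^ (l.length - 1) * Dl l smoothNorm (s • p) = Dl l smoothNorm p := by
  have hU : IsOpen {q : R3 | 1 / 2 < ‖q‖} := isOpen_lt continuous_const continuous_norm
  have h1 : ∀ q ∈ {q : R3 | 1 / 2 < ‖q‖}, smoothNorm.dilate s q = (s • smoothNorm) q := by
    intro q hq
    have hq' : 1 / 2 < ‖q‖ := hq
    have hn : ‖s • q‖ = s * ‖q‖ := by rw [norm_smul, Real.norm_of_nonneg (by linarith)]
    rw [Smooth3.dilate_apply, Smooth3.smul_apply, smoothNorm_of_ge hq'.le, smoothNorm_of_ge, hn]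
    rw [hn]; nlinarith
  have h2 := Dl_congr_on hU h1 l p hp
  rw [Dl_dilate, Dl_smul] at h2
  simp only [Smooth3.smul_apply, Smooth3.dilate_apply] at h2
  obtain ⟨m, hm⟩ : ∃ m, l.length = m + 1 := ⟨l.length - 1, by omega⟩
  rw [hm, pow_succ] at h2
  rw [hm, Nat.add_sub_cancel]
  have hs0 : s ≠ 0 := by linarith
  exact mul_left_cancel₀ hs0 (by linear_combination h2)

theorem exists_decay_smoothNorm {l : List (Fin 3)} (hl : 1 ≤ l.length) :
    ∃ C : ℝ, 0 ≤ C ∧ ∀ p : R3, p ≠ 0 → |Dl l smoothNorm p| ≤ C / ‖p‖ ^ (l.length - 1) := by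
  obtain ⟨C, hC0, hC⟩ := exists_decay (F := Dl l smoothNorm) (Smooth3.continuous _)
    (n := l.length - 1) (r := 1) one_pos (S := Set.univ) (fun _ _ _ _ => trivial)
    (fun p _ hpn s hs => Dl_smoothNorm_smul hl (by rw [hpn]; norm_num) hs)
  obtain ⟨C', hC'⟩ := (isCompact_closedBall (0 : R3) 1).exists_bound_of_continuousOn
    (Smooth3.continuous (Dl l smoothNorm)).continuousOn
  refine ⟨max C |C'|, le_max_of_le_left hC0, fun p hp => ?_⟩
  have hp0 : 0 < ‖p‖ := norm_pos_iff.2 hp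
  rcases le_or_gt 1 ‖p‖ with h | h
  · exact (hC p trivial h).trans (by gcongr; exact le_max_left _ _)
  · have h1 := hC' p (by simpa using h.le)
    rw [Real.norm_eq_abs] at h1
    calc |Dl l smoothNorm p| ≤ max C |C'| := h1.trans ((le_abs_self _).trans (le_max_right _ _))
      _ ≤ max C |C'| / ‖p‖ ^ (l.length - 1) := by
        rw [le_div_iff₀ (by positivity)]
        exact mul_le_of_le_one_right (le_max_of_le_left hC0) (pow_le_one₀ hp0.le h.le)

/-- The smoothed distance to `z` at scale `δ`. -/
def smoothDist (δ : ℝ) (z : R3) : Smooth3 :=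
  δ • smoothNorm.compDiag (fun _ => δ⁻¹) (fun i => -(δ⁻¹ * z i))

theorem diagMap_dist (δ : ℝ) (z x : R3) :
    diagMap (fun _ => δ⁻¹) (fun i => -(δ⁻¹ * z i)) x = δ⁻¹ • (x - z) := by
  ext i; simp; ring

theorem Dl_smoothDist (δ : ℝ) (z : R3) (l : List (Fin 3)) (x : R3) :
    Dl l (smoothDist δ z) x = δ * (δ⁻¹ ^ l.length * Dl l smoothNorm (δ⁻¹ • (x - z))) := by
  have h : ∀ l : List (Fin 3), Dl l (smoothDist δ z) = δ • δ⁻¹ ^ l.length •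
      (Dl l smoothNorm).compDiag (fun _ => δ⁻¹) (fun i => -(δ⁻¹ * z i)) := by
    intro l
    induction l with
    | nil => simp [Dl, smoothDist]
    | cons i l ih =>
      rw [Dl_cons, ih, Derivation.map_smul, Derivation.map_smul, D_compDiag]
      simp only [Dl_cons, List.length_cons, pow_succ, smul_smul]
  rw [h, Smooth3.smul_apply, Smooth3.smul_apply, Smooth3.compDiag_apply, diagMap_dist]

theorem smoothDist_of_ge {δ : ℝ} (hδ : 0 < δ) {z x : R3} (h : δ / 2 ≤ ‖x - z‖) :
    smoothDist δ z x = ‖x - z‖ := by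
  have h1 := Dl_smoothDist δ z [] x
  simp only [Dl, List.foldr_nil, List.length_nil, pow_zero, one_mul] at h1
  have hn : ‖δ⁻¹ • (x - z)‖ = δ⁻¹ * ‖x - z‖ := by
    rw [norm_smul, Real.norm_of_nonneg (by positivity)]
  rw [h1, smoothNorm_of_ge, hn]
  · field_simp
  · rw [hn, inv_mul_eq_div, le_div_iff₀ hδ]; linarith

/-- The powers of `δ` cancel, so the constant does not depend on `δ`. This uniformity is what
permits dominated convergence as the regularisation is removed. -/
theorem exists_decay_smoothDist {l : List (Fin 3)} (hl : 1 ≤ l.length) :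
    ∃ C : ℝ, 0 ≤ C ∧ ∀ δ : ℝ, 0 < δ → ∀ z x : R3, x ≠ z →
      |Dl l (smoothDist δ z) x| ≤ C / ‖x - z‖ ^ (l.length - 1) := by
  obtain ⟨C, hC0, hC⟩ := exists_decay_smoothNorm hl
  refine ⟨C, hC0, fun δ hδ z x hx => ?_⟩
  have hx' : x - z ≠ 0 := sub_ne_zero.2 hx
  have h := hC (δ⁻¹ • (x - z)) (smul_ne_zero (inv_ne_zero hδ.ne') hx')
  rw [norm_smul, Real.norm_of_nonneg (by positivity : 0 ≤ δ⁻¹), mul_pow] at h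
  rw [Dl_smoothDist]
  obtain ⟨m, hm⟩ : ∃ m, l.length = m + 1 := ⟨l.length - 1, by omega⟩
  rw [hm, Nat.add_sub_cancel] at h ⊢
  have hn : 0 < ‖x - z‖ := norm_pos_iff.2 hx'
  rw [abs_mul, abs_mul, abs_of_pos hδ, abs_of_pos (by positivity : 0 < δ⁻¹ ^ (m + 1))]
  calc δ * (δ⁻¹ ^ (m + 1) * |Dl l smoothNorm (δ⁻¹ • (x - z))|)
      ≤ δ * (δ⁻¹ ^ (m + 1) * (C / (δ⁻¹ ^ m * ‖x - z‖ ^ m))) := by gcongr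
    _ = C / ‖x - z‖ ^ m := by rw [pow_succ]; field_simp

/-- Obtained by differentiating `H² = ∑ (x_m - z_m)²` twice, without differentiating a square root.
-/
theorem D_D_smoothDist {δ : ℝ} (hδ : 0 < δ) {z x : R3} (h : δ / 2 < ‖x - z‖) (i j : Fin 3) :
    D i (D j (smoothDist δ z)) x =
      (if i = j then 1 else 0) / ‖x - z‖ - (x i - z i) * (x j - z j) / ‖x - z‖ ^ 3 := by
  set H := smoothDist δ z with hH
  have hU : IsOpen {y : R3 | δ / 2 < ‖y - z‖} :=
    isOpen_lt continuous_const (continuous_id.sub continuous_const).norm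
  have hsq : ∀ y ∈ {y : R3 | δ / 2 < ‖y - z‖}, (H * H) y =
      (∑ m : Fin 3, (coord m - z m • 1) * (coord m - z m • 1) : Smooth3) y := fun y hy => by
    have := norm_sq_eq (y - z)
    simp only [Smooth3.mul_apply, hH, smoothDist_of_ge hδ (le_of_lt hy), Smooth3.add_apply,
      Smooth3.sub_apply, Smooth3.smul_apply, Smooth3.one_apply, coord_apply, Fin.sum_univ_three]
    simp only [PiLp.sub_apply] at this
    linear_combination this
  have h1 := D_congr_on hU hsq
  have h2 := fun j => D_congr_on hU (h1 j) i x h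
  have hx : H x = ‖x - z‖ := smoothDist_of_ge hδ h.le
  have h0 : ‖x - z‖ ≠ 0 := by linarith [half_pos hδ]
  have hD : ∀ m, D m H x = (x m - z m) / ‖x - z‖ := fun m => by
    have := h1 m x h
    rw [eq_div_iff h0, ← hx]
    fin_cases m <;> simp [Fin.sum_univ_three] at this ⊢ <;> linear_combination this / 2
  have h3 := h2 j
  simp only [Derivation.leibniz, smul_eq_mul, map_add, Smooth3.add_apply, Smooth3.mul_apply,
    hx, hD] at h3
  have h4 : D i (D j (∑ m : Fin 3, (coord m - z m • 1) * (coord m - z m • 1) : Smooth3)) x =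
      2 * (if i = j then 1 else 0) := by
    fin_cases i <;> fin_cases j <;> simp [Fin.sum_univ_three] <;> norm_num
  rw [h4] at h3
  field_simp at h3 ⊢
  linear_combination h3 / 2

end

/-! ### Approximate identity -/

section

section ApproximateIdentity

theorem bilap_smoothDist (δ : ℝ) (z x : R3) :
    lap (lap (smoothDist δ z)) x = δ * (δ⁻¹ ^ 4 * bilapNorm (δ⁻¹ • (x - z))) := by
  have h := fun i j => Dl_smoothDist δ z [i, i, j, j] x
  simp only [Dl, List.foldr, List.length_cons, List.length_nil] at h
  simp only [bilapNorm, lap, map_sum, Smooth3.sum_apply, Finset.mul_sum, h]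

theorem bilap_smoothDist_eq_zero {δ : ℝ} (hδ : 0 < δ) {z x : R3} (h : δ / 2 < ‖x - z‖) :
    lap (lap (smoothDist δ z)) x = 0 := by
  rw [bilap_smoothDist, bilapNorm_eq_zero]
  · simp
  · rw [norm_smul, Real.norm_of_nonneg (by positivity), inv_mul_eq_div, lt_div_iff₀ hδ]; linarith

theorem hasCompactSupport_bilap_smoothDist {δ : ℝ} (hδ : 0 < δ) (z : R3) :
    HasCompactSupport (lap (lap (smoothDist δ z)) : R3 → ℝ) :=
  HasCompactSupport.intro (isCompact_closedBall z (δ / 2)) fun x hx =>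
    bilap_smoothDist_eq_zero hδ (by simpa [dist_eq_norm] using hx)

theorem integral_scaled {δ : ℝ} (hδ : 0 < δ) (z : R3) (g : R3 → ℝ) :
    ∫ x, δ * (δ⁻¹ ^ 4 * g (δ⁻¹ • (x - z))) = ∫ p, g p := by
  rw [integral_const_mul, integral_const_mul,
    integral_sub_right_eq_self (fun x => g (δ⁻¹ • x)) z, Measure.integral_comp_smul]
  simp only [finrank_euclideanSpace, Fintype.card_fin, smul_eq_mul]
  rw [abs_of_pos (by positivity)]
  field_simp

/-- The bilaplacians have integral `-8π`, an `L¹` norm independent of `δ` and support shrinking to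
`z`. Continuity of `v` is needed only at `z`. -/
theorem tendsto_integral_bilap {v : R3 → ℝ} (hv : LocallyIntegrable v volume) {z : R3}
    (hc : ContinuousAt v z) :
    Tendsto (fun δ : ℝ => ∫ x, v x * lap (lap (smoothDist δ z)) x) (𝓝[>] 0)
      (𝓝 (-(8 * Real.pi) * v z)) := by
  rw [Metric.tendsto_nhds]
  intro ε hε
  set I := ∫ p, |bilapNorm p| with hI
  have hI0 : 0 ≤ I := integral_nonneg fun _ => abs_nonneg _
  obtain ⟨r, hr, hball⟩ := Metric.continuousAt_iff.1 hc (ε / (I + 1)) (by positivity)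
  filter_upwards [Ioo_mem_nhdsGT hr] with δ hδ
  have hδ0 : 0 < δ := hδ.1
  have hcs := hasCompactSupport_bilap_smoothDist hδ0 z
  have hcont := Smooth3.continuous (lap (lap (smoothDist δ z)))
  have h1 : ∫ x, lap (lap (smoothDist δ z)) x = -(8 * Real.pi) := by
    simp_rw [bilap_smoothDist]
    rw [integral_scaled hδ0, integral_bilapNorm]
  have h2 : ∫ x, |lap (lap (smoothDist δ z)) x| = I := by
    simp_rw [bilap_smoothDist, abs_mul, abs_of_pos hδ0,
      abs_of_pos (show 0 < δ⁻¹ ^ 4 by positivity)]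
    exact integral_scaled hδ0 z (fun p => |bilapNorm p|)
  have hi := hcont.integrable_of_hasCompactSupport (μ := volume) hcs
  rw [Real.dist_eq, ← h1, mul_comm _ (v z), ← integral_const_mul,
    ← integral_sub (integrable_mul_of_compact hv hcont hcs) (hi.const_mul _)]
  calc |∫ x, (v x * lap (lap (smoothDist δ z)) x - v z * lap (lap (smoothDist δ z)) x)|
      ≤ ∫ x, ε / (I + 1) * |lap (lap (smoothDist δ z)) x| := by
        rw [← Real.norm_eq_abs]
        refine norm_integral_le_of_norm_le (hi.abs.const_mul _)
          (Filter.Eventually.of_forall fun x => ?_)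
        rw [← sub_mul, Real.norm_eq_abs, abs_mul]
        by_cases hx : δ / 2 < ‖x - z‖
        · rw [bilap_smoothDist_eq_zero hδ0 hx]; simp
        · refine mul_le_mul_of_nonneg_right ?_ (abs_nonneg _)
          have := hball (x := x) (by rw [dist_eq_norm]; linarith [hδ.2, not_lt.1 hx])
          rw [Real.dist_eq] at this
          exact this.le
    _ = ε / (I + 1) * I := by rw [integral_const_mul, h2]
    _ < ε := by rw [div_mul_eq_mul_div, div_lt_iff₀ (by positivity)]; nlinarith

end ApproximateIdentity

/-! ### Cut-off functions at large scale -/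

section Cutoff

theorem contDiff_cut : ContDiff ℝ ∞ (fun s : ℝ => Real.smoothTransition (2 - s)) :=
  (Real.smoothTransition.contDiff (n := ⊤)).comp (contDiff_const.sub contDiff_id)

/-- A smooth cut-off function equal to `1` on the ball of radius `R` and to `0` outside the ball of
radius `2 R`. -/
def cutoff (R : ℝ) : Smooth3 := (radial _ contDiff_cut).dilate R⁻¹

theorem cutoff_apply (R : ℝ) (x : R3) :
    cutoff R x = Real.smoothTransition (2 - ‖R⁻¹ • x‖ ^ 2) := by
  rw [cutoff, Smooth3.dilate_apply, radial_apply]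

theorem cutoff_eq_one {R : ℝ} (hR : 0 < R) {x : R3} (hx : ‖x‖ ≤ R) : cutoff R x = 1 := by
  rw [cutoff_apply, Real.smoothTransition.one_of_one_le]
  have : ‖R⁻¹ • x‖ ≤ 1 := by
    rw [norm_smul, Real.norm_of_nonneg (by positivity), inv_mul_eq_div]
    exact div_le_one_of_le₀ hx hR.le
  nlinarith [norm_nonneg (R⁻¹ • x)]

theorem cutoff_eq_zero {R : ℝ} (hR : 0 < R) {x : R3} (hx : 2 * R < ‖x‖) : cutoff R x = 0 := by
  rw [cutoff_apply, Real.smoothTransition.zero_of_nonpos]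
  have : 2 < ‖R⁻¹ • x‖ := by
    rw [norm_smul, Real.norm_of_nonneg (by positivity), inv_mul_eq_div, lt_div_iff₀ hR]
    exact hx
  nlinarith

theorem hasCompactSupport_cutoff {R : ℝ} (hR : 0 < R) : HasCompactSupport (cutoff R : R3 → ℝ) :=
  HasCompactSupport.intro (isCompact_closedBall (0 : R3) (2 * R)) fun x hx =>
    cutoff_eq_zero hR (by simpa using hx)

theorem hasCompactSupport_Dl {f : Smooth3} (h : HasCompactSupport (f : R3 → ℝ))
    (l : List (Fin 3)) : HasCompactSupport (Dl l f : R3 → ℝ) := by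
  induction l with
  | nil => exact h
  | cons i l ih => exact hasCompactSupport_D ih i

theorem exists_bound_Dl_cutoff (l : List (Fin 3)) :
    ∃ C : ℝ, 0 ≤ C ∧ ∀ R : ℝ, 0 < R → ∀ x, |Dl l (cutoff R) x| ≤ C / R ^ l.length := by
  have h1 : cutoff 1 = radial _ contDiff_cut := by
    ext x; rw [cutoff, Smooth3.dilate_apply, inv_one, one_smul]
  have hc := hasCompactSupport_Dl (hasCompactSupport_cutoff one_pos) l
  obtain ⟨C, hC⟩ := hc.exists_bound_of_continuous (Smooth3.continuous _)
  refine ⟨C, (norm_nonneg _).trans (hC 0), fun R hR x => ?_⟩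
  rw [cutoff, Dl_dilate, Smooth3.smul_apply, Smooth3.dilate_apply, abs_mul,
    abs_of_pos (by positivity), inv_pow, inv_mul_eq_div, ← h1]
  exact div_le_div_of_nonneg_right (hC _) (by positivity)

theorem D_cutoff_eq_zero {R : ℝ} (hR : 0 < R) (j : Fin 3) {x : R3}
    (hx : ‖x‖ < R ∨ 2 * R < ‖x‖) : D j (cutoff R) x = 0 := by
  rcases hx with hx | hx
  · have h := D_congr_on (f := cutoff R) (g := 1) (U := {y | ‖y‖ < R})
      (isOpen_lt continuous_norm continuous_const)
      (fun y hy => cutoff_eq_one hR (le_of_lt hy)) j x hx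
    simpa using h
  · exact D_zero_on (U := {y | 2 * R < ‖y‖}) (isOpen_lt continuous_const continuous_norm)
      (fun y hy => cutoff_eq_zero hR hy) j x hx

theorem abs_integral_le_of_ball {f : R3 → ℝ} {R M : ℝ} (hR : 0 ≤ R)
    (hf : ∀ x, 2 * R < ‖x‖ → f x = 0) (hM : ∀ x, |f x| ≤ M) :
    |∫ x, f x| ≤ M * (32 * Real.pi / 3) * R ^ 3 := by
  have h0 : ∀ x ∉ Metric.closedBall (0 : R3) (2 * R), f x = 0 := fun x hx =>
    hf x (by simpa using hx)
  rw [← setIntegral_eq_integral_of_forall_compl_eq_zero h0, ← Real.norm_eq_abs]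
  refine (norm_setIntegral_le_of_norm_le_const measure_closedBall_lt_top
    (fun x _ => hM x)).trans (le_of_eq ?_)
  rw [measureReal_def, EuclideanSpace.volume_closedBall_fin_three, ENNReal.toReal_mul,
    ENNReal.toReal_pow, ENNReal.toReal_ofReal (by positivity),
    ENNReal.toReal_ofReal (by positivity)]
  ring

end Cutoff

/-! ### The weak equation for piecewise smooth test fields -/

section Pairing

theorem integrable_mul_glue {w : R3 → ℝ} (hw : LocallyIntegrable w volume) {A B : Smooth3}
    (hA : HasCompactSupport (A : R3 → ℝ)) (hB : HasCompactSupport (B : R3 → ℝ)) :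
    Integrable (fun x => w x * glue A B x) := by
  have h := (integrable_mul_of_compact hw A.continuous hA).indicator
    (isOpen_upper.measurableSet.compl)
  have h' := (integrable_mul_of_compact hw B.continuous hB).indicator isOpen_upper.measurableSet
  refine (h.add h').congr (Filter.Eventually.of_forall fun x => ?_)
  by_cases hx : 0 < x 2 <;> simp [Set.indicator, glue, hx]

theorem matrixDot_elasticityAction (lam mu : ℝ) (A B : Matrix (Fin 3) (Fin 3) ℝ) :
    matrixDot (elasticityAction lam mu A) B = matrixDot A (elasticityAction lam mu B) := by
  simp only [matrixDot, elasticityAction_eq, Fin.sum_univ_three]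
  simp
  ring

theorem locallyIntegrable_inclusionAction {lam mu lamI muI : ℝ}
    {V : R3 → Matrix (Fin 3) (Fin 3) ℝ} (hV : ∀ i j, LocallyIntegrable (fun x => V x i j) volume)
    (i j : Fin 3) : LocallyIntegrable
      (fun x => inclusionAction lam mu lamI muI upperHalfSpace x (V x) i j) volume := by
  have h : ∀ lam mu : ℝ, LocallyIntegrable (fun x => elasticityAction lam mu (V x) i j) volume := by
    intro lam mu
    simp_rw [elasticityAction_eq, Fin.sum_univ_three]
    refine LocallyIntegrable.add ?_ (((hV i j).add (hV j i)).smul mu)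
    by_cases hij : i = j
    · simp only [hij, if_true]
      exact (((hV 0 0).add (hV 1 1)).add (hV 2 2)).smul lam
    · simp only [hij, if_false, mul_zero]
      exact locallyIntegrable_const _
  have hm : MeasurableSet upperHalfSpace := isOpen_upper.measurableSet
  refine (((h lamI muI).indicator hm).add ((h lam mu).indicator hm.compl)).congr
    (Filter.Eventually.of_forall fun x => ?_)
  by_cases hx : x ∈ upperHalfSpace <;> simp [inclusionAction, hx]

theorem IsWeakDeriv.of_hasWeakGradient {u : R3 → R3} {V : R3 → Matrix (Fin 3) (Fin 3) ℝ}
    (h : HasWeakGradient u V) (i j : Fin 3) :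
    IsWeakDeriv j (fun x => u x i) (fun x => V x i j) :=
  fun ψ hψ => h.2 i j ψ ψ.contDiff hψ

/-- The vector field with smooth components `U`. -/
def vec (U : Fin 3 → Smooth3) (x : R3) : R3 := WithLp.toLp 2 fun i => U i x

theorem contDiff_vec (U : Fin 3 → Smooth3) : ContDiff ℝ ∞ (vec U) :=
  contDiff_euclidean.2 fun i => (U i).contDiff

theorem grad_apply {φ : R3 → R3} {x : R3} (h : DifferentiableAt ℝ φ x) (i j : Fin 3) :
    grad φ x i j = fderiv ℝ (fun y => φ y i) x (e j) := by
  have h1 : HasFDerivAt (fun y => φ y i)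
      ((EuclideanSpace.proj i : R3 →L[ℝ] ℝ).comp (fderiv ℝ φ x)) x :=
    (EuclideanSpace.proj i : R3 →L[ℝ] ℝ).hasFDerivAt.comp x h.hasFDerivAt
  rw [h1.fderiv]; rfl

theorem grad_vec (U : Fin 3 → Smooth3) (x : R3) (i j : Fin 3) :
    grad (vec U) x i j = D j (U i) x :=
  grad_apply ((contDiff_vec U).differentiable (by simp) x) i j

theorem inner_vec (l : R3) (U : Fin 3 → Smooth3) (x : R3) :
    inner ℝ l (vec U x) = ∑ i, l i * U i x := by
  simp [PiLp.inner_apply, vec, mul_comm]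

theorem hasCompactSupport_vec {U : Fin 3 → Smooth3}
    (h : ∀ i, HasCompactSupport (U i : R3 → ℝ)) : HasCompactSupport (vec U) := by
  refine HasCompactSupport.intro (K := ⋃ i, tsupport (U i : R3 → ℝ))
    (isCompact_iUnion fun i => h i) fun x hx => ?_
  ext i
  simp only [Set.mem_iUnion, not_exists] at hx
  exact image_eq_zero_of_notMem_tsupport (f := (U i : R3 → ℝ)) (hx i)

theorem exists_vec {φ : R3 → R3} (h : ContDiff ℝ ∞ φ) : ∃ U, φ = vec U :=
  ⟨fun i => .of (fun x => φ x i) (contDiff_euclidean.1 h i), by ext x i; rfl⟩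

/-- The weak equation extends to piecewise smooth compactly supported test fields. -/
theorem weak_equation_glue {lam mu lamI muI : ℝ} {y l : R3}
    {V : R3 → Matrix (Fin 3) (Fin 3) ℝ}
    (hV : ∀ i j, LocallyIntegrable (fun x => V x i j) volume)
    (hw : ∀ φ : R3 → R3, ContDiff ℝ ∞ φ → HasCompactSupport φ →
        ∫ x, matrixDot (inclusionAction lam mu lamI muI upperHalfSpace x (V x)) (grad φ x)
          = inner ℝ l (φ y)) (hy : y 2 ≤ 0) {A B : Fin 3 → Smooth3}
    (hA : ∀ i, HasCompactSupport (A i : R3 → ℝ)) (hB : ∀ i, HasCompactSupport (B i : R3 → ℝ))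
    (hAB : ∀ i, ∀ x : R3, x 2 = 0 → A i x = B i x) :
    ∑ i, ∑ j, ∫ x, V x i j * glue (stress lam mu A i j) (stress lamI muI B i j) x =
      ∑ i, l i * A i y := by
  set W : Fin 3 → Fin 3 → R3 → ℝ := fun i j x =>
    inclusionAction lam mu lamI muI upperHalfSpace x (V x) i j with hW
  have hWi : ∀ i j, LocallyIntegrable (W i j) volume := fun i j =>
    locallyIntegrable_inclusionAction hV i j
  have hlim : Tendsto (fun n : ℕ => ∑ i, ∑ j, ∫ x, W i j x * D j (blend (A i) (B i) n) x) atTop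
      (𝓝 (∑ i, ∑ j, ∫ x, W i j x * glue (D j (A i)) (D j (B i)) x)) :=
    tendsto_finsetSum _ fun i _ => tendsto_finsetSum _ fun j _ =>
      tendsto_integral_D_blend (hWi i j) (hA i) (hB i) j fun _ => hAB i
  -- The right-hand side does not depend on `n`: the pole satisfies `y₃ ≤ 0`, where every blend
  -- equals `A`.
  have hconst : ∀ n : ℕ, ∑ i, ∑ j, ∫ x, W i j x * D j (blend (A i) (B i) n) x =
      ∑ i, l i * A i y := by
    intro n
    have hcs : ∀ i, HasCompactSupport (blend (A i) (B i) n : R3 → ℝ) := fun i =>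
      hasCompactSupport_blend (hA i) (hB i) n
    have h := hw _ (contDiff_vec fun i => blend (A i) (B i) n) (hasCompactSupport_vec hcs)
    rw [inner_vec] at h
    simp only [matrixDot, grad_vec] at h
    rw [integral_finsetSum _ (fun i _ => integrable_finsetSum _ fun j _ =>
      integrable_mul_of_compact (hWi i j) (Smooth3.continuous _)
        (hasCompactSupport_D (hcs i) j))] at h
    simp_rw [fun i => integral_finsetSum (μ := (volume : Measure R3)) Finset.univ (fun j _ =>
      integrable_mul_of_compact (hWi i j) (Smooth3.continuous _)
        (hasCompactSupport_D (hcs i) j))] at h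
    rw [h]
    simp [blend_apply, step_of_nonpos n hy]
  have hfin := tendsto_nhds_unique hlim (by simp_rw [hconst]; exact tendsto_const_nhds)
  rw [← hfin]
  have hstress : ∀ {lam mu : ℝ} {A : Fin 3 → Smooth3}, (∀ i, HasCompactSupport (A i : R3 → ℝ)) →
      ∀ i j, HasCompactSupport (stress lam mu A i j : R3 → ℝ) := by
    intro lam mu A hA i j
    refine HasCompactSupport.intro (K := ⋃ i, tsupport (A i : R3 → ℝ))
      (isCompact_iUnion fun i => hA i) fun x hx => ?_
    simp only [Set.mem_iUnion, not_exists] at hx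
    have hz : ∀ i j, D j (A i) x = 0 := fun i j =>
      image_eq_zero_of_notMem_tsupport fun h => hx i (D_tsupport_subset _ _ h)
    rw [stress_apply]
    simp [hz, elasticityAction]
  have hi1 : ∀ i j, Integrable (fun x => W i j x * glue (D j (A i)) (D j (B i)) x) := fun i j =>
    integrable_mul_glue (hWi i j) (hasCompactSupport_D (hA i) j) (hasCompactSupport_D (hB i) j)
  have hi2 : ∀ i j, Integrable
      (fun x => V x i j * glue (stress lam mu A i j) (stress lamI muI B i j) x) := fun i j =>
    integrable_mul_glue (hV i j) (hstress hA i j) (hstress hB i j)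
  simp_rw [← fun i => integral_finsetSum (μ := (volume : Measure R3)) Finset.univ
    (fun j _ => hi1 i j), ← fun i => integral_finsetSum (μ := (volume : Measure R3)) Finset.univ
    (fun j _ => hi2 i j)]
  rw [← integral_finsetSum _ (fun i _ => integrable_finsetSum _ fun j _ => hi1 i j),
    ← integral_finsetSum _ (fun i _ => integrable_finsetSum _ fun j _ => hi2 i j)]
  congr 1
  ext x
  -- The symmetry of the elasticity tensor moves it from the weak gradient to the test field.
  by_cases hx : 0 < x 2
  · have hx' : x ∈ upperHalfSpace := hx
    simp only [glue, hx, if_true, stress_apply, hW, inclusionAction, hx']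
    exact (matrixDot_elasticityAction _ _ _ _).symm
  · have hx' : x ∉ upperHalfSpace := hx
    simp only [glue, hx, if_false, stress_apply, hW, inclusionAction, hx']
    exact (matrixDot_elasticityAction _ _ _ _).symm

end Pairing

end

/-! ### Betti reciprocity -/

section

section Pairing

/-- The part of the stress of `η A` which involves derivatives of the cut-off `η`. -/
def cutStress (lam mu : ℝ) (η : Smooth3) (A : Fin 3 → Smooth3) (i j : Fin 3) : Smooth3 :=
  lam • (if i = j then ∑ m, D m η * A m else 0) + mu • (D j η * A i + D i η * A j)

theorem stress_mul (lam mu : ℝ) (η : Smooth3) (A : Fin 3 → Smooth3) (i j : Fin 3) :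
    stress lam mu (fun i => η * A i) i j = η * stress lam mu A i j + cutStress lam mu η A i j := by
  ext x
  by_cases h : i = j <;> simp [stress, cutStress, divF, h, Fin.sum_univ_three] <;> ring

theorem abs_isotropic_le {lam mu s t K : ℝ} (P : Prop) [Decidable P] (hs : |s| ≤ K) (ht : |t| ≤ K) :
    |lam * (if P then s else 0) + mu * t| ≤ (|lam| + |mu|) * K := by
  have hK : 0 ≤ K := (abs_nonneg _).trans hs
  have h1 : |if P then s else 0| ≤ K := by split_ifs <;> simp [hs, hK]
  calc _ ≤ |lam| * |if P then s else 0| + |mu| * |t| := by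
        rw [← abs_mul, ← abs_mul]; exact abs_add_le _ _
    _ ≤ |lam| * K + |mu| * K := by gcongr
    _ = _ := by ring

theorem abs_sum_three_le {f : Fin 3 → ℝ} {K : ℝ} (h : ∀ i, |f i| ≤ K) : |∑ i, f i| ≤ 3 * K := by
  refine (Finset.abs_sum_le_sum_abs _ _).trans ((Finset.sum_le_sum fun i _ => h i).trans ?_)
  simp

theorem abs_stress_le {lam mu q : ℝ} {A : Fin 3 → Smooth3} {x : R3}
    (h : ∀ i j, |D j (A i) x| ≤ q) (i j : Fin 3) :
    |stress lam mu A i j x| ≤ (|lam| + |mu|) * (3 * q) := by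
  have hq : 0 ≤ q := (abs_nonneg _).trans (h 0 0)
  have h1 : stress lam mu A i j x = lam * (if i = j then ∑ m, D m (A m) x else 0) +
      mu * (D j (A i) x + D i (A j) x) := by
    by_cases h : i = j <;> simp [stress, divF, h] <;> ring
  rw [h1]
  refine abs_isotropic_le _ (abs_sum_three_le fun m => h m m) ?_
  linarith [abs_add_le (D j (A i) x) (D i (A j) x), h i j, h j i]

theorem abs_cutStress_le {lam mu p q : ℝ} {η : Smooth3} {A : Fin 3 → Smooth3} {x : R3}
    (hη : ∀ j, |D j η x| ≤ p) (h : ∀ i, |A i x| ≤ q) (i j : Fin 3) :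
    |cutStress lam mu η A i j x| ≤ (|lam| + |mu|) * (3 * (p * q)) := by
  have hp : 0 ≤ p := (abs_nonneg _).trans (hη 0)
  have hq : 0 ≤ q := (abs_nonneg _).trans (h 0)
  have h2 : ∀ i j, |D j η x * A i x| ≤ p * q := fun i j => by
    rw [abs_mul]; exact mul_le_mul (hη j) (h i) (abs_nonneg _) hp
  have h1 : cutStress lam mu η A i j x = lam * (if i = j then ∑ m, D m η x * A m x else 0) +
      mu * (D j η x * A i x + D i η x * A j x) := by
    by_cases h : i = j <;> simp [cutStress, h] <;> ring
  rw [h1]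
  refine abs_isotropic_le _ (abs_sum_three_le fun m => h2 m m) ?_
  nlinarith [abs_add_le (D j η x * A i x) (D i η x * A j x), h2 i j, h2 j i, mul_nonneg hp hq]

theorem abs_D_cutStress_le {lam mu p p' q q' : ℝ} {η : Smooth3} {A : Fin 3 → Smooth3} {x : R3}
    (hη : ∀ j, |D j η x| ≤ p) (hη' : ∀ i j, |D i (D j η) x| ≤ p') (h : ∀ i, |A i x| ≤ q)
    (h' : ∀ i j, |D j (A i) x| ≤ q') (i j k : Fin 3) :
    |D k (cutStress lam mu η A i j) x| ≤ (|lam| + |mu|) * (3 * (p * q' + p' * q)) := by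
  have hp : 0 ≤ p := (abs_nonneg _).trans (hη 0)
  have hq : 0 ≤ q := (abs_nonneg _).trans (h 0)
  have hp' : 0 ≤ p' := (abs_nonneg _).trans (hη' 0 0)
  have hq' : 0 ≤ q' := (abs_nonneg _).trans (h' 0 0)
  have h2 : ∀ i j, |D k (D j η * A i) x| ≤ p * q' + p' * q := fun i j => by
    simp only [Derivation.leibniz, smul_eq_mul, Smooth3.add_apply, Smooth3.mul_apply]
    refine (abs_add_le _ _).trans (add_le_add ?_ ?_)
    · rw [abs_mul]; exact mul_le_mul (hη j) (h' i k) (abs_nonneg _) hp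
    · rw [abs_mul, mul_comm]; exact mul_le_mul (hη' k j) (h i) (abs_nonneg _) hp'
  have h1 : D k (cutStress lam mu η A i j) x =
      lam * (if i = j then ∑ m, D k (D m η * A m) x else 0) +
      mu * (D k (D j η * A i) x + D k (D i η * A j) x) := by
    by_cases h : i = j
    · simp only [cutStress, h, if_true, map_add, Derivation.map_smul, map_sum, Smooth3.add_apply,
        Smooth3.smul_apply, Smooth3.sum_apply]
    · simp only [cutStress, h, if_false, map_add, Derivation.map_smul, map_zero, Smooth3.add_apply,
        Smooth3.smul_apply, Smooth3.zero_apply]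
  rw [h1]
  refine abs_isotropic_le _ (abs_sum_three_le fun m => h2 m m) ?_
  have : 0 ≤ p * q' + p' * q := by positivity
  linarith [abs_add_le (D k (D j η * A i) x) (D k (D i η * A j) x), h2 i j, h2 j i]

theorem exists_bound_cutoff : ∃ C : ℝ, 0 ≤ C ∧ ∀ R : ℝ, 0 < R → ∀ x,
    (∀ j, |D j (cutoff R) x| ≤ C / R) ∧ ∀ i j, |D i (D j (cutoff R)) x| ≤ C / R ^ 2 := by
  choose C hC0 hC using exists_bound_Dl_cutoff
  refine ⟨∑ j, C [j] + ∑ i, ∑ j, C [i, j], add_nonneg (Finset.sum_nonneg fun _ _ => hC0 _)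
    (Finset.sum_nonneg fun _ _ => Finset.sum_nonneg fun _ _ => hC0 _),
    fun R hR x => ⟨fun j => ?_, fun i j => ?_⟩⟩
  · have h := hC [j] R hR x
    simp only [List.length_cons, List.length_nil, zero_add, pow_one] at h
    refine h.trans (div_le_div_of_nonneg_right ?_ hR.le)
    exact (Finset.single_le_sum (fun j _ => hC0 [j]) (Finset.mem_univ j)).trans
      (le_add_of_nonneg_right
        (Finset.sum_nonneg fun _ _ => Finset.sum_nonneg fun _ _ => hC0 _))
  · refine (hC [i, j] R hR x).trans (div_le_div_of_nonneg_right ?_ (by positivity))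
    refine ((Finset.single_le_sum (fun j _ => hC0 [i, j]) (Finset.mem_univ j)).trans
      (Finset.single_le_sum (f := fun i => ∑ j, C [i, j])
        (fun i _ => Finset.sum_nonneg fun _ _ => hC0 _) (Finset.mem_univ i))).trans
      (le_add_of_nonneg_left (Finset.sum_nonneg fun _ _ => hC0 _))

theorem abs_glue_le_of {P Q : R3 → ℝ} {x : R3} {K : ℝ} (h1 : x 2 ≤ 0 → |P x| ≤ K)
    (h2 : 0 < x 2 → |Q x| ≤ K) : |glue P Q x| ≤ K := by
  unfold glue; split_ifs with h
  · exact h2 h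
  · exact h1 (not_lt.1 h)

/-- A pair of fields, one below and one above the interface, satisfying the transmission
conditions, with Lamé operator `F`, and decaying like the fundamental solution. -/
structure IsTransmission (lam mu lamI muI a M : ℝ) (A B F : Fin 3 → Smooth3) : Prop where
  lower : ∀ i (x : R3), x 2 ≤ a → |A i x| ≤ M / (1 + ‖x‖)
  lower_deriv : ∀ i j (x : R3), x 2 ≤ a → |D j (A i) x| ≤ M / (1 + ‖x‖) ^ 2
  upper : ∀ i (x : R3), 0 ≤ x 2 → |B i x| ≤ M / (1 + ‖x‖)
  upper_deriv : ∀ i j (x : R3), 0 ≤ x 2 → |D j (B i) x| ≤ M / (1 + ‖x‖) ^ 2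
  displacement : ∀ i (x : R3), x 2 = 0 → A i x = B i x
  traction : ∀ i (x : R3), x 2 = 0 → stress lam mu A i 2 x = stress lamI muI B i 2 x
  compact : ∀ i, HasCompactSupport (F i : R3 → ℝ)
  lame_eq : ∀ i, glue (lame lam mu A i) (lame lamI muI B i) = F i

variable {lam mu lamI muI a M : ℝ} {A B F : Fin 3 → Smooth3}

/-- Both integrands live in the shell `R ≤ ‖x‖ ≤ 2R`. In the first, `∂η` is `O(1/R)` and the stress
`O(1/R²)`, against a volume `O(R³)` and `|u| ≤ ε`. For `v` nothing beyond local integrability is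
known, so the second integral is transferred to `u` by parts. The cut stress jumps across the
interface, by `O(1/R²)` over an area `O(R²)`, which `exists_jump_bound` controls. That lemma looks
at both fields in `0 < x₃ < a`, which is why the lower field is controlled up to height `a`. -/
theorem IsTransmission.cutoff_error (h : IsTransmission lam mu lamI muI a M A B F) (ha : 0 < a) :
    ∃ K : ℝ, 0 ≤ K ∧ ∀ (u v : R3 → ℝ) (i j : Fin 3), LocallyIntegrable u volume →
      LocallyIntegrable v volume → IsWeakDeriv j u v → ∀ ε R : ℝ, 0 ≤ ε → 1 ≤ R →
      (∀ x, R ≤ ‖x‖ → |u x| ≤ ε) →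
      |∫ x, u x * glue (D j (cutoff R) * stress lam mu A i j : Smooth3)
        (D j (cutoff R) * stress lamI muI B i j : Smooth3) x| ≤ K * ε ∧
      |∫ x, v x * glue (cutStress lam mu (cutoff R) A i j)
        (cutStress lamI muI (cutoff R) B i j) x| ≤ K * ε := by
  obtain ⟨C, hC0, hC⟩ := exists_bound_cutoff
  obtain ⟨J, hJ0, hJ⟩ := exists_jump_bound
  have hM0 : 0 ≤ M := by
    have := (abs_nonneg _).trans (h.upper 0 0 (by simp))
    simpa using this
  set L := |lam| + |mu| + |lamI| + |muI| with hL
  have hL0 : 0 ≤ L := by positivity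
  set K1 := L * (3 * (C * M + C * M)) with hK1
  have hK10 : 0 ≤ K1 := by positivity
  refine ⟨K1 * (32 * Real.pi / 3) + 8 * J * K1, by positivity,
    fun u v i j hu hv huv ε R hε hR hue => ?_⟩
  have hR0 : 0 < R := by linarith
  have hKR : 0 ≤ K1 / R ^ 3 := by positivity
  have hcs := hasCompactSupport_cutoff hR0
  have hD0 : ∀ (j : Fin 3) (x : R3), ‖x‖ < R ∨ 2 * R < ‖x‖ → D j (cutoff R) x = 0 :=
    fun j x hx => D_cutoff_eq_zero hR0 j hx
  have hDD0 : ∀ (i j : Fin 3) (x : R3), ‖x‖ < R ∨ 2 * R < ‖x‖ → D i (D j (cutoff R)) x = 0 := by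
    intro i j x hx
    rcases hx with hx | hx
    · exact D_zero_on (isOpen_lt continuous_norm continuous_const)
        (fun y hy => hD0 j y (Or.inl hy)) i x hx
    · exact D_zero_on (isOpen_lt continuous_const continuous_norm)
        (fun y hy => hD0 j y (Or.inr hy)) i x hx
  have hcut0 : ∀ (lam mu : ℝ) (A : Fin 3 → Smooth3) (x : R3), ‖x‖ < R ∨ 2 * R < ‖x‖ →
      cutStress lam mu (cutoff R) A i j x = 0 ∧
      D j (cutStress lam mu (cutoff R) A i j) x = 0 := by
    intro lam mu A x hx
    constructor
    · by_cases hij : i = j <;> simp [cutStress, hij, hD0 _ x hx]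
    · by_cases hij : i = j <;> simp [cutStress, hij, hD0 _ x hx, hDD0 _ _ x hx]
  have hfar : ∀ x : R3, R ≤ ‖x‖ → M / (1 + ‖x‖) ≤ M / R ∧ M / (1 + ‖x‖) ^ 2 ≤ M / R ^ 2 :=
    fun x hx => ⟨by gcongr; linarith, by gcongr; linarith⟩
  have hcsG : ∀ (lam mu : ℝ) (A : Fin 3 → Smooth3),
      HasCompactSupport (cutStress lam mu (cutoff R) A i j : R3 → ℝ) := fun lam mu A =>
    HasCompactSupport.intro (isCompact_closedBall (0 : R3) (2 * R)) fun x hx =>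
      (hcut0 lam mu A x (Or.inr (by simpa using hx))).1
  -- Uniform bounds in the region `‖x‖ ≥ R`.
  have bound : ∀ {lam mu : ℝ} {A : Fin 3 → Smooth3} {x : R3}, |lam| + |mu| ≤ L → R ≤ ‖x‖ →
      (∀ i, |A i x| ≤ M / (1 + ‖x‖)) → (∀ i j, |D j (A i) x| ≤ M / (1 + ‖x‖) ^ 2) →
      |D j (cutoff R) x * stress lam mu A i j x| ≤ K1 / R ^ 3 ∧
      |cutStress lam mu (cutoff R) A i j x| ≤ K1 / R ^ 2 ∧
      |D j (cutStress lam mu (cutoff R) A i j) x| ≤ K1 / R ^ 3 := by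
    intro lam mu A x hl hx h1 h2
    have h1' := fun i => (h1 i).trans (hfar x hx).1
    have h2' := fun i j => (h2 i j).trans (hfar x hx).2
    refine ⟨?_, ?_, ?_⟩
    · rw [abs_mul]
      calc _ ≤ C / R * ((|lam| + |mu|) * (3 * (M / R ^ 2))) :=
            mul_le_mul ((hC R hR0 x).1 j) (abs_stress_le h2' i j) (abs_nonneg _) (by positivity)
        _ ≤ C / R * (L * (3 * (M / R ^ 2))) := by gcongr
        _ = L * (3 * (C * M)) / R ^ 3 := by field_simp
        _ ≤ K1 / R ^ 3 := by
          gcongr; rw [hK1]; gcongr; nlinarith [mul_nonneg hC0 hM0]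
    · refine (abs_cutStress_le (hC R hR0 x).1 h1' i j).trans ?_
      calc _ ≤ L * (3 * (C / R * (M / R))) := by gcongr
        _ = L * (3 * (C * M)) / R ^ 2 := by field_simp
        _ ≤ K1 / R ^ 2 := by
          gcongr; rw [hK1]; gcongr; nlinarith [mul_nonneg hC0 hM0]
    · refine (abs_D_cutStress_le (hC R hR0 x).1 (hC R hR0 x).2 h1' h2' i j j).trans ?_
      calc _ ≤ L * (3 * (C / R * (M / R ^ 2) + C / R ^ 2 * (M / R))) := by gcongr
        _ = K1 / R ^ 3 := by rw [hK1]; field_simp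
  have hLm : |lam| + |mu| ≤ L := by rw [hL]; linarith [abs_nonneg lamI, abs_nonneg muI]
  have hLI : |lamI| + |muI| ≤ L := by rw [hL]; linarith [abs_nonneg lam, abs_nonneg mu]
  have bA : ∀ {x : R3}, x 2 ≤ a → R ≤ ‖x‖ → _ := fun {x} hx hxR =>
    bound (lam := lam) (mu := mu) (A := A) (x := x) hLm hxR (fun i => h.lower i x hx)
      (fun i j => h.lower_deriv i j x hx)
  have bB : ∀ {x : R3}, 0 ≤ x 2 → R ≤ ‖x‖ → _ := fun {x} hx hxR =>
    bound (lam := lamI) (mu := muI) (A := B) (x := x) hLI hxR (fun i => h.upper i x hx)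
      (fun i j => h.upper_deriv i j x hx)
  have key : ∀ P Q : R3 → ℝ, (∀ x : R3, ‖x‖ < R ∨ 2 * R < ‖x‖ → P x = 0 ∧ Q x = 0) →
      (∀ x : R3, x 2 ≤ 0 → R ≤ ‖x‖ → |P x| ≤ K1 / R ^ 3) →
      (∀ x : R3, 0 < x 2 → R ≤ ‖x‖ → |Q x| ≤ K1 / R ^ 3) →
      |∫ x, u x * glue P Q x| ≤ K1 * (32 * Real.pi / 3) * ε := by
    intro P Q h0 hP hQ
    have hg0 : ∀ x : R3, ‖x‖ < R ∨ 2 * R < ‖x‖ → glue P Q x = 0 := fun x hx => by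
      unfold glue; split_ifs; exacts [(h0 x hx).2, (h0 x hx).1]
    refine (abs_integral_le_of_ball (R := R) (M := ε * (K1 / R ^ 3)) hR0.le
      (fun x hx => by rw [hg0 x (Or.inr hx), mul_zero]) fun x => ?_).trans (le_of_eq ?_)
    · by_cases hx : ‖x‖ < R
      · rw [hg0 x (Or.inl hx)]; simp; positivity
      · rw [abs_mul]
        exact mul_le_mul (hue x (not_lt.1 hx)) (abs_glue_le_of (fun hx2 => hP x hx2 (not_lt.1 hx))
          (fun hx2 => hQ x hx2 (not_lt.1 hx))) (abs_nonneg _) hε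
    · field_simp
  have hJK : 0 ≤ 8 * J * K1 * ε := by positivity
  constructor
  · refine (key _ _ (fun x hx => ?_) (fun x hx hxR => (bA (hx.trans ha.le) hxR).1)
      (fun x hx hxR => (bB hx.le hxR).1)).trans (by linarith)
    simp [hD0 j x hx]
  · have k1 := key (D j (cutStress lam mu (cutoff R) A i j))
      (D j (cutStress lamI muI (cutoff R) B i j))
      (fun x hx => ⟨(hcut0 _ _ _ x hx).2, (hcut0 _ _ _ x hx).2⟩)
      (fun x hx hxR => (bA (hx.trans ha.le) hxR).2.2)
      (fun x hx hxR => (bB hx.le hxR).2.2)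
    have k2 : |(∫ x, u x * glue (D j (cutStress lam mu (cutoff R) A i j))
        (D j (cutStress lamI muI (cutoff R) B i j)) x) +
        ∫ x, v x * glue (cutStress lam mu (cutoff R) A i j)
          (cutStress lamI muI (cutoff R) B i j) x| ≤ 8 * J * K1 * ε := by
      by_cases hj : j = 2
      · subst hj
        -- The jump is at most twice the bound on either side, times `ε`; with `ρ = 2R` the powers
        -- of `R` cancel and leave `8 J K1 ε`.
        refine (hJ u v hu hv huv _ _ (hcsG _ _ _) (hcsG _ _ _) (2 * (ε * (K1 / R ^ 2))) (2 * R) a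
          (by positivity) (by positivity) ha (fun x hx0 hxa => ?_) (fun x hx => ?_)).trans
          (le_of_eq (by field_simp; ring))
        · by_cases hx : ‖x‖ < R
          · rw [(hcut0 _ _ _ x (Or.inl hx)).1, (hcut0 _ _ _ x (Or.inl hx)).1]; simp; positivity
          · rw [abs_mul, mul_left_comm]
            refine mul_le_mul (hue x (not_lt.1 hx)) ?_ (abs_nonneg _) hε
            have e1 := (bA hxa.le (not_lt.1 hx)).2.1
            have e2 := (bB hx0.le (not_lt.1 hx)).2.1
            linarith [abs_sub (cutStress lamI muI (cutoff R) B i 2 x)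
              (cutStress lam mu (cutoff R) A i 2 x)]
        · rw [(hcut0 _ _ _ x (Or.inr hx)).1, (hcut0 _ _ _ x (Or.inr hx)).1, sub_zero]
      · rw [huv.integral_glue hu hv (hcsG _ _ _) (hcsG _ _ _) (fun h => absurd h hj),
          neg_add_cancel, abs_zero]
        exact hJK
    have k3 := abs_sub_abs_le_abs_sub (∫ x, v x * glue (cutStress lam mu (cutoff R) A i j)
          (cutStress lamI muI (cutoff R) B i j) x)
      (-∫ x, u x * glue (D j (cutStress lam mu (cutoff R) A i j))
        (D j (cutStress lamI muI (cutoff R) B i j)) x)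
    rw [sub_neg_eq_add, abs_neg, add_comm (∫ x, v x * _)] at k3
    linarith

/-- Testing the equation of `u` with the cut-off pair produces the value at the pole. Integrating by
parts back onto `u`, with no interface term since tractions agree, produces `F`. The remaining terms
contain derivatives of the cut-off and vanish as `R → ∞` because `u` tends to zero. -/
theorem IsTransmission.pairing (h : IsTransmission lam mu lamI muI a M A B F) (ha : 0 < a)
    {y l : R3} (hy : y 2 ≤ 0) {u : R3 → R3}
    (hu : IsFundamentalSolution lam mu lamI muI upperHalfSpace y l u) :
    ∑ i, l i * A i y = -∑ i, ∫ x, u x i * F i x := by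
  obtain ⟨hul, ⟨V, hV, hw⟩, hinf⟩ := hu
  obtain ⟨K, hK0, hK⟩ := h.cutoff_error ha
  have hui : ∀ i, LocallyIntegrable (fun x => u x i) volume := fun i x => by
    obtain ⟨s, hs, hs'⟩ := hul x
    exact ⟨s, hs, (EuclideanSpace.proj i : R3 →L[ℝ] ℝ).integrable_comp hs'⟩
  have hweak := fun i j => IsWeakDeriv.of_hasWeakGradient hV i j
  -- The identity for a given cut-off, up to the error terms.
  have ident : ∀ R : ℝ, 0 < R → cutoff R y * ∑ i, l i * A i y +
      ∑ i, ∫ x, u x i * (cutoff R x * F i x) =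
      ∑ i, ∑ j, ((∫ x, V x i j * glue (cutStress lam mu (cutoff R) A i j)
        (cutStress lamI muI (cutoff R) B i j) x) -
        ∫ x, u x i * glue (D j (cutoff R) * stress lam mu A i j : Smooth3)
          (D j (cutoff R) * stress lamI muI B i j : Smooth3) x) := by
    intro R hR
    set η := cutoff R with hη
    have hc : HasCompactSupport (η : R3 → ℝ) := hasCompactSupport_cutoff hR
    have hm : ∀ f : Smooth3, HasCompactSupport ((η * f : Smooth3) : R3 → ℝ) := fun f =>
      hc.mul_right (f' := (f : R3 → ℝ))
    have hDm : ∀ (j : Fin 3) (f : Smooth3), HasCompactSupport ((D j η * f : Smooth3) : R3 → ℝ) :=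
      fun j f => (hasCompactSupport_D hc j).mul_right (f' := (f : R3 → ℝ))
    have hcut : ∀ (lam mu : ℝ) (A : Fin 3 → Smooth3) i j,
        HasCompactSupport (cutStress lam mu η A i j : R3 → ℝ) := fun lam mu A i j => by
      refine HasCompactSupport.intro hc fun x hx => ?_
      have hz : ∀ j, D j η x = 0 := fun j =>
        image_eq_zero_of_notMem_tsupport fun h => hx (D_tsupport_subset _ _ h)
      by_cases hij : i = j <;> simp [cutStress, hij, hz]
    have h1 := weak_equation_glue (A := fun i => η * A i) (B := fun i => η * B i) hV.1 hw hy
      (fun i => hm _) (fun i => hm _) (fun i x hx => by simp [h.displacement i x hx])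
    have h2 : ∀ i j, ∫ x, V x i j * glue (stress lam mu (fun i => η * A i) i j)
        (stress lamI muI (fun i => η * B i) i j) x =
        (∫ x, V x i j * glue (cutStress lam mu η A i j) (cutStress lamI muI η B i j) x) -
        (∫ x, u x i * glue (η * D j (stress lam mu A i j) : Smooth3)
          (η * D j (stress lamI muI B i j) : Smooth3) x) -
        ∫ x, u x i * glue (D j η * stress lam mu A i j : Smooth3)
          (D j η * stress lamI muI B i j : Smooth3) x := by
      intro i j
      have e1 := (hweak i j).integral_glue (hui i) (hV.1 i j)
        (A := η * stress lam mu A i j) (B := η * stress lamI muI B i j) (hm _) (hm _)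
        (fun hj x hx => by subst hj; simp [h.traction i x hx])
      have e2 : ∫ x, u x i * glue (D j (η * stress lam mu A i j))
          (D j (η * stress lamI muI B i j)) x =
          (∫ x, u x i * glue (η * D j (stress lam mu A i j) : Smooth3)
            (η * D j (stress lamI muI B i j) : Smooth3) x) +
          ∫ x, u x i * glue (D j η * stress lam mu A i j : Smooth3)
          (D j η * stress lamI muI B i j : Smooth3) x := by
        rw [← integral_add (integrable_mul_glue (hui i) (hm _) (hm _))
          (integrable_mul_glue (A := D j η * stress lam mu A i j)
            (B := D j η * stress lamI muI B i j) (hui i) (hDm _ _) (hDm _ _))]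
        congr 1
        ext x
        unfold glue
        split_ifs <;> simp <;> ring
      have e3 : ∫ x, V x i j * glue (stress lam mu (fun i => η * A i) i j)
          (stress lamI muI (fun i => η * B i) i j) x =
          (∫ x, V x i j * glue (η * stress lam mu A i j : Smooth3)
            (η * stress lamI muI B i j : Smooth3) x) +
          ∫ x, V x i j * glue (cutStress lam mu η A i j) (cutStress lamI muI η B i j) x := by
        rw [← integral_add (integrable_mul_glue (hV.1 i j) (hm _) (hm _))
          (integrable_mul_glue (hV.1 i j) (hcut _ _ _ _ _) (hcut _ _ _ _ _))]
        congr 1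
        ext x
        unfold glue
        split_ifs <;> simp only [stress_mul, Smooth3.add_apply] <;> ring
      rw [e3]
      linarith
    have h3 : ∀ i, ∑ j, ∫ x, u x i * glue (η * D j (stress lam mu A i j) : Smooth3)
          (η * D j (stress lamI muI B i j) : Smooth3) x = ∫ x, u x i * (η x * F i x) := by
      intro i
      rw [← integral_finsetSum _ fun j _ => integrable_mul_glue (hui i) (hm _) (hm _)]
      congr 1
      ext x
      rw [← congrFun (h.lame_eq i) x]
      unfold glue
      split_ifs <;> simp only [lame, Smooth3.sum_apply, Smooth3.mul_apply, Finset.mul_sum]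
    simp_rw [h2, Finset.sum_sub_distrib, h3] at h1
    simp_rw [Finset.sum_sub_distrib]
    have h4 : ∑ i, l i * (η * A i) y = η y * ∑ i, l i * A i y := by
      rw [Finset.mul_sum]
      exact Finset.sum_congr rfl fun i _ => by rw [Smooth3.mul_apply]; ring
    rw [h4] at h1
    linarith
  set Z := ∑ i, l i * A i y + ∑ i, ∫ x, u x i * F i x with hZ
  suffices hZ0 : Z = 0 by rw [hZ] at hZ0; linarith
  obtain ⟨ρ, hρ⟩ : ∃ ρ : ℝ, ∀ i x, ρ < ‖x‖ → F i x = 0 := by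
    have hb : ∀ i, ∃ ρ : ℝ, ∀ x, ρ < ‖x‖ → F i x = 0 := fun i => by
      obtain ⟨r, hr⟩ := (h.compact i).isCompact.isBounded.subset_closedBall (0 : R3)
      refine ⟨r, fun x hx => image_eq_zero_of_notMem_tsupport (f := (F i : R3 → ℝ)) fun hx' => ?_⟩
      have := hr hx'
      rw [mem_closedBall_zero_iff] at this
      linarith
    choose ρ hρ using hb
    exact ⟨max (ρ 0) (max (ρ 1) (ρ 2)), fun i x hx => hρ i x (lt_of_le_of_lt (by
      fin_cases i <;> simp) hx)⟩
  have hsmall : ∀ ε : ℝ, 0 < ε → |Z| ≤ 18 * K * ε := by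
    intro ε hε
    have hev : ∀ᶠ x in cocompact R3, ‖u x‖ < ε := by
      have := hinf.norm
      rw [norm_zero] at this
      exact this.eventually_lt_const hε
    obtain ⟨r, hr⟩ : ∃ r : ℝ, ∀ x : R3, r ≤ ‖x‖ → ‖u x‖ < ε := by
      rw [← Metric.cobounded_eq_cocompact, ← comap_norm_atTop, eventually_comap] at hev
      obtain ⟨r, hr⟩ := eventually_atTop.1 hev
      exact ⟨r, fun x hx => hr _ hx x rfl⟩
    set R := max 1 (max r (max ρ ‖y‖)) with hR
    have hR1 : 1 ≤ R := le_max_left _ _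
    have hRr : r ≤ R := (le_max_left _ _).trans (le_max_right _ _)
    have hRρ : ρ ≤ R := ((le_max_left _ _).trans (le_max_right _ _)).trans (le_max_right _ _)
    have hRy : ‖y‖ ≤ R := ((le_max_right _ _).trans (le_max_right _ _)).trans (le_max_right _ _)
    have hR0 : 0 < R := by linarith
    have hI := ident R hR0
    have hηF : ∀ i x, cutoff R x * F i x = F i x := fun i x => by
      by_cases hx : ‖x‖ ≤ R
      · rw [cutoff_eq_one hR0 hx, one_mul]
      · rw [hρ i x (by linarith), mul_zero]
    simp_rw [hηF, cutoff_eq_one hR0 hRy, one_mul] at hI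
    rw [← hZ] at hI
    rw [hI]
    -- Nine index pairs, each contributing two errors of size at most `K ε`.
    refine (abs_sum_three_le (K := 3 * (2 * K * ε)) fun i =>
      abs_sum_three_le fun j => ?_).trans (by linarith)
    have hb := hK (fun x => u x i) (fun x => V x i j) i j (hui i) (hV.1 i j) (hweak i j) ε R hε.le
      hR1 (fun x hx => (abs_coord_le _ _).trans (hr x (hRr.trans hx)).le)
    refine (abs_sub _ _).trans ?_
    linarith [hb.1, hb.2]
  by_contra hne
  have hpos : 0 < |Z| := abs_pos.2 hne
  have := hsmall (|Z| / (36 * (K + 1))) (by positivity)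
  have h2 : 18 * K * (|Z| / (36 * (K + 1))) < |Z| := by
    rw [← mul_div_assoc, div_lt_iff₀ (by positivity)]
    nlinarith
  linarith

end Pairing

end

/-! ### From smooth approximations to fundamental solutions -/

section

/-- In polar coordinates the density is `r^(2 - n)`, continuous up to `0` exactly when `n ≤ 2`. -/
theorem locallyIntegrable_one_div_norm_pow {n : ℕ} (hn : n ≤ 2) (C : ℝ) (z : R3) :
    LocallyIntegrable (fun x : R3 => C / ‖x - z‖ ^ n) volume := by
  rw [locallyIntegrable_iff]
  intro K hK
  obtain ⟨r, hr⟩ := hK.isBounded.subset_ball z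
  refine IntegrableOn.mono_set ?_ hr
  have h0 : IntegrableOn (fun x : R3 => (fun y : ℝ => C / y ^ n) ‖x‖) (Metric.ball 0 r) volume := by
    refine (integrableOn_fun_norm_addHaar (volume : Measure R3) (f := fun y : ℝ => C / y ^ n)
      (r := r)).2 ?_
    have h1 : IntegrableOn (fun y : ℝ => C * y ^ (2 - n)) (Set.Ioo 0 r) :=
      ((continuous_const.mul (continuous_pow (2 - n))).integrableOn_Icc (a := 0) (b := r)).mono_set
        Set.Ioo_subset_Icc_self
    refine h1.congr_fun (fun y hy => ?_) measurableSet_Ioo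
    have hy0 : y ≠ 0 := hy.1.ne'
    simp only [finrank_euclideanSpace, Fintype.card_fin, smul_eq_mul]
    interval_cases n <;> simp <;> field_simp
  have h2 := (measurePreserving_sub_right (volume : Measure R3) z).integrableOn_comp_preimage
    (Homeomorph.subRight z).measurableEmbedding (f := fun x : R3 => C / ‖x‖ ^ n)
    (s := Metric.ball 0 r)
  refine (h2.2 h0).mono_set fun x hx => ?_
  simpa [dist_eq_norm] using hx

theorem ae_ne (z : R3) : ∀ᵐ x : R3, x ≠ z := by
  simp [ae_iff]

theorem continuous_glue {A B : Smooth3} (h : ∀ x : R3, x 2 = 0 → A x = B x) :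
    Continuous (glue A B) := by
  have h1 : glue A B = fun x => if x 2 ≤ 0 then A x else B x := by
    ext x
    unfold glue
    by_cases hx : 0 < x 2
    · simp [hx, not_le.2 hx]
    · simp [hx, not_lt.1 hx]
  rw [h1]
  exact Continuous.if_le A.continuous B.continuous (coord 2).continuous continuous_const h

theorem glue_congr_left {A A' B : R3 → ℝ} {x : R3} (h : A x = A' x) :
    glue A B x = glue A' B x := by
  unfold glue; split_ifs; exacts [rfl, h]

/-- Approximation data for a fundamental solution with pole `z` and force `l`: the smooth fields
`A n` below the interface converge locally uniformly away from `z` to the singular field `A0`. -/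
structure IsApproximation (lam mu lamI muI C : ℝ) (z l : R3) (A F : ℕ → Fin 3 → Smooth3)
    (B : Fin 3 → Smooth3) (A0 : Fin 3 → R3 → ℝ) : Prop where
  nonneg : 0 ≤ C
  eventually_eq : ∀ i x, x ≠ z → ∀ᶠ n in atTop, A n i =ᶠ[𝓝 x] A0 i
  bound : ∀ n i x, x ≠ z → |glue (A n i) (B i) x| ≤ C / ‖x - z‖ ^ 1
  bound_deriv : ∀ n i j x, x ≠ z → |glue (D j (A n i)) (D j (B i)) x| ≤ C / ‖x - z‖ ^ 2
  displacement : ∀ n i (x : R3), x 2 = 0 → A n i x = B i x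
  traction : ∀ n i (x : R3), x 2 = 0 → stress lam mu (A n) i 2 x = stress lamI muI B i 2 x
  lame_eq : ∀ n i, glue (lame lam mu (A n) i) (lame lamI muI B i) = F n i
  source : ∀ U : Fin 3 → Smooth3, (∀ i, HasCompactSupport (U i : R3 → ℝ)) →
    Tendsto (fun n => ∑ i, ∫ x, F n i x * U i x) atTop (𝓝 (-∑ i, l i * U i z))

namespace IsApproximation

variable {lam mu lamI muI C : ℝ} {z l : R3} {A F : ℕ → Fin 3 → Smooth3}
  {B : Fin 3 → Smooth3} {A0 : Fin 3 → R3 → ℝ} (h : IsApproximation lam mu lamI muI C z l A F B A0)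
include h

theorem tendsto_value (i : Fin 3) {x : R3} (hx : x ≠ z) :
    ∀ᶠ n in atTop, glue (A n i) (B i) x = glue (A0 i) (B i) x := by
  filter_upwards [h.eventually_eq i x hx] with n hn
  exact glue_congr_left hn.eq_of_nhds

theorem tendsto_deriv (i j : Fin 3) {x : R3} (hx : x ≠ z) :
    ∀ᶠ n in atTop, D j (A n i) x = fderiv ℝ (A0 i) x (e j) := by
  filter_upwards [h.eventually_eq i x hx] with n hn
  rw [D_apply, hn.fderiv_eq]

omit h in
theorem locallyIntegrable_of_limit {f : ℕ → R3 → ℝ} {g : R3 → ℝ} {C : ℝ} {m : ℕ} (hm : m ≤ 2)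
    (hf : ∀ n, Measurable (f n)) (hlim : ∀ x, x ≠ z → ∀ᶠ n in atTop, f n x = g x)
    (hb : ∀ n x, x ≠ z → |f n x| ≤ C / ‖x - z‖ ^ m) : LocallyIntegrable g volume := by
  have hlim' : ∀ᵐ x, Tendsto (fun n => f n x) atTop (𝓝 (g x)) := by
    filter_upwards [ae_ne z] with x hx
    exact tendsto_const_nhds.congr' ((hlim x hx).mono fun n hn => hn.symm)
  refine (locallyIntegrable_one_div_norm_pow hm C z).mono
    (aestronglyMeasurable_of_tendsto_ae atTop (fun n => (hf n).aestronglyMeasurable) hlim') ?_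
  filter_upwards [ae_ne z] with x hx
  obtain ⟨n, hn⟩ := (hlim x hx).exists
  rw [← hn, Real.norm_eq_abs]
  exact (hb n x hx).trans (le_abs_self _)

omit h in
theorem tendsto_integral_of_limit {f : ℕ → R3 → ℝ} {g : R3 → ℝ} {C : ℝ} {m : ℕ} (hm : m ≤ 2)
    (hf : ∀ n, Measurable (f n)) (hlim : ∀ x, x ≠ z → ∀ᶠ n in atTop, f n x = g x)
    (hb : ∀ n x, x ≠ z → |f n x| ≤ C / ‖x - z‖ ^ m) {ψ : R3 → ℝ} (hψ : Continuous ψ)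
    (hc : HasCompactSupport ψ) :
    Tendsto (fun n => ∫ x, f n x * ψ x) atTop (𝓝 (∫ x, g x * ψ x)) := by
  refine tendsto_integral_of_dominated_convergence (fun x => C / ‖x - z‖ ^ m * |ψ x|)
    (fun n => ((hf n).mul hψ.measurable).aestronglyMeasurable)
    (integrable_mul_of_compact (locallyIntegrable_one_div_norm_pow hm C z) hψ.abs hc.abs)
    (fun n => ?_) ?_
  · filter_upwards [ae_ne z] with x hx
    rw [Real.norm_eq_abs, abs_mul]
    exact mul_le_mul_of_nonneg_right (hb n x hx) (abs_nonneg _)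
  · filter_upwards [ae_ne z] with x hx
    refine Tendsto.mul_const _ ?_
    exact tendsto_const_nhds.congr' ((hlim x hx).mono fun n hn => hn.symm)

theorem abs_stress_le (n : ℕ) (i j : Fin 3) {x : R3} (hx : x ≠ z) :
    |glue (stress lam mu (A n) i j) (stress lamI muI B i j) x| ≤
      (|lam| + |mu| + |lamI| + |muI|) * 3 * C / ‖x - z‖ ^ 2 := by
  have hC : 0 ≤ C / ‖x - z‖ ^ 2 := div_nonneg h.nonneg (by positivity)
  have hb := fun i j => h.bound_deriv n i j x hx
  rw [mul_div_assoc, mul_assoc]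
  refine abs_glue_le_of (fun hx0 => ?_) (fun hx0 => ?_)
  · refine (LameSystem.abs_stress_le (fun i j => ?_) i j).trans
      (mul_le_mul_of_nonneg_right ?_ (by positivity : 0 ≤ 3 * (C / ‖x - z‖ ^ 2)))
    · have := hb i j
      rwa [glue, if_neg (not_lt.2 hx0)] at this
    · linarith [abs_nonneg lamI, abs_nonneg muI]
  · refine (LameSystem.abs_stress_le (fun i j => ?_) i j).trans
      (mul_le_mul_of_nonneg_right ?_ (by positivity : 0 ≤ 3 * (C / ‖x - z‖ ^ 2)))
    · have := hb i j
      rwa [glue, if_pos hx0] at this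
    · linarith [abs_nonneg lam, abs_nonneg mu]

theorem continuousAt (i : Fin 3) {x : R3} (hx : x ≠ z) : ContinuousAt (glue (A0 i) (B i)) x := by
  obtain ⟨n, hn⟩ := (h.eventually_eq i x hx).exists
  refine ((continuous_glue (h.displacement n i)).continuousAt (x := x)).congr ?_
  filter_upwards [hn] with y hy using glue_congr_left hy

/-- For each `n` the weak identities hold without interface terms, since displacements and tractions
match. The bounds `C/‖x - z‖` and `C/‖x - z‖²` are locally integrable and uniform in `n`, so
everything passes to the limit; the first also gives decay at infinity. -/
theorem isFundamentalSolution : IsFundamentalSolution lam mu lamI muI upperHalfSpace z l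
    (fun x => WithLp.toLp 2 fun i => glue (A0 i) (B i) x) := by
  have mA : ∀ n i, Measurable (glue (A n i) (B i)) := fun n i =>
    measurable_glue (A n i).continuous.measurable (B i).continuous.measurable
  have mD : ∀ n i j, Measurable (glue (D j (A n i)) (D j (B i))) := fun n i j =>
    measurable_glue (D j (A n i)).continuous.measurable (D j (B i)).continuous.measurable
  have mS : ∀ n i j, Measurable (glue (stress lam mu (A n) i j) (stress lamI muI B i j)) :=
    fun n i j => measurable_glue (Smooth3.continuous _).measurable (Smooth3.continuous _).measurable
  set V : R3 → Matrix (Fin 3) (Fin 3) ℝ := fun x i j =>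
    glue (fun x => fderiv ℝ (A0 i) x (e j)) (D j (B i)) x with hV
  have hlimV : ∀ i j x, x ≠ z → ∀ᶠ n in atTop, glue (D j (A n i)) (D j (B i)) x = V x i j :=
    fun i j x hx => (h.tendsto_deriv i j hx).mono fun n hn => glue_congr_left hn
  have hu : ∀ i, LocallyIntegrable (fun x => glue (A0 i) (B i) x) volume := fun i =>
    locallyIntegrable_of_limit (by norm_num) (fun n => mA n i) (fun x hx => h.tendsto_value i hx)
      (fun n x hx => h.bound n i x hx)
  have hVi : ∀ i j, LocallyIntegrable (fun x => V x i j) volume := fun i j =>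
    locallyIntegrable_of_limit (by norm_num) (fun n => mD n i j) (hlimV i j)
      (fun n x hx => h.bound_deriv n i j x hx)
  refine ⟨?_, ⟨V, ⟨hVi, fun i j ψ hψ hc => ?_⟩, fun φ hφ hc => ?_⟩, ?_⟩
  · have : (fun x : R3 => (WithLp.toLp 2 fun i => glue (A0 i) (B i) x : R3)) =
        fun x => ∑ i, glue (A0 i) (B i) x • e i := by
      ext x k
      fin_cases k <;> simp [e, Fin.sum_univ_three]
    rw [this]
    refine locallyIntegrable_finsetSum _ fun i _ x => ?_
    obtain ⟨s, hs, hs'⟩ := hu i x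
    exact ⟨s, hs, Integrable.smul_const hs' _⟩
  · set Ψ := Smooth3.of ψ hψ
    have h1 := tendsto_integral_of_limit (by norm_num) (fun n => mA n i)
      (fun x hx => h.tendsto_value i hx) (fun n x hx => h.bound n i x hx)
      (D j Ψ).continuous (hasCompactSupport_D (f := Ψ) hc j)
    have h2 := (tendsto_integral_of_limit (by norm_num) (fun n => mD n i j) (hlimV i j)
      (fun n x hx => h.bound_deriv n i j x hx) hψ.continuous hc).neg
    refine tendsto_nhds_unique h1 (h2.congr fun n => ?_)
    exact (isWeakDeriv_glue j (A n i) (B i) (fun _ => h.displacement n i) Ψ hc).symm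
  · obtain ⟨U, rfl⟩ := exists_vec hφ
    have hU : ∀ i, HasCompactSupport (U i : R3 → ℝ) := fun i =>
      hc.comp_left (g := fun y : R3 => y i) rfl
    set W : Fin 3 → Fin 3 → R3 → ℝ := fun i j x =>
      inclusionAction lam mu lamI muI upperHalfSpace x (V x) i j with hW
    have hlimW : ∀ i j x, x ≠ z → ∀ᶠ n in atTop,
        glue (stress lam mu (A n) i j) (stress lamI muI B i j) x = W i j x := by
      intro i j x hx
      have hall : ∀ᶠ n in atTop, ∀ i j, D j (A n i) x = fderiv ℝ (A0 i) x (e j) :=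
        eventually_all.2 fun i => eventually_all.2 fun j => h.tendsto_deriv i j hx
      filter_upwards [hall] with n hn
      by_cases hx0 : 0 < x 2
      · have hx' : x ∈ upperHalfSpace := hx0
        simp only [hW, hV, inclusionAction, hx', if_true, glue, hx0, stress_apply]
      · have hx' : x ∉ upperHalfSpace := hx0
        simp only [hW, hV, inclusionAction, hx', if_false, glue, hx0, stress_apply, hn]
    have hWi : ∀ i j, LocallyIntegrable (W i j) volume := fun i j =>
      locallyIntegrable_inclusionAction hVi i j
    have hIW : ∀ i j, Integrable (fun x => W i j x * D j (U i) x) := fun i j =>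
      integrable_mul_of_compact (hWi i j) (Smooth3.continuous _) (hasCompactSupport_D (hU i) j)
    have h1 : Tendsto (fun n => ∑ i, ∑ j,
        ∫ x, glue (stress lam mu (A n) i j) (stress lamI muI B i j) x * D j (U i) x) atTop
        (𝓝 (∑ i, ∑ j, ∫ x, W i j x * D j (U i) x)) :=
      tendsto_finsetSum _ fun i _ => tendsto_finsetSum _ fun j _ =>
        tendsto_integral_of_limit le_rfl (fun n => mS n i j) (hlimW i j)
          (fun n x hx => h.abs_stress_le n i j hx) (Smooth3.continuous _)
          (hasCompactSupport_D (hU i) j)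
    have h2 : ∀ n, ∑ i, ∑ j,
        ∫ x, glue (stress lam mu (A n) i j) (stress lamI muI B i j) x * D j (U i) x =
        -∑ i, ∫ x, F n i x * U i x := by
      intro n
      rw [← Finset.sum_neg_distrib]
      refine Finset.sum_congr rfl fun i _ => ?_
      have h3 : ∀ j, ∫ x, glue (stress lam mu (A n) i j) (stress lamI muI B i j) x * D j (U i) x =
          -∫ x, glue (D j (stress lam mu (A n) i j)) (D j (stress lamI muI B i j)) x * U i x :=
        fun j => isWeakDeriv_glue j _ _ (fun hj x hx => by subst hj; exact h.traction n i x hx)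
          (U i) (hU i)
      simp_rw [h3]
      rw [Finset.sum_neg_distrib, ← integral_finsetSum _ fun j _ =>
        integrable_glue_mul (U i).continuous (hU i)]
      congr 2
      ext x
      rw [← congrFun (h.lame_eq n i) x, ← Finset.sum_mul]
      congr 1
      unfold glue
      split_ifs <;> simp only [lame, Smooth3.sum_apply]
    simp_rw [h2] at h1
    have h4 := tendsto_nhds_unique h1 (h.source U hU).neg
    rw [neg_neg] at h4
    rw [inner_vec, ← h4]
    simp_rw [matrixDot, grad_vec]
    rw [integral_finsetSum _ fun i _ => integrable_finsetSum _ fun j _ => hIW i j]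
    refine Finset.sum_congr rfl fun i _ => ?_
    exact integral_finsetSum _ fun j _ => hIW i j
  · have hpi : Tendsto (fun x => fun i => glue (A0 i) (B i) x) (cocompact R3) (𝓝 0) := by
      rw [tendsto_pi_nhds]
      intro i
      have h1 : Tendsto (fun x : R3 => C / ‖x - z‖ ^ 1) (cocompact R3) (𝓝 0) := by
        simp only [pow_one]
        refine Tendsto.div_atTop tendsto_const_nhds ?_
        exact tendsto_norm_cocompact_atTop.comp
          (Homeomorph.subRight z).isClosedEmbedding.tendsto_cocompact
      refine squeeze_zero_norm' ?_ h1
      have hne : ∀ᶠ x in cocompact R3, x ≠ z := by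
        filter_upwards [(isCompact_singleton (x := z)).compl_mem_cocompact] with x hx using hx
      filter_upwards [hne] with x hx
      obtain ⟨n, hn⟩ := (h.tendsto_value i hx).exists
      rw [← hn, Real.norm_eq_abs]
      exact h.bound n i x hx
    exact ((PiLp.continuous_toLp 2 (fun _ : Fin 3 => ℝ)).tendsto 0).comp hpi

end IsApproximation

end

/-! ### Symbol classes and decay of the explicit fields -/

section

theorem Dl_append_singleton (l : List (Fin 3)) (i : Fin 3) (f : Smooth3) :
    Dl (l ++ [i]) f = Dl l (D i f) := by
  simp [Dl, List.foldr_append]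

/-- Smooth functions of symbol class `-n` on `S`: all derivatives of order `m` are
`O((1 + ‖x‖) ^ (-(n + m)))`. -/
def Symb (n : ℕ) (S : Set R3) (f : Smooth3) : Prop :=
  ∀ l : List (Fin 3), ∃ C : ℝ, 0 ≤ C ∧ ∀ x ∈ S, |Dl l f x| ≤ C / (1 + ‖x‖) ^ (n + l.length)

namespace Symb

variable {n : ℕ} {S : Set R3} {f g : Smooth3}

theorem zero : Symb n S 0 := fun l =>
  ⟨0, le_rfl, fun x _ => by
    have h : Dl l (0 : Smooth3) = 0 := by
      have := Dl_smul l 0 (0 : Smooth3)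
      rwa [zero_smul, zero_smul] at this
    simp [h]⟩

theorem add (hf : Symb n S f) (hg : Symb n S g) : Symb n S (f + g) := fun l => by
  obtain ⟨C, hC, h⟩ := hf l
  obtain ⟨C', hC', h'⟩ := hg l
  refine ⟨C + C', add_nonneg hC hC', fun x hx => ?_⟩
  rw [Dl_add, Smooth3.add_apply, add_div]
  exact (abs_add_le _ _).trans (add_le_add (h x hx) (h' x hx))

theorem smul (c : ℝ) (hf : Symb n S f) : Symb n S (c • f) := fun l => by
  obtain ⟨C, hC, h⟩ := hf l
  refine ⟨|c| * C, mul_nonneg (abs_nonneg c) hC, fun x hx => ?_⟩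
  rw [Dl_smul, Smooth3.smul_apply, abs_mul, mul_div_assoc]
  exact mul_le_mul_of_nonneg_left (h x hx) (abs_nonneg c)

theorem deriv (hf : Symb n S f) (i : Fin 3) : Symb (n + 1) S (D i f) := fun l => by
  obtain ⟨C, hC, h⟩ := hf (l ++ [i])
  refine ⟨C, hC, fun x hx => ?_⟩
  have := h x hx
  rwa [Dl_append_singleton, List.length_append, List.length_singleton, ← add_assoc,
    add_right_comm] at this

theorem of_succ (hf : Symb (n + 1) S f) : Symb n S f := fun l => by
  obtain ⟨C, hC, h⟩ := hf l
  refine ⟨C, hC, fun x hx => (h x hx).trans ?_⟩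
  have h1 : 1 ≤ 1 + ‖x‖ := by linarith [norm_nonneg x]
  exact div_le_div_of_nonneg_left hC (by positivity) (pow_le_pow_right₀ h1 (by omega))

/-- A coordinate factor costs one order of decay, which is what the term `x₃ ∇∂₃f` of the Almansi
field requires. The induction peels off the innermost derivative by `∂_j (x_i f) = x_i ∂_j f + δ_ij
f`. -/
theorem coord_mul (i : Fin 3) (hf : Symb (n + 1) S f) : Symb n S (coord i * f) := by
  intro l
  induction l using List.reverseRecOn generalizing n f with
  | nil =>
    obtain ⟨C, hC, h⟩ := hf []
    refine ⟨C, hC, fun x hx => ?_⟩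
    have h1 := h x hx
    change |x i * f x| ≤ C / (1 + ‖x‖) ^ n
    change |f x| ≤ C / (1 + ‖x‖) ^ (n + 1) at h1
    have h2 : |x i| ≤ 1 + ‖x‖ := (abs_coord_le x i).trans (by linarith)
    have h3 : 0 < 1 + ‖x‖ := by positivity
    rw [abs_mul]
    refine (mul_le_mul h2 h1 (abs_nonneg _) h3.le).trans (le_of_eq ?_)
    rw [pow_succ]
    field_simp
  | append_singleton l j ih =>
    obtain ⟨C, hC, h⟩ := ih (hf.deriv j)
    obtain ⟨C', hC', h'⟩ := (hf.smul (if j = i then 1 else 0)) l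
    refine ⟨C + C', add_nonneg hC hC', fun x hx => ?_⟩
    have h1 : D j (coord i * f) = coord i * D j f + (if j = i then (1 : ℝ) else 0) • f := by
      ext x
      simp only [Derivation.leibniz, D_coord, smul_eq_mul, Smooth3.add_apply, Smooth3.mul_apply,
        Smooth3.smul_apply]
      by_cases h : j = i
      · simp [h]
      · simp [h, Ne.symm h]
    rw [Dl_append_singleton, h1, Dl_add, Smooth3.add_apply, add_div, List.length_append,
      List.length_singleton, add_comm l.length, ← add_assoc]
    exact (abs_add_le _ _).trans (add_le_add (h x hx) (h' x hx))

theorem norm_reflect (x : R3) : ‖diagMap sgn 0 x‖ = ‖x‖ := by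
  rw [EuclideanSpace.norm_eq, EuclideanSpace.norm_eq]
  congr 1
  simp [Fin.sum_univ_three]

theorem abs_Dl_mirror (l : List (Fin 3)) (f : Smooth3) (x : R3) :
    |Dl l f.mirror x| = |Dl l f (diagMap sgn 0 x)| := by
  have h : ∃ s : ℝ, |s| = 1 ∧ Dl l f.mirror = s • (Dl l f).mirror := by
    induction l with
    | nil => exact ⟨1, abs_one, (one_smul _ _).symm⟩
    | cons i l ih =>
      obtain ⟨s, hs, h⟩ := ih
      refine ⟨s * sgn i, ?_, ?_⟩
      · rw [abs_mul, hs, one_mul]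
        fin_cases i <;> simp
      · rw [Dl_cons, h, Derivation.map_smul, D_mirror, smul_smul]
        rfl
  obtain ⟨s, hs, h⟩ := h
  rw [h, Smooth3.smul_apply, abs_mul, hs, one_mul]
  rfl

theorem mirror (hf : Symb n S f) : Symb n (diagMap sgn 0 ⁻¹' S) f.mirror := fun l => by
  obtain ⟨C, hC, h⟩ := hf l
  refine ⟨C, hC, fun x hx => ?_⟩
  rw [abs_Dl_mirror, ← norm_reflect x]
  exact h _ hx

theorem almansi {k : ℝ} (hf : ∀ i, Symb 1 S (D i f)) (i : Fin 3) : Symb 1 S (almansi k f i) :=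
  ((hf i).smul _).add ((coord_mul 2 (((hf 2).deriv i))).smul _)

theorem twist (hf : ∀ i j, Symb 1 S (D i (D j f))) (j i : Fin 3) : Symb 1 S (twist j f i) := by
  unfold LameSystem.twist
  split_ifs
  exacts [zero, (hf 2 2).add (hf i j), zero.add (hf i j)]

theorem deriv_mirror (hf : ∀ i, Symb 1 S (D i f)) (i : Fin 3) :
    Symb 1 (diagMap sgn 0 ⁻¹' S) (D i f.mirror) := by
  rw [D_mirror]
  exact (hf i).mirror.smul _

theorem deriv_potUp (hf : ∀ i j, Symb 1 S (D i (D j f))) (j i : Fin 3) :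
    Symb 1 S (D i (potUp f j)) := by
  rw [potUp, Derivation.map_smul]
  exact (hf i j).smul _

/-- The second summand of the potential carries an extra derivative; its additional decay is
discarded by `of_succ`. -/
theorem deriv_potSum (k d : ℝ) (hf : ∀ i j, Symb 1 S (D i (D j f))) (j i : Fin 3) :
    Symb 1 S (D i (potSum k d f j)) := by
  rw [potSum, map_add, Derivation.map_smul, Derivation.map_smul]
  exact ((deriv_potUp hf j i).smul _).add ((((deriv_potUp hf j 2).deriv i).of_succ).smul _)

theorem upField (c k kI d p q r : ℝ) (hf : ∀ i j, Symb 1 S (D i (D j f))) (j i : Fin 3) :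
    Symb 1 S (upField c k kI d p q r f j i) :=
  (((deriv_potSum k d hf j i).smul _).add ((almansi (deriv_potUp hf j) i).smul _)).add
    ((twist hf j i).smul _)

theorem lowField (c k d p q r : ℝ) (hf : ∀ i j, Symb 1 S (D i (D j f))) (j i : Fin 3) :
    Symb 1 (diagMap sgn 0 ⁻¹' S) (lowField c k d p q r f j i) :=
  (((almansi (deriv_mirror (deriv_potSum k d hf j)) i).smul _).add
    ((deriv_mirror (deriv_potUp hf j) i).smul _)).add ((twist (fun i j => by
      rw [D_mirror, Derivation.map_smul]
      exact (deriv_mirror (fun i => hf i j) i).smul _) j i).smul _)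

/-- A common bound for finitely many members of a symbol class and their gradients. -/
theorem exists_bound {ι : Type*} [Finite ι] {f : ι → Smooth3} (hf : ∀ i, Symb n S (f i)) :
    ∃ C : ℝ, 0 ≤ C ∧ (∀ i, ∀ x ∈ S, |f i x| ≤ C / (1 + ‖x‖) ^ n) ∧
      ∀ i j, ∀ x ∈ S, |D j (f i) x| ≤ C / (1 + ‖x‖) ^ (n + 1) := by
  have := Fintype.ofFinite ι
  choose C hC h using fun i => hf i []
  choose C' hC' h' using fun i j => hf i [j]
  refine ⟨∑ i, (C i + ∑ j, C' i j), Finset.sum_nonneg fun i _ => add_nonneg (hC i)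
    (Finset.sum_nonneg fun j _ => hC' i j), fun i x hx => (h i x hx).trans ?_,
    fun i j x hx => (h' i j x hx).trans ?_⟩
  all_goals
    have hi := Finset.single_le_sum (f := fun i => C i + ∑ j, C' i j) (fun i _ => add_nonneg (hC i)
      (Finset.sum_nonneg fun j _ => hC' i j)) (Finset.mem_univ i)
  · exact div_le_div_of_nonneg_right ((le_add_of_nonneg_right
      (Finset.sum_nonneg fun j _ => hC' i j)).trans hi) (by positivity)
  · exact div_le_div_of_nonneg_right (((Finset.single_le_sum (fun j _ => hC' i j)
      (Finset.mem_univ j)).trans (le_add_of_nonneg_left (hC i))).trans hi) (by positivity)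

end Symb

theorem div_pow_le_of_le_mul {C K s t : ℝ} (hC : 0 ≤ C) (hs : 0 < s) (ht : 0 < t) (h : s ≤ K * t)
    (m : ℕ) : C / t ^ m ≤ C * K ^ m / s ^ m := by
  rw [div_le_div_iff₀ (by positivity) (by positivity), mul_assoc, ← mul_pow]
  exact mul_le_mul_of_nonneg_left (pow_le_pow_left₀ hs.le h m) hC

/-- The translate of `potX` with pole `(0, 0, -d)`. -/
def shiftPot {d : ℝ} (hd : 0 < d) : Smooth3 :=
  -- With threshold `a = d/4`, the half space `x₃ ≥ -d/2` lies at height at least `d/2 = 2a` above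
  -- the pole, as `exists_decay_potX` demands.
  (potX (show 0 < d / 4 by positivity)).compDiag (fun _ => 1) (axis d)

section ShiftPot

variable {d : ℝ} (hd : 0 < d)

theorem diagMap_one (d : ℝ) (x : R3) : diagMap (fun _ => 1) (axis d) x = x - axis (-d) := by
  ext i
  by_cases h : i = 2 <;> simp [h]

theorem Dl_shiftPot (l : List (Fin 3)) (x : R3) :
    Dl l (shiftPot hd) x = Dl l (potX (show 0 < d / 4 by positivity)) (x - axis (-d)) := by
  have h : Dl l (shiftPot hd) =
      (Dl l (potX (show 0 < d / 4 by positivity))).compDiag (fun _ => 1) (axis d) := by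
    induction l with
    | nil => rfl
    | cons i l ih => rw [Dl_cons, ih, D_compDiag, one_smul]; rfl
  rw [h, Smooth3.compDiag_apply, diagMap_one]

theorem sub_axis_apply_two (d : ℝ) (x : R3) : (x - axis (-d)) 2 = x 2 + d := by simp

theorem le_norm_sub_axis {x : R3} : x 2 + d ≤ ‖x - axis (-d)‖ := by
  rw [← sub_axis_apply_two]
  exact (le_abs_self _).trans (abs_coord_le _ _)

include hd in
theorem sub_axis_mem_goodSet {x : R3} (hx : -(d / 2) ≤ x 2) :
    x - axis (-d) ∈ goodSet (d / 4) := by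
  change d / 4 < ‖x - axis (-d)‖ + (x - axis (-d)) 2
  have := norm_nonneg (x - axis (-d))
  rw [sub_axis_apply_two]
  linarith

theorem lap_shiftPot {x : R3} (hx : -(d / 2) ≤ x 2) : lap (shiftPot hd) x = 0 := by
  rw [← lap_potX (show 0 < d / 4 by positivity) _ (sub_axis_mem_goodSet hd hx)]
  simp only [lap, Smooth3.sum_apply]
  exact Finset.sum_congr rfl fun i _ => Dl_shiftPot hd [i, i] x

theorem norm_eq_shiftPot {x : R3} (hx : -(d / 2) ≤ x 2) :
    ‖x - axis (-d)‖ = (x 2 + d) * D 2 (shiftPot hd) x - shiftPot hd x := by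
  rw [norm_eq_potX (show 0 < d / 4 by positivity) (sub_axis_mem_goodSet hd hx),
    sub_axis_apply_two]
  congr 1
  · congr 1
    exact (Dl_shiftPot hd [2] x).symm
  · exact (Dl_shiftPot hd [] x).symm

include hd in
theorem one_add_norm_le {x : R3} (hx : d / 2 ≤ ‖x - axis (-d)‖) :
    1 + ‖x‖ ≤ (1 + (1 + d) * (2 / d)) * ‖x - axis (-d)‖ := by
  have h1 : ‖x‖ ≤ ‖x - axis (-d)‖ + d := by
    have h := norm_add_le (x - axis (-d)) (axis (-d))
    have h2 : ‖axis (-d)‖ = d := by simp [axis, norm_smul, e, abs_of_pos hd]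
    rwa [sub_add_cancel, h2] at h
  have h2 : 1 ≤ 2 / d * ‖x - axis (-d)‖ := by
    rw [div_mul_eq_mul_div, le_div_iff₀ hd]; linarith
  nlinarith

/-- Only second derivatives are claimed to decay, since the first derivatives of the potential
contain a logarithm. Away from the pole `1 + ‖x‖` is controlled by the distance to it. -/
theorem symb_shiftPot (i j : Fin 3) : Symb 1 {x | -(d / 2) ≤ x 2} (D i (D j (shiftPot hd))) := by
  intro l
  obtain ⟨C, hC, h⟩ := exists_decay_potX (show 0 < d / 4 by positivity) (l := l ++ [i] ++ [j])
    (by simp)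
  refine ⟨C * (1 + (1 + d) * (2 / d)) ^ (1 + l.length), by positivity, fun x hx => ?_⟩
  have hx' : -(d / 2) ≤ x 2 := hx
  have hn : d / 2 ≤ ‖x - axis (-d)‖ := le_trans (by linarith) le_norm_sub_axis
  rw [← Dl_append_singleton, ← Dl_append_singleton, Dl_shiftPot]
  refine (h _ (by rw [sub_axis_apply_two]; linarith)).trans ?_
  have hl : (l ++ [i] ++ [j]).length - 1 = 1 + l.length := by simp; omega
  rw [hl]
  exact div_pow_le_of_le_mul hC (by positivity) (by linarith) (one_add_norm_le hd hn) _

end ShiftPot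

theorem exists_decay_kelvinField (c k : ℝ) : ∃ C : ℝ, 0 ≤ C ∧ ∀ δ : ℝ, 0 < δ → ∀ z x : R3, x ≠ z →
    ∀ j i, |kelvinField c k (smoothDist δ z) j i x| ≤ C / ‖x - z‖ ^ 1 ∧
      ∀ m, |D m (kelvinField c k (smoothDist δ z) j i) x| ≤ C / ‖x - z‖ ^ 2 := by
  choose C hC h using fun i j : Fin 3 => exists_decay_smoothDist (l := [i, j]) (by simp)
  choose C' hC' h' using fun m i j : Fin 3 => exists_decay_smoothDist (l := [m, i, j]) (by simp)
  set K := ∑ i, ∑ j, (C i j + ∑ m, C' m i j) with hK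
  have hn : ∀ i j, 0 ≤ C i j + ∑ m, C' m i j := fun i j =>
    add_nonneg (hC i j) (Finset.sum_nonneg fun m _ => hC' m i j)
  have hle : ∀ i j, C i j + ∑ m, C' m i j ≤ K := fun i j =>
    (Finset.single_le_sum (f := fun j => C i j + ∑ m, C' m i j) (fun j _ => hn i j)
      (Finset.mem_univ j)).trans (Finset.single_le_sum (f := fun i => ∑ j, (C i j + ∑ m, C' m i j))
        (fun i _ => Finset.sum_nonneg fun j _ => hn i j) (Finset.mem_univ i))
  have hCK : ∀ i j, C i j ≤ K := fun i j =>
    (le_add_of_nonneg_right (Finset.sum_nonneg fun m _ => hC' m i j)).trans (hle i j)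
  have hCK' : ∀ m i j, C' m i j ≤ K := fun m i j =>
    ((Finset.single_le_sum (f := fun m => C' m i j) (fun m _ => hC' m i j)
      (Finset.mem_univ m)).trans (le_add_of_nonneg_left (hC i j))).trans (hle i j)
  have hK0 : 0 ≤ K := (hC 0 0).trans (hCK 0 0)
  have key : ∀ s t u : ℝ, |s| ≤ 3 * u → |t| ≤ u →
      |c * ((1 + k⁻¹) / 2 * s - t)| ≤ |c| * (|(1 + k⁻¹) / 2| * 3 + 1) * u := by
    intro s t u hs ht
    rw [abs_mul, mul_assoc]
    refine mul_le_mul_of_nonneg_left ((abs_sub _ _).trans ?_) (abs_nonneg _)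
    rw [abs_mul]
    have := mul_le_mul_of_nonneg_left hs (abs_nonneg ((1 + k⁻¹) / 2))
    linarith
  refine ⟨|c| * (|(1 + k⁻¹) / 2| * 3 + 1) * K, by positivity, fun δ hδ z x hx j i => ⟨?_, fun m => ?_⟩⟩
  · have hb : ∀ i j, |D i (D j (smoothDist δ z)) x| ≤ K / ‖x - z‖ ^ 1 := fun i j =>
      (h i j δ hδ z x hx).trans (div_le_div_of_nonneg_right (hCK i j) (by positivity))
    rw [mul_div_assoc]
    have e1 : kelvinField c k (smoothDist δ z) j i x = c * ((1 + k⁻¹) / 2 *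
        (if i = j then ∑ m, D m (D m (smoothDist δ z)) x else 0) - D i (D j (smoothDist δ z)) x) := by
      by_cases hij : i = j <;> simp [kelvinField, lap, hij]
    rw [e1]
    refine key _ _ _ ?_ (hb i j)
    split_ifs
    · exact abs_sum_three_le fun m => hb m m
    · rw [abs_zero]; positivity
  · have hb : ∀ m i j, |D m (D i (D j (smoothDist δ z))) x| ≤ K / ‖x - z‖ ^ 2 := fun m i j =>
      (h' m i j δ hδ z x hx).trans (div_le_div_of_nonneg_right (hCK' m i j) (by positivity))
    rw [mul_div_assoc]
    have e1 : D m (kelvinField c k (smoothDist δ z) j i) x = c * ((1 + k⁻¹) / 2 *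
        (if i = j then ∑ n, D m (D n (D n (smoothDist δ z))) x else 0) -
          D m (D i (D j (smoothDist δ z))) x) := by
      by_cases hij : i = j <;> simp [kelvinField, lap, hij]
    rw [e1]
    refine key _ _ _ ?_ (hb m i j)
    split_ifs
    · exact abs_sum_three_le fun n => hb m n n
    · rw [abs_zero]; positivity

end

/-! ### Amplitudes and the regularised two-phase fields -/

section

theorem exists_common_bound {ι : Type*} [Finite ι] {P : ι → ℝ → Prop}
    (mono : ∀ i C C', C ≤ C' → P i C → P i C') (h : ∀ i, ∃ C : ℝ, 0 ≤ C ∧ P i C) :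
    ∃ C : ℝ, 0 ≤ C ∧ ∀ i, P i C := by
  have := Fintype.ofFinite ι
  choose C hC h using h
  exact ⟨∑ i, C i, Finset.sum_nonneg fun i _ => hC i, fun i => mono i _ _
    (Finset.single_le_sum (fun i _ => hC i) (Finset.mem_univ i)) (h i)⟩

theorem exists_bound_of_decay {f : R3 → ℝ} (hf : Continuous f) {d C : ℝ} (hd : 0 < d) (hC : 0 ≤ C)
    {m : ℕ} (h : ∀ x, x ≠ axis (-d) → |f x| ≤ C / ‖x - axis (-d)‖ ^ m) :
    ∃ M : ℝ, 0 ≤ M ∧ ∀ x, |f x| ≤ M / (1 + ‖x‖) ^ m := by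
  set K := 1 + (1 + d) * (2 / d) with hK
  obtain ⟨M, hM⟩ := (isCompact_closedBall (axis (-d)) (d / 2)).exists_bound_of_continuousOn
    (f := fun x => f x * (1 + ‖x‖) ^ m) (by fun_prop)
  refine ⟨|M| + C * K ^ m, by positivity, fun x => ?_⟩
  have hp : 0 < (1 + ‖x‖) ^ m := by positivity
  rw [le_div_iff₀ hp]
  by_cases hx : ‖x - axis (-d)‖ ≤ d / 2
  · have := hM x (by simpa [dist_eq_norm] using hx)
    rw [Real.norm_eq_abs, abs_mul, abs_of_pos hp] at this
    have h2 : 0 ≤ C * K ^ m := by positivity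
    linarith [le_abs_self M]
  · have hx' := not_le.1 hx
    have hn : 0 < ‖x - axis (-d)‖ := by linarith
    have h1 := (h x (sub_ne_zero.1 (norm_pos_iff.1 hn))).trans
      (div_pow_le_of_le_mul hC (by positivity : 0 < 1 + ‖x‖) hn (one_add_norm_le hd hx'.le) m)
    rw [le_div_iff₀ hp] at h1
    linarith [abs_nonneg M]

/-- Ellipticity of a pair of Lamé moduli. -/
structure Elliptic (lam mu : ℝ) : Prop where
  pos : 0 < mu
  add_pos : 0 < lam + mu

/-- The number `1 / (3 - 4 ν)` in terms of the Lamé moduli. -/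
def modRatio (lam mu : ℝ) : ℝ := (lam + mu) / (lam + 3 * mu)

/-- The constant `1 / (16 π μ (1 - ν))`. -/
def kelvinConst (lam mu : ℝ) : ℝ :=
  modRatio lam mu / (4 * Real.pi * mu * (1 + modRatio lam mu))

/-- The amplitude of the dilatational part of the reflected field. -/
def reflP (lam mu muI : ℝ) : ℝ := (mu - muI) / (muI + modRatio lam mu * mu)

/-- The amplitude of the gradient part of the reflected field. -/
def reflQ (lam mu lamI muI : ℝ) : ℝ :=
  (modRatio lam mu * mu - modRatio lamI muI * muI) / (mu + modRatio lamI muI * muI)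

/-- The amplitude of the solenoidal part of the reflected field. -/
def reflR (mu muI : ℝ) : ℝ := (mu - muI) / (mu + muI)

namespace Elliptic

variable {lam mu lamI muI : ℝ} (h : Elliptic lam mu) (hI : Elliptic lamI muI)
include h

theorem denom_pos : 0 < lam + 3 * mu := by linarith [h.pos, h.add_pos]

theorem modRatio_pos : 0 < modRatio lam mu := div_pos h.add_pos h.denom_pos

theorem modRatio_mul : modRatio lam mu * (lam + 3 * mu) = lam + mu :=
  div_mul_cancel₀ _ h.denom_pos.ne'

theorem kelvinConst_pos : 0 < kelvinConst lam mu := by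
  have := h.modRatio_pos
  have := h.pos
  unfold kelvinConst
  positivity

/-- Normalisation: combined with the mass `-8π` of the bilaplacian it makes the total force equal to
one. -/
theorem kelvinConst_eq :
    kelvinConst lam mu * mu * (1 + (modRatio lam mu)⁻¹) / 2 = (8 * Real.pi)⁻¹ := by
  have := h.modRatio_pos
  have := h.pos
  unfold kelvinConst
  field_simp
  ring

include hI

/-- This equation and the next two are the scalar balances required by `traction_match`; ellipticity
of both media makes the denominators positive. -/
theorem reflP_eq : mu - reflP lam mu muI * modRatio lam mu * mu = (1 + reflP lam mu muI) * muI := by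
  have : muI + modRatio lam mu * mu ≠ 0 :=
    (_root_.add_pos hI.pos (mul_pos h.modRatio_pos h.pos)).ne'
  have h1 : reflP lam mu muI * (muI + modRatio lam mu * mu) = mu - muI := div_mul_cancel₀ _ this
  linear_combination -h1

theorem reflQ_eq : modRatio lam mu * mu - reflQ lam mu lamI muI * mu =
    (1 + reflQ lam mu lamI muI) * modRatio lamI muI * muI := by
  have : mu + modRatio lamI muI * muI ≠ 0 :=
    (_root_.add_pos h.pos (mul_pos hI.modRatio_pos hI.pos)).ne'
  unfold reflQ
  field_simp
  ring

theorem reflR_eq : mu * (1 - reflR mu muI) = (1 + reflR mu muI) * muI := by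
  have : mu + muI ≠ 0 := (_root_.add_pos h.pos hI.pos).ne'
  unfold reflR
  field_simp
  ring

end Elliptic

section Phase

variable (lam mu lamI muI : ℝ) {d : ℝ} (hd : 0 < d)

/-- The reflected field of a force `e j` at `(0, 0, -d)`. -/
def reflected (j : Fin 3) : Fin 3 → Smooth3 :=
  lowField (kelvinConst lam mu) (modRatio lam mu) d (reflP lam mu muI) (reflQ lam mu lamI muI)
    (reflR mu muI) (shiftPot hd) j

/-- The transmitted field of a force `e j` at `(0, 0, -d)`. -/
def transmitted (j : Fin 3) : Fin 3 → Smooth3 :=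
  upField (kelvinConst lam mu) (modRatio lam mu) (modRatio lamI muI) d (1 + reflP lam mu muI)
    (1 + reflQ lam mu lamI muI) (1 + reflR mu muI) (shiftPot hd) j

/-- The incoming field of a regularised force `e j` at `(0, 0, -d)`. -/
def incoming (d δ : ℝ) (j : Fin 3) : Fin 3 → Smooth3 :=
  kelvinField (kelvinConst lam mu) (modRatio lam mu) (smoothDist δ (axis (-d))) j

/-- Minus the regularised force `e j` at `(0, 0, -d)`. -/
def regularForce (d δ : ℝ) (j i : Fin 3) : Smooth3 :=
  (8 * Real.pi)⁻¹ • if i = j then lap (lap (smoothDist δ (axis (-d)))) else 0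

theorem hasCompactSupport_regularForce {d δ : ℝ} (hδ : 0 < δ) (j i : Fin 3) :
    HasCompactSupport (regularForce d δ j i : R3 → ℝ) := by
  by_cases h : i = j
  · exact HasCompactSupport.intro (hasCompactSupport_bilap_smoothDist hδ (axis (-d)))
      fun x hx => by
        simp [regularForce, h, image_eq_zero_of_notMem_tsupport hx]
  · exact HasCompactSupport.intro isCompact_empty fun x _ => by simp [regularForce, h]

variable {lam mu lamI muI}

theorem exists_bound_phase (j : Fin 3) : ∃ C : ℝ, 0 ≤ C ∧
    (∀ i (x : R3), x 2 ≤ d / 2 → |reflected lam mu lamI muI hd j i x| ≤ C / (1 + ‖x‖) ^ 1) ∧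
    (∀ i m (x : R3), x 2 ≤ d / 2 → |D m (reflected lam mu lamI muI hd j i) x| ≤
      C / (1 + ‖x‖) ^ 2) ∧
    (∀ i (x : R3), 0 ≤ x 2 → |transmitted lam mu lamI muI hd j i x| ≤ C / (1 + ‖x‖) ^ 1) ∧
    ∀ i m (x : R3), 0 ≤ x 2 → |D m (transmitted lam mu lamI muI hd j i) x| ≤
      C / (1 + ‖x‖) ^ 2 := by
  obtain ⟨C, hC, h1, h2⟩ := Symb.exists_bound fun i => Symb.lowField (kelvinConst lam mu)
    (modRatio lam mu) d (reflP lam mu muI) (reflQ lam mu lamI muI) (reflR mu muI)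
    (symb_shiftPot hd) j i
  obtain ⟨C', hC', h3, h4⟩ := Symb.exists_bound fun i => Symb.upField (kelvinConst lam mu)
    (modRatio lam mu) (modRatio lamI muI) d (1 + reflP lam mu muI)
    (1 + reflQ lam mu lamI muI) (1 + reflR mu muI) (symb_shiftPot hd) j i
  have hle : ∀ {K t : ℝ}, K ≤ C + C' → 0 ≤ t → K / t ≤ (C + C') / t := fun hK ht =>
    div_le_div_of_nonneg_right hK ht
  have hlow : ∀ x : R3, x 2 ≤ d / 2 → x ∈ diagMap sgn 0 ⁻¹' {x | -(d / 2) ≤ x 2} := fun x hx => by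
    simpa using hx
  have hup : ∀ x : R3, 0 ≤ x 2 → x ∈ {x : R3 | -(d / 2) ≤ x 2} := fun x hx => by
    change -(d / 2) ≤ x 2
    linarith
  exact ⟨C + C', add_nonneg hC hC',
    fun i x hx => (h1 i x (hlow x hx)).trans (hle (by linarith) (by positivity)),
    fun i m x hx => (h2 i m x (hlow x hx)).trans (hle (by linarith) (by positivity)),
    fun i x hx => (h3 i x (hup x hx)).trans (hle (by linarith) (by positivity)),
    fun i m x hx => (h4 i m x (hup x hx)).trans (hle (by linarith) (by positivity))⟩

theorem isOpen_above (d : ℝ) : IsOpen {x : R3 | -(d / 2) < x 2} :=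
  isOpen_lt continuous_const (coord 2).continuous

/-- For `δ ≤ d` the smoothing ball, of radius `δ/2` about the pole, does not meet `x₃ > -d/2`. -/
theorem incoming_eq (h : Elliptic lam mu) {δ : ℝ} (hδ : 0 < δ) (hδd : δ ≤ d) (j i : Fin 3) :
    ∀ x ∈ {x : R3 | -(d / 2) < x 2}, incoming lam mu d δ j i x =
      upField (kelvinConst lam mu) (modRatio lam mu) (modRatio lam mu) d 1 1 1 (shiftPot hd) j i x :=
  kelvinField_eq_upField h.modRatio_pos.ne' (isOpen_above d)
    (fun x hx => lap_shiftPot hd (le_of_lt hx)) (fun x hx => by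
      have hx' : -(d / 2) < x 2 := hx
      rw [smoothDist_of_ge hδ, norm_eq_shiftPot hd hx'.le]
      have := le_norm_sub_axis (d := d) (x := x)
      linarith) j i

theorem stress_congr_on {A B : Fin 3 → Smooth3} {U : Set R3} (hU : IsOpen U)
    (h : ∀ i, ∀ x ∈ U, A i x = B i x) (i j : Fin 3) :
    ∀ x ∈ U, stress lam mu A i j x = stress lam mu B i j x := fun x hx => by
  have hD : (fun k l => D l (A k) x) = fun k l => D l (B k) x := by
    ext k l
    exact D_congr_on hU (h k) l x hx
  rw [stress_apply, stress_apply, hD]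

variable (h : Elliptic lam mu) (hI : Elliptic lamI muI)
include h

theorem displacement_phase {δ : ℝ} (hδ : 0 < δ) (hδd : δ ≤ d) (j i : Fin 3) {x : R3}
    (hx : x 2 = 0) : (incoming lam mu d δ j + reflected lam mu lamI muI hd j) i x =
      transmitted lam mu lamI muI hd j i x := by
  have hx' : x ∈ {x : R3 | -(d / 2) < x 2} := by
    change -(d / 2) < x 2
    linarith
  rw [Pi.add_apply, Smooth3.add_apply, incoming_eq hd h hδ hδd j i x hx']
  exact displacement_match j i hx

theorem lame_incoming (δ : ℝ) (j i : Fin 3) :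
    lame lam mu (incoming lam mu d δ j) i = regularForce d δ j i := by
  rw [incoming, lame_kelvinField h.modRatio_pos.ne' h.modRatio_mul, h.kelvinConst_eq]
  rfl

include hI

theorem traction_phase {δ : ℝ} (hδ : 0 < δ) (hδd : δ ≤ d) (j i : Fin 3) {x : R3}
    (hx : x 2 = 0) :
    stress lam mu (incoming lam mu d δ j + reflected lam mu lamI muI hd j) i 2 x =
      stress lamI muI (transmitted lam mu lamI muI hd j) i 2 x := by
  have hx' : x ∈ {x : R3 | -(d / 2) < x 2} := by
    change -(d / 2) < x 2
    linarith
  rw [stress_add, Smooth3.add_apply,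
    stress_congr_on (isOpen_above d) (fun i => incoming_eq hd h hδ hδd j i) i 2 x hx']
  exact traction_match h.modRatio_mul hI.modRatio_mul (h.reflP_eq hI) (h.reflQ_eq hI)
    (h.reflR_eq hI) (isOpen_above d) (fun x hx => lap_shiftPot hd (le_of_lt hx)) j i hx hx'

/-- The transmitted potential is harmonic above `-d/2` and the reflected one below `d/2`, so on its
own side each solves the homogeneous system. The regularised force vanishes in the upper half space.
-/
theorem lame_phase {δ : ℝ} (hδ : 0 < δ) (hδd : δ ≤ d) (j i : Fin 3) :
    glue (lame lam mu (incoming lam mu d δ j + reflected lam mu lamI muI hd j) i)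
      (lame lamI muI (transmitted lam mu lamI muI hd j) i) = regularForce d δ j i := by
  have hX : ∀ x ∈ {x : R3 | -(d / 2) < x 2}, lap (shiftPot hd) x = 0 := fun x hx =>
    lap_shiftPot hd (le_of_lt hx)
  ext x
  unfold glue
  split_ifs with hx
  · have hx' : x ∈ {x : R3 | -(d / 2) < x 2} := by
      change -(d / 2) < x 2
      linarith
    have hn := le_norm_sub_axis (d := d) (x := x)
    have hb : lap (lap (smoothDist δ (axis (-d)))) x = 0 := bilap_smoothDist_eq_zero hδ (by linarith)
    rw [transmitted, lame_upField hI.modRatio_mul _ _ _ _ _ _ (isOpen_above d) hX j i x hx']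
    by_cases hij : i = j <;> simp [regularForce, hij, hb]
  · have hx' : x ∈ diagMap sgn 0 ⁻¹' {x : R3 | -(d / 2) < x 2} := by
      have : x 2 < d / 2 := by linarith [not_lt.1 hx]
      simpa using this
    rw [lame_add, Smooth3.add_apply, lame_incoming h, reflected,
      lame_lowField h.modRatio_mul _ _ _ _ _ (isOpen_above d) hX j i x hx', add_zero]

theorem isTransmission_phase {δ : ℝ} (hδ : 0 < δ) (hδd : δ ≤ d) (j : Fin 3) :
    ∃ M, IsTransmission lam mu lamI muI (d / 2) M
      (incoming lam mu d δ j + reflected lam mu lamI muI hd j)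
      (transmitted lam mu lamI muI hd j) (regularForce d δ j) := by
  obtain ⟨C, hC, h1, h2, h3, h4⟩ := exists_bound_phase (lam := lam) (mu := mu) (lamI := lamI)
    (muI := muI) hd j
  obtain ⟨K, hK, hk⟩ := exists_decay_kelvinField (kelvinConst lam mu) (modRatio lam mu)
  obtain ⟨M, hM, hm⟩ := exists_common_bound (P := fun (i : Fin 3) M => ∀ x : R3,
      |incoming lam mu d δ j i x| ≤ M / (1 + ‖x‖) ^ 1)
    (fun i C C' hle hP x => (hP x).trans (div_le_div_of_nonneg_right hle (by positivity)))
    (fun i => exists_bound_of_decay (Smooth3.continuous _) hd hK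
      fun x hx => (hk δ hδ _ x hx j i).1)
  obtain ⟨M', hM', hm'⟩ := exists_common_bound (P := fun (im : Fin 3 × Fin 3) M => ∀ x : R3,
      |D im.2 (incoming lam mu d δ j im.1) x| ≤ M / (1 + ‖x‖) ^ 2)
    (fun i C C' hle hP x => (hP x).trans (div_le_div_of_nonneg_right hle (by positivity)))
    (fun im => exists_bound_of_decay (Smooth3.continuous _) hd hK
      fun x hx => (hk δ hδ _ x hx j im.1).2 im.2)
  refine ⟨C + M + M', ⟨fun i x hx => ?_, fun i m x hx => ?_, fun i x hx => ?_, fun i m x hx => ?_,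
    fun i x hx => displacement_phase hd h hδ hδd j i hx,
    fun i x hx => traction_phase hd h hI hδ hδd j i hx, hasCompactSupport_regularForce hδ j,
    lame_phase hd h hI hδ hδd j⟩⟩
  · have := h1 i x hx
    have := hm i x
    rw [pow_one] at *
    rw [Pi.add_apply, Smooth3.add_apply, add_div, add_div]
    have : 0 ≤ M' / (1 + ‖x‖) := by positivity
    linarith [abs_add_le (incoming lam mu d δ j i x) (reflected lam mu lamI muI hd j i x)]
  · have := h2 i m x hx
    have := hm' (i, m) x
    rw [Pi.add_apply, map_add, Smooth3.add_apply, add_div, add_div]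
    have : 0 ≤ M / (1 + ‖x‖) ^ 2 := by positivity
    linarith [abs_add_le (D m (incoming lam mu d δ j i) x)
      (D m (reflected lam mu lamI muI hd j i) x)]
  · have := h3 i x hx
    rw [pow_one] at this
    exact this.trans (div_le_div_of_nonneg_right (by linarith) (by positivity))
  · exact (h4 i m x hx).trans (div_le_div_of_nonneg_right (by linarith) (by positivity))

end Phase

end

/-! ### Existence and representation of the fundamental matrix -/

section

theorem glue_add (A A' B B' : R3 → ℝ) (x : R3) :
    glue (A + A') (B + B') x = glue A B x + glue A' B' x := by
  unfold glue; split_ifs <;> rfl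

theorem glue_smul (t : ℝ) (A B : R3 → ℝ) (x : R3) :
    glue (t • A) (t • B) x = t * glue A B x := by
  unfold glue; split_ifs <;> rfl

namespace IsApproximation

variable {lam mu lamI muI C C' : ℝ} {z l l' : R3} {A F A' F' : ℕ → Fin 3 → Smooth3}
  {B B' : Fin 3 → Smooth3} {A0 A0' : Fin 3 → R3 → ℝ}

theorem zero : IsApproximation lam mu lamI muI 0 z 0 0 0 0 0 where
  nonneg := le_rfl
  eventually_eq i x _ := Eventually.of_forall fun n => Eventually.of_forall fun y => by simp
  bound n i x _ := by simp [glue]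
  bound_deriv n i j x _ := by simp [glue]
  displacement n i x _ := by simp
  traction n i x _ := by simp [stress, divF]
  lame_eq n i := by
    ext x
    simp [glue, lame, stress, divF]
  source U _ := by simp

/-- Superposition: approximations are constructed for the forces `e j`, and a fundamental matrix
needs every unit force. -/
theorem add_smul (h : IsApproximation lam mu lamI muI C z l A F B A0)
    (h' : IsApproximation lam mu lamI muI C' z l' A' F' B' A0') (t : ℝ) :
    IsApproximation lam mu lamI muI (C + |t| * C') z (l + t • l') (fun n => A n + t • A' n)
      (fun n => F n + t • F' n) (B + t • B') (fun i => A0 i + t • A0' i) where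
  nonneg := add_nonneg h.nonneg (mul_nonneg (abs_nonneg t) h'.nonneg)
  eventually_eq i x hx := by
    filter_upwards [h.eventually_eq i x hx, h'.eventually_eq i x hx] with n h1 h2
    filter_upwards [h1, h2] with y h3 h4
    simp [h3, h4]
  bound n i x hx := by
    have h1 := h.bound n i x hx
    have h2 := mul_le_mul_of_nonneg_left (h'.bound n i x hx) (abs_nonneg t)
    rw [← abs_mul, ← glue_smul] at h2
    rw [add_div, mul_div_assoc]
    refine le_trans ?_ (add_le_add h1 h2)
    refine le_trans (le_of_eq ?_) (abs_add_le _ _)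
    rw [← glue_add]
    rfl
  bound_deriv n i j x hx := by
    have h1 := h.bound_deriv n i j x hx
    have h2 := mul_le_mul_of_nonneg_left (h'.bound_deriv n i j x hx) (abs_nonneg t)
    rw [← abs_mul, ← glue_smul] at h2
    rw [add_div, mul_div_assoc]
    refine le_trans ?_ (add_le_add h1 h2)
    refine le_trans (le_of_eq ?_) (abs_add_le _ _)
    rw [← glue_add, Pi.add_apply, Pi.add_apply, map_add, map_add, Pi.smul_apply, Pi.smul_apply,
      Derivation.map_smul, Derivation.map_smul]
    rfl
  displacement n i x hx := by
    simp [h.displacement n i x hx, h'.displacement n i x hx]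
  traction n i x hx := by
    simp only [stress_add, stress_smul, Smooth3.add_apply, Smooth3.smul_apply,
      h.traction n i x hx, h'.traction n i x hx]
  lame_eq n i := by
    ext x
    simp only [lame_add, lame_smul]
    have h1 := congrFun (h.lame_eq n i) x
    have h2 := congrFun (h'.lame_eq n i) x
    refine (glue_add _ _ _ _ x).trans ?_
    refine (congrArg₂ (· + ·) h1 ((glue_smul t _ _ x).trans (congrArg (t * ·) h2))).trans ?_
    rfl
  source U hU := by
    have hi : ∀ (f : Smooth3) i, Integrable (fun x => f x * U i x) := fun f i =>
      (f.continuous.mul (U i).continuous).integrable_of_hasCompactSupport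
        ((hU i).mul_left (f := (f : R3 → ℝ)))
    have h1 := (h.source U hU).add ((h'.source U hU).const_mul t)
    refine (h1.congr fun n => ?_).trans (le_of_eq (congrArg 𝓝 ?_))
    · rw [Finset.mul_sum, ← Finset.sum_add_distrib]
      refine Finset.sum_congr rfl fun i _ => ?_
      rw [← integral_const_mul, ← integral_add (hi _ i) ((hi _ i).const_mul t)]
      congr 1
      ext x
      simp only [Pi.add_apply, Pi.smul_apply, Smooth3.add_apply, Smooth3.smul_apply]
      ring
    · simp only [Fin.sum_univ_three, PiLp.add_apply, PiLp.smul_apply, smul_eq_mul]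
      ring

end IsApproximation

/-- The Hessian of the distance to `z`. -/
def distHess (z : R3) (i j : Fin 3) (x : R3) : ℝ :=
  (if i = j then 1 else 0) / ‖x - z‖ - (x i - z i) * (x j - z j) / ‖x - z‖ ^ 3

/-- The `i`-th component of the Kelvin solution with pole `z` and force `e j`. -/
def kelvinSolution (lam mu : ℝ) (z : R3) (j i : Fin 3) (x : R3) : ℝ :=
  kelvinConst lam mu * ((1 + (modRatio lam mu)⁻¹) / 2 *
    (if i = j then ∑ m, distHess z m m x else 0) - distHess z i j x)

theorem incoming_eq_kelvinSolution (lam mu d : ℝ) {δ : ℝ} (hδ : 0 < δ) (j i : Fin 3) {x : R3}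
    (hx : δ / 2 < ‖x - axis (-d)‖) :
    incoming lam mu d δ j i x = kelvinSolution lam mu (axis (-d)) j i x := by
  have h : ∀ m n, D m (D n (smoothDist δ (axis (-d)))) x = distHess (axis (-d)) m n x := fun m n =>
    D_D_smoothDist hδ hx m n
  rw [incoming, kelvinField, kelvinSolution, ← h i j]
  simp_rw [← h]
  by_cases hij : i = j <;> simp [lap, hij]

section Existence

variable {lam mu lamI muI : ℝ} (h : Elliptic lam mu) (hI : Elliptic lamI muI) {d : ℝ} (hd : 0 < d)
include h hI

theorem exists_isApproximation (j : Fin 3) : ∃ C A F, IsApproximation lam mu lamI muI C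
    (axis (-d)) (e j) A F (transmitted lam mu lamI muI hd j)
    (fun i x => kelvinSolution lam mu (axis (-d)) j i x + reflected lam mu lamI muI hd j i x) := by
  obtain ⟨C, hC, h1, h2, h3, h4⟩ := exists_bound_phase (lam := lam) (mu := mu) (lamI := lamI)
    (muI := muI) hd j
  obtain ⟨K, hK, hk⟩ := exists_decay_kelvinField (kelvinConst lam mu) (modRatio lam mu)
  have hpos : ∀ n : ℕ, 0 < d / ((n : ℝ) + 1) := fun n => by positivity
  have hle : ∀ n : ℕ, d / ((n : ℝ) + 1) ≤ d := fun n => by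
    rw [div_le_iff₀ (by positivity)]
    have : (0 : ℝ) ≤ n := n.cast_nonneg
    nlinarith
  have hlim : Tendsto (fun n : ℕ => d / ((n : ℝ) + 1)) atTop (𝓝 0) :=
    tendsto_const_nhds.div_atTop
      (tendsto_atTop_add_const_right _ _ tendsto_natCast_atTop_atTop)
  have hz : ∀ m ≤ 2, ∀ x : R3, x ≠ axis (-d) →
      C / (1 + ‖x‖) ^ m ≤ C * (1 + d) ^ 2 / ‖x - axis (-d)‖ ^ m := fun m hm x hx => by
    have hn : 0 < ‖x - axis (-d)‖ := norm_pos_iff.2 (sub_ne_zero.2 hx)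
    have hle : ‖x - axis (-d)‖ ≤ (1 + d) * (1 + ‖x‖) := by
      have h5 := norm_sub_le x (axis (-d))
      have h6 : ‖axis (-d)‖ = d := by simp [axis, norm_smul, e, abs_of_pos hd]
      nlinarith [norm_nonneg x]
    refine (div_pow_le_of_le_mul hC hn (by positivity) hle m).trans ?_
    refine div_le_div_of_nonneg_right (mul_le_mul_of_nonneg_left ?_ hC) (by positivity)
    exact pow_le_pow_right₀ (by linarith) hm
  refine ⟨K + C * (1 + d) ^ 2, fun n => incoming lam mu d (d / ((n : ℝ) + 1)) j +
    reflected lam mu lamI muI hd j, fun n => regularForce d (d / ((n : ℝ) + 1)) j, ?_⟩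
  refine ⟨by positivity, fun i x hx => ?_, fun n i x hx => ?_, fun n i m x hx => ?_,
    fun n i x hx => displacement_phase hd h (hpos n) (hle n) j i hx,
    fun n i x hx => traction_phase hd h hI (hpos n) (hle n) j i hx,
    fun n i => lame_phase hd h hI (hpos n) (hle n) j i, fun U hU => ?_⟩
  · have hn : 0 < ‖x - axis (-d)‖ := norm_pos_iff.2 (sub_ne_zero.2 hx)
    filter_upwards [hlim.eventually_lt_const hn] with n hn'
    have ho : IsOpen {y : R3 | d / ((n : ℝ) + 1) / 2 < ‖y - axis (-d)‖} :=
      isOpen_lt continuous_const (continuous_id.sub continuous_const).norm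
    filter_upwards [ho.mem_nhds (show d / ((n : ℝ) + 1) / 2 < ‖x - axis (-d)‖ by
      linarith [hpos n])] with y hy
    rw [← incoming_eq_kelvinSolution lam mu d (hpos n) j i hy]
    rfl
  · rw [add_div]
    have hp : 0 ≤ K / ‖x - axis (-d)‖ ^ 1 := by positivity
    refine abs_glue_le_of (fun hx0 => ?_) (fun hx0 => ?_)
    · refine (abs_add_le _ _).trans (add_le_add (hk _ (hpos n) _ x hx j i).1 ?_)
      exact (h1 i x (by linarith)).trans (hz 1 (by norm_num) x hx)
    · exact ((h3 i x hx0.le).trans (hz 1 (by norm_num) x hx)).trans (le_add_of_nonneg_left hp)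
  · rw [add_div]
    have hp : 0 ≤ K / ‖x - axis (-d)‖ ^ 2 := by positivity
    refine abs_glue_le_of (fun hx0 => ?_) (fun hx0 => ?_)
    · rw [Pi.add_apply, map_add]
      refine (abs_add_le _ _).trans (add_le_add ((hk _ (hpos n) _ x hx j i).2 m) ?_)
      exact (h2 i m x (by linarith)).trans (hz 2 le_rfl x hx)
    · exact ((h4 i m x hx0.le).trans (hz 2 le_rfl x hx)).trans (le_add_of_nonneg_left hp)
  · have h5 := (tendsto_integral_bilap ((U j).continuous.locallyIntegrable)
      ((U j).continuous.continuousAt (x := axis (-d)))).comp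
      (tendsto_nhdsWithin_iff.2 ⟨hlim, Eventually.of_forall hpos⟩)
    have h6 := h5.const_mul (8 * Real.pi)⁻¹
    refine (h6.congr fun n => ?_).trans (le_of_eq (congrArg 𝓝 ?_))
    · rw [Finset.sum_eq_single j (fun i _ hij => by simp [regularForce, hij]) (by simp),
        Function.comp_apply, ← integral_const_mul]
      congr 1
      ext x
      simp [regularForce]
      ring
    · rw [Finset.sum_eq_single j (fun i _ hij => by simp [e, hij]) (by simp)]
      have := Real.pi_ne_zero
      simp [e]
      field_simp

include hd in
theorem exists_isFundamentalMatrix :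
    ∃ G, IsFundamentalMatrix lam mu lamI muI upperHalfSpace (axis (-d)) G := by
  choose C A F H using exists_isApproximation h hI hd
  set g : Fin 3 → Fin 3 → R3 → ℝ := fun j i => glue
    (fun x => kelvinSolution lam mu (axis (-d)) j i x + reflected lam mu lamI muI hd j i x)
    (transmitted lam mu lamI muI hd j i) with hg
  refine ⟨fun x => ∑ j, (EuclideanSpace.proj j : R3 →L[ℝ] ℝ).smulRight
    (WithLp.toLp 2 fun i => g j i x : R3), ?_, fun l _ => ?_⟩
  · refine continuousOn_finsetSum _ fun j _ x hx => ContinuousAt.continuousWithinAt ?_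
    have h1 : ContinuousAt (fun x => (WithLp.toLp 2 fun i => g j i x : R3)) x :=
      (PiLp.continuous_toLp 2 (fun _ : Fin 3 => ℝ)).continuousAt.comp
        (continuousAt_pi.2 fun i => (H j).continuousAt i hx)
    exact (ContinuousLinearMap.smulRightL ℝ R3 R3
      (EuclideanSpace.proj j : R3 →L[ℝ] ℝ)).continuous.continuousAt.comp h1
  · have h1 := ((((IsApproximation.zero (lam := lam) (mu := mu) (lamI := lamI) (muI := muI)
      (z := axis (-d))).add_smul (H 0) (l 0)).add_smul (H 1) (l 1)).add_smul (H 2)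
        (l 2)).isFundamentalSolution
    have hl : 0 + l 0 • e 0 + l 1 • e 1 + l 2 • e 2 = l := by
      ext i
      fin_cases i <;> simp [e]
    rw [hl] at h1
    convert h1 using 1
    ext x i
    simp only [hg, glue, Fin.sum_univ_three]
    split_ifs <;> simp

end Existence

/-- The field `u`, with pole `y` and force `e i`, is paired with the explicit regularised field with
pole `axis (-d)` and force `e j`. One side is the explicit field at `y`, the other an average of `u`
near `axis (-d)`. Only continuity of `u` at that point is used besides the defining properties, so
this applies to whichever solution `fundamentalMatrix` selects. -/
theorem IsFundamentalSolution.apply_eq {lam mu lamI muI : ℝ} (h : Elliptic lam mu)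
    (hI : Elliptic lamI muI) {d : ℝ} (hd : 0 < d) {y : R3} (hy : y 2 ≤ 0) (hyd : y ≠ axis (-d))
    {u : R3 → R3} {i : Fin 3}
    (hu : IsFundamentalSolution lam mu lamI muI upperHalfSpace y (e i) u)
    (hc : ContinuousAt u (axis (-d))) (j : Fin 3) :
    u (axis (-d)) j = kelvinSolution lam mu (axis (-d)) j i y +
      reflected lam mu lamI muI hd j i y := by
  have hloc : LocallyIntegrable (fun x => u x j) volume := fun x => by
    obtain ⟨s, hs, hs'⟩ := hu.1 x
    exact ⟨s, hs, (EuclideanSpace.proj j : R3 →L[ℝ] ℝ).integrable_comp hs'⟩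
  have hcj : ContinuousAt (fun x => u x j) (axis (-d)) :=
    (EuclideanSpace.proj j : R3 →L[ℝ] ℝ).continuous.continuousAt.comp hc
  have h1 := (tendsto_integral_bilap hloc hcj).const_mul (-(8 * Real.pi)⁻¹)
  have hn : 0 < ‖y - axis (-d)‖ := norm_pos_iff.2 (sub_ne_zero.2 hyd)
  have h2 : Tendsto (fun δ : ℝ => -(8 * Real.pi)⁻¹ *
      ∫ x, u x j * lap (lap (smoothDist δ (axis (-d)))) x) (𝓝[>] 0)
      (𝓝 (kelvinSolution lam mu (axis (-d)) j i y + reflected lam mu lamI muI hd j i y)) := by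
    refine tendsto_const_nhds.congr' ?_
    -- `δ ≤ d` keeps the regularisation away from the interface, and `δ < ‖y - axis (-d)‖` makes the
    -- incoming field at `y` equal to the exact Kelvin field. The expression is thus constant for
    -- small `δ`.
    filter_upwards [Ioc_mem_nhdsGT hd, Ioo_mem_nhdsGT hn] with δ hδ hδ'
    obtain ⟨M, hM⟩ := isTransmission_phase hd h hI hδ.1 hδ.2 j
    have h3 := hM.pairing (by linarith) hy hu
    rw [Finset.sum_eq_single i (fun m _ hm => by simp [e, hm]) (by simp),
      Finset.sum_eq_single j (fun m _ hm => by simp [regularForce, hm]) (by simp)] at h3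
    have h4 : (e i) i = 1 := by simp [e]
    rw [h4, one_mul, Pi.add_apply, Smooth3.add_apply,
      incoming_eq_kelvinSolution lam mu d hδ.1 j i (by linarith [hδ.1, hδ'.2])] at h3
    rw [h3, neg_mul, ← integral_const_mul]
    congr 2
    ext x
    simp [regularForce]
    ring
  have h3 := tendsto_nhds_unique h1 h2
  rw [← h3]
  have := Real.pi_ne_zero
  field_simp

end

/-! ### Values on the axis and the uniform lower bound -/

section

theorem inner_e (v : R3) (i : Fin 3) : inner ℝ v (e i) = v i := innerSL_e v i

theorem norm_e (i : Fin 3) : ‖e i‖ = 1 := by simp [e]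

/-- The dictionary is `3 - 4ν = k⁻¹`, with the trace `2/r` of the Hessian of the distance `r`. The
Kelvin matrix is even in `x - y`, so pole and evaluation point may be exchanged. -/
theorem inner_kelvinMatrix {lam mu : ℝ} (h : Elliptic lam mu) {z y : R3} (hzy : y ≠ z)
    (i : Fin 3) : inner ℝ (kelvinMatrix lam mu z y (e i)) (e i) =
      kelvinSolution lam mu z i i y := by
  have hr : 0 < ‖y - z‖ := norm_pos_iff.2 (sub_ne_zero.2 hzy)
  have h1 := h.pos
  have h2 := h.add_pos
  have h3 := h.denom_pos
  have h4 : 0 < lam + 2 * mu := by linarith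
  have hn := norm_sq_eq (y - z)
  simp only [PiLp.sub_apply] at hn
  have hs : ∑ m, distHess z m m y = 2 / ‖y - z‖ := by
    simp only [distHess, if_true, Fin.sum_univ_three]
    field_simp
    linear_combination hn
  have hc : 1 / (16 * Real.pi * mu * (1 - poissonRatio lam mu)) = kelvinConst lam mu := by
    have hp : 1 - poissonRatio lam mu = (lam + 2 * mu) / (2 * (lam + mu)) := by
      unfold poissonRatio; field_simp; ring
    have hk : 1 + modRatio lam mu = 2 * (lam + 2 * mu) / (lam + 3 * mu) := by
      rw [modRatio, eq_div_iff h3.ne', add_mul, div_mul_cancel₀ _ h3.ne']; ring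
    have hpi := Real.pi_pos
    rw [hp, kelvinConst, hk, modRatio]
    generalize lam + 2 * mu = a, lam + mu = b, lam + 3 * mu = n at *
    field_simp
    norm_num
  have hk : 3 - 4 * poissonRatio lam mu = (modRatio lam mu)⁻¹ := by
    unfold poissonRatio modRatio; field_simp; ring
  rw [inner_e, kelvinMatrix, hc, hk, norm_sub_rev z y, kelvinSolution, if_pos rfl, hs, distHess,
    if_pos rfl]
  have h5 : (e i) i = 1 := by simp [e]
  simp only [_root_.smul_apply, _root_.add_apply, ContinuousLinearMap.smulRight_apply, innerSL_e,
    ContinuousLinearMap.id_apply, PiLp.smul_apply, PiLp.add_apply, PiLp.sub_apply, smul_eq_mul, h5]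
  field_simp
  ring

section Axis

/-- The numbers `a i` with `∂ᵢᵢ X = a i / s` on the axis. -/
def axisCoeff (i : Fin 3) : ℝ := if i = 2 then 1 else -(1 / 2)

theorem D_D_shiftPot_axis (i : Fin 3) {h : ℝ} (hh : 0 < h) :
    D i (D i (shiftPot one_pos)) (axis h) = axisCoeff i / (1 + h) ∧
    D i (D 2 (D i (shiftPot one_pos))) (axis h) = -axisCoeff i / (1 + h) ^ 2 ∧
    D i (D 2 (D 2 (D i (shiftPot one_pos)))) (axis h) = 2 * axisCoeff i / (1 + h) ^ 3 := by
  set P := potX (show (0 : ℝ) < 1 / 4 by positivity) with hP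
  have hs : 1 / 4 < 1 + h := by linarith
  have hx : axis h - axis (-1) = axis (1 + h) := by
    ext m
    by_cases hm : m = 2 <;> simp [hm, add_comm]
  have h0 : ∀ s, 1 / 4 < s → D i (D i P) (axis s) = axisCoeff i / s ^ (0 + 1) := fun s hs =>
    D_D_potX_axis _ i hs
  have h1 := D_two_axis (by norm_num) h0
  have h2 := D_two_axis (by norm_num) h1
  refine ⟨?_, ?_, ?_⟩
  · refine (Dl_shiftPot one_pos [i, i] (axis h)).trans ?_
    rw [hx]
    exact (h0 _ hs).trans (by simp)
  · refine (Dl_shiftPot one_pos [i, 2, i] (axis h)).trans ?_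
    rw [hx]
    change D i (D 2 (D i P)) _ = _
    rw [D_comm i 2, h1 _ hs]
    simp
  · refine (Dl_shiftPot one_pos [i, 2, 2, i] (axis h)).trans ?_
    rw [hx]
    change D i (D 2 (D 2 (D i P))) _ = _
    rw [D_comm i 2, D_comm i 2, h2 _ hs]
    norm_num

/-- The values `(1 + h) (Γ⁺ - Γ)ᵢᵢ` on the axis, at height `-h`, for the pole `(0, 0, -1)`. -/
def axisValue (lam mu lamI muI : ℝ) (i : Fin 3) (h : ℝ) : ℝ :=
  -(kelvinConst lam mu / 2) * axisCoeff i *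
      (sgn i * (modRatio lam mu)⁻¹ * (reflP lam mu muI + reflQ lam mu lamI muI) -
        2 * reflP lam mu muI +
        8 * sgn i * modRatio lam mu * reflP lam mu muI * (h / (1 + h) ^ 2)) +
    kelvinConst lam mu * (1 + (modRatio lam mu)⁻¹) * reflR mu muI * (if i = 2 then 0 else 1 / 2)

/-- The reflected field at depth `h` involves the potential only at the mirror point, at height `1 +
h` above the pole, where its derivatives are pure powers of `1 + h`. -/
theorem reflected_axis {lam mu lamI muI : ℝ} (he : Elliptic lam mu) (i : Fin 3) {h : ℝ}
    (hh : 0 < h) : reflected lam mu lamI muI one_pos i i (axis (-h)) =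
      axisValue lam mu lamI muI i h / (1 + h) := by
  have hk := he.modRatio_pos
  obtain ⟨h1, h2, h3⟩ := D_D_shiftPot_axis i hh
  obtain ⟨h4, -, -⟩ := D_D_shiftPot_axis 2 hh
  have hx : diagMap sgn 0 (axis (-h)) = axis h := by
    ext m
    by_cases hm : m = 2 <;> simp [hm]
  have hs : 1 + h ≠ 0 := by positivity
  have hm : ∀ f : Smooth3, f.mirror (axis (-h)) = f (axis h) := fun f => by
    rw [← hx]; rfl
  rw [reflected]
  generalize shiftPot one_pos = X at *
  fin_cases i <;>
    simp [lowField, almansi, gradF, twist, potSum, potUp, D_mirror, hm, axisValue, axisCoeff]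
      at h1 h2 h3 h4 ⊢ <;>
    simp only [h1, h2, h3, h4] <;> field_simp <;> ring

end Axis

theorem fundamentalMatrix_spec {lam mu lamI muI : ℝ} {S : Set R3} {y : R3}
    (h : ∃ G, IsFundamentalMatrix lam mu lamI muI S y G) :
    IsFundamentalMatrix lam mu lamI muI S y (fun x => fundamentalMatrix lam mu lamI muI S x y) := by
  have : (fun x => fundamentalMatrix lam mu lamI muI S x y) = h.choose := by
    ext1 x
    rw [fundamentalMatrix, dif_pos h]
  rw [this]
  exact h.choose_spec

theorem axis_neg (h : ℝ) : (!₂[0, 0, -h] : R3) = axis (-h) := by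
  ext i
  fin_cases i <;> simp

/-- The explicit field is placed at the evaluation point `axis (-1)` of `Γ⁺` rather than at its
pole, as reciprocity dictates; the Kelvin parts cancel. -/
theorem inner_fundamentalMatrix_sub {lam mu lamI muI : ℝ} (he : Elliptic lam mu)
    (hI : Elliptic lamI muI) {h : ℝ} (hh : 0 < h) (h1 : h ≠ 1) (i : Fin 3) :
    inner ℝ ((fundamentalMatrix lam mu lamI muI upperHalfSpace (axis (-1)) (axis (-h)) -
      kelvinMatrix lam mu (axis (-1)) (axis (-h))) (e i)) (e i) =
      axisValue lam mu lamI muI i h / (1 + h) := by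
  have hG := fundamentalMatrix_spec (exists_isFundamentalMatrix he hI hh)
  have hne : axis (-h) ≠ axis (-1) := fun hc => by
    have := congrArg (fun p : R3 => p 2) hc
    simp at this
    exact h1 this
  have hc : ContinuousAt (fun x => fundamentalMatrix lam mu lamI muI upperHalfSpace x (axis (-h)))
      (axis (-1)) := hG.1.continuousAt (isOpen_compl_singleton.mem_nhds hne.symm)
  have hv := (hG.2 (e i) (norm_e i)).apply_eq he hI one_pos (by simp [hh.le]) hne
    (hc.clm_apply continuousAt_const) i
  rw [_root_.sub_apply, inner_sub_left, inner_kelvinMatrix he hne, inner_e, hv,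
    reflected_axis he i hh]
  ring

theorem axisValue_ne_zero {lam mu lamI muI : ℝ} (h : Elliptic lam mu) (hI : Elliptic lamI muI)
    (hne : lam ≠ lamI ∨ mu ≠ muI) (i : Fin 3) :
    axisValue lam mu lamI muI i (2 / 3) ≠ 0 ∨ axisValue lam mu lamI muI i (3 / 4) ≠ 0 := by
  by_contra! hz
  obtain ⟨h1, h2⟩ := hz
  have hk := h.modRatio_pos
  have hc := h.kelvinConst_pos
  have ha : axisCoeff i ≠ 0 := by unfold axisCoeff; split_ifs <;> norm_num
  have hs : sgn i ≠ 0 := by unfold sgn; split_ifs <;> norm_num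
  have hP : reflP lam mu muI = 0 := by
    have h3 : kelvinConst lam mu * axisCoeff i * sgn i * modRatio lam mu * reflP lam mu muI = 0 := by
      unfold axisValue at h1 h2
      -- The values of `h / (1 + h)²` at `2/3` and `3/4` are `6/25` and `12/49`. Subtraction cancels
      -- everything else and leaves `-4` times the product times their difference.
      linear_combination (-(1 / (4 * (6 / 25 - 12 / 49)))) * (h1 - h2)
    simpa [hc.ne', ha, hs, hk.ne'] using h3
  have hmu : mu = muI := by
    have := (add_pos hI.pos (mul_pos hk h.pos)).ne'
    have h3 := (div_eq_zero_iff.1 hP).resolve_right this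
    linarith
  have hR : reflR mu muI = 0 := by simp [reflR, hmu]
  have hQ : reflQ lam mu lamI muI = 0 := by
    have h3 : kelvinConst lam mu * axisCoeff i * sgn i * (modRatio lam mu)⁻¹ *
        reflQ lam mu lamI muI = 0 := by
      unfold axisValue at h1
      rw [hP, hR] at h1
      -- With `p = r = 0` only the `q` term remains, carrying the factor `-1/2`.
      linear_combination (-2) * h1
    simpa [hc.ne', ha, hs, hk.ne'] using h3
  have hq := (div_eq_zero_iff.1 hQ).resolve_right (add_pos h.pos (mul_pos hI.modRatio_pos hI.pos)).ne'
  rw [← hmu, ← sub_mul] at hq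
  have hkk := (mul_eq_zero.1 hq).resolve_right h.pos.ne'
  have hI' := hI.denom_pos
  rw [← hmu] at hI'
  have h' := h.denom_pos
  rw [modRatio, modRatio, sub_eq_zero, div_eq_div_iff h'.ne' hI'.ne'] at hkk
  -- For equal shear moduli, cross-multiplying the equality of the two ratios gives `2μ (λ - λᴵ) =
  -- 0`.
  have hl : mu * (lam - lamI) = 0 := by linear_combination (1 / 2) * hkk
  have := (mul_eq_zero.1 hl).resolve_left h.pos.ne'
  rcases hne with hne | hne
  · exact hne (by linarith)
  · exact hne hmu

theorem ModuliBounds.elliptic {α₀ γ₀ muBar lamBar lam mu : ℝ} (hα₀ : 0 < α₀) (hγ₀ : 0 < γ₀)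
    (h : ModuliBounds α₀ γ₀ muBar lamBar lam mu) : Elliptic lam mu := by
  obtain ⟨h1, h2, -, -⟩ := h
  exact ⟨by linarith, by linarith⟩

/-- The sum of absolute values is continuous and positive on a compact set of admissible moduli; the
separation by `η₀` keeps that set away from the locus where the media coincide. -/
theorem exists_pos_le_axisValue {α₀ γ₀ : ℝ} (muBar lamBar : ℝ) {η₀ : ℝ} (hα₀ : 0 < α₀) (hγ₀ : 0 < γ₀)
    (hη₀ : 0 < η₀) (i : Fin 3) : ∃ c : ℝ, 0 < c ∧ ∀ lam mu lamI muI : ℝ,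
      ModuliBounds α₀ γ₀ muBar lamBar lam mu → ModuliBounds α₀ γ₀ muBar lamBar lamI muI →
      η₀ ^ 2 ≤ (lam - lamI) ^ 2 + (mu - muI) ^ 2 →
      c ≤ |axisValue lam mu lamI muI i (2 / 3)| + |axisValue lam mu lamI muI i (3 / 4)| := by
  set K : Set (ℝ × ℝ × ℝ × ℝ) := {p | ModuliBounds α₀ γ₀ muBar lamBar p.1 p.2.1 ∧
    ModuliBounds α₀ γ₀ muBar lamBar p.2.2.1 p.2.2.2 ∧
    η₀ ^ 2 ≤ (p.1 - p.2.2.1) ^ 2 + (p.2.1 - p.2.2.2) ^ 2} with hK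
  have hKc : IsCompact K := by
    -- The lower bound for `λ` comes from `2μ + 3λ ≥ γ₀` and `μ ≤ muBar`.
    refine IsCompact.of_isClosed_subset (s := Set.Icc ((γ₀ - 2 * muBar) / 3) lamBar ×ˢ
      Set.Icc α₀ muBar ×ˢ Set.Icc ((γ₀ - 2 * muBar) / 3) lamBar ×ˢ Set.Icc α₀ muBar)
      (isCompact_Icc.prod (isCompact_Icc.prod (isCompact_Icc.prod isCompact_Icc))) ?_ ?_
    · simp only [hK, ModuliBounds, Set.ofPred_and]
      repeat' apply IsClosed.inter
      all_goals exact isClosed_le (by fun_prop) (by fun_prop)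
    · rintro ⟨lam, mu, lamI, muI⟩ ⟨⟨h1, h2, h3, h4⟩, ⟨h5, h6, h7, h8⟩, -⟩
      simp only at h1 h2 h3 h4 h5 h6 h7 h8
      refine ⟨⟨?_, ?_⟩, ⟨?_, ?_⟩, ⟨?_, ?_⟩, ⟨?_, ?_⟩⟩ <;> simp only <;> linarith
  have hE : ∀ p ∈ K, Elliptic p.1 p.2.1 := fun p hp => hp.1.elliptic hα₀ hγ₀
  have hEI : ∀ p ∈ K, Elliptic p.2.2.1 p.2.2.2 := fun p hp => hp.2.1.elliptic hα₀ hγ₀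
  have c1 : ContinuousOn (fun p : ℝ × ℝ × ℝ × ℝ => modRatio p.1 p.2.1) K :=
    ContinuousOn.div (by fun_prop) (by fun_prop) fun p hp => (hE p hp).denom_pos.ne'
  have c2 : ContinuousOn (fun p : ℝ × ℝ × ℝ × ℝ => modRatio p.2.2.1 p.2.2.2) K :=
    ContinuousOn.div (by fun_prop) (by fun_prop) fun p hp => (hEI p hp).denom_pos.ne'
  have c3 : ContinuousOn (fun p : ℝ × ℝ × ℝ × ℝ => (modRatio p.1 p.2.1)⁻¹) K :=
    c1.inv₀ fun p hp => (hE p hp).modRatio_pos.ne'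
  have c4 : ContinuousOn (fun p : ℝ × ℝ × ℝ × ℝ => kelvinConst p.1 p.2.1) K :=
    ContinuousOn.div c1 (by fun_prop) fun p hp => by
      have := (hE p hp).modRatio_pos
      have := (hE p hp).pos
      positivity
  have c5 : ContinuousOn (fun p : ℝ × ℝ × ℝ × ℝ => reflP p.1 p.2.1 p.2.2.2) K :=
    ContinuousOn.div (by fun_prop) (by fun_prop) fun p hp =>
      (add_pos (hEI p hp).pos (mul_pos (hE p hp).modRatio_pos (hE p hp).pos)).ne'
  have c6 : ContinuousOn (fun p : ℝ × ℝ × ℝ × ℝ => reflQ p.1 p.2.1 p.2.2.1 p.2.2.2) K :=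
    ContinuousOn.div (by fun_prop) (by fun_prop) fun p hp =>
      (add_pos (hE p hp).pos (mul_pos (hEI p hp).modRatio_pos (hEI p hp).pos)).ne'
  have c7 : ContinuousOn (fun p : ℝ × ℝ × ℝ × ℝ => reflR p.2.1 p.2.2.2) K :=
    ContinuousOn.div (by fun_prop) (by fun_prop) fun p hp =>
      (add_pos (hE p hp).pos (hEI p hp).pos).ne'
  have c8 : ∀ h : ℝ, ContinuousOn
      (fun p : ℝ × ℝ × ℝ × ℝ => axisValue p.1 p.2.1 p.2.2.1 p.2.2.2 i h) K := fun h => by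
    unfold axisValue
    fun_prop
  obtain ⟨c, hc, h⟩ := hKc.exists_forall_le' ((c8 (2 / 3)).abs.add (c8 (3 / 4)).abs) (a := 0)
    fun p hp => by
      have hne : p.1 ≠ p.2.2.1 ∨ p.2.1 ≠ p.2.2.2 := by
        by_contra! hq
        have := hp.2.2
        rw [hq.1, hq.2] at this
        nlinarith
      rcases axisValue_ne_zero (hE p hp) (hEI p hp) hne i with h1 | h1
      · exact add_pos_of_pos_of_nonneg (abs_pos.2 h1) (abs_nonneg _)
      · exact add_pos_of_nonneg_of_pos (abs_nonneg _) (abs_pos.2 h1)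
  exact ⟨c, hc, fun lam mu lamI muI h1 h2 h3 => h (lam, mu, lamI, muI) ⟨h1, h2, h3⟩⟩

end

end

end LameSystem

theorem mainTheorem6 (α₀ γ₀ muBar lamBar η₀ : ℝ) (hα₀ : 0 < α₀) (hγ₀ : 0 < γ₀)
    (hmuBar : 0 < muBar) (hη₀ : 0 < η₀) :
    ∃ c : ℝ, 0 < c ∧
      ∀ lam mu lamI muI : ℝ,
        ModuliBounds α₀ γ₀ muBar lamBar lam mu →
        ModuliBounds α₀ γ₀ muBar lamBar lamI muI →
        η₀ ^ 2 ≤ (lam - lamI) ^ 2 + (mu - muI) ^ 2 →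
        ∀ i : Fin 3, ∃ lamW ∈ ({2 / 3, 3 / 4, 4 / 5} : Set ℝ),
          IsFundamentalMatrix lam mu lamI muI upperHalfSpace !₂[0, 0, -lamW]
            (fun x => fundamentalMatrix lam mu lamI muI upperHalfSpace x !₂[0, 0, -lamW]) ∧
          c ≤ |inner ℝ
            ((fundamentalMatrix lam mu lamI muI upperHalfSpace !₂[0, 0, -1] !₂[0, 0, -lamW]
              - kelvinMatrix lam mu !₂[0, 0, -1] !₂[0, 0, -lamW]) (e i)) (e i)| := by
  choose m hm hle using exists_pos_le_axisValue muBar lamBar hα₀ hγ₀ hη₀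
  have hpos : 0 < min (m 0) (min (m 1) (m 2)) := lt_min (hm 0) (lt_min (hm 1) (hm 2))
  -- One of the two axis values is at least half of the bound on their sum, and dividing by `1 + t <
  -- 2` costs another factor of two.
  refine ⟨min (m 0) (min (m 1) (m 2)) / 4, by positivity,
    fun lam mu lamI muI h hI hd i => ?_⟩
  have he := h.elliptic hα₀ hγ₀
  have heI := hI.elliptic hα₀ hγ₀
  have hmi : min (m 0) (min (m 1) (m 2)) ≤ m i := by
    fin_cases i <;> simp
  have hsum := hmi.trans (hle i lam mu lamI muI h hI hd)
  have key : ∀ t : ℝ, 0 < t → t < 1 →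
      min (m 0) (min (m 1) (m 2)) / 2 ≤ |axisValue lam mu lamI muI i t| →
      IsFundamentalMatrix lam mu lamI muI upperHalfSpace !₂[0, 0, -t]
        (fun x => fundamentalMatrix lam mu lamI muI upperHalfSpace x !₂[0, 0, -t]) ∧
      min (m 0) (min (m 1) (m 2)) / 4 ≤ |inner ℝ
        ((fundamentalMatrix lam mu lamI muI upperHalfSpace !₂[0, 0, -1] !₂[0, 0, -t]
          - kelvinMatrix lam mu !₂[0, 0, -1] !₂[0, 0, -t]) (e i)) (e i)| := by
    intro t ht ht1 hv
    rw [axis_neg, axis_neg, inner_fundamentalMatrix_sub he heI ht ht1.ne i]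
    refine ⟨fundamentalMatrix_spec (exists_isFundamentalMatrix he heI ht), ?_⟩
    rw [abs_div, abs_of_pos (by linarith : 0 < 1 + t), le_div_iff₀ (by linarith)]
    nlinarith
  by_cases hv : min (m 0) (min (m 1) (m 2)) / 2 ≤ |axisValue lam mu lamI muI i (2 / 3)|
  · exact ⟨2 / 3, by simp, key _ (by norm_num) (by norm_num) hv⟩
  · exact ⟨3 / 4, by simp, key _ (by norm_num) (by norm_num) (by linarith [not_le.1 hv])⟩
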